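/- **Setting.** Let $n=k+m$ and $\kappa_1<\dots<\kappa_n$ be real numbers. Put $\phi_i(\bar x,\bar y)=\kappa_i\bar x+\kappa_i^2\bar y+\kappa_i^3$ for $1\le i\le n$. For $\mathcal M\subseteq\binom{[n]}{k}$, the positroid cell $S^{tnn}_{\mathcal M}\subseteq (Gr_{k,n})_{\ge 0}$ is the set of points represented by full-rank real $k\times n$ matrices $A$ with $\Delta_J(A)>0$ for $J\in\mathcal M$ and $\Delta_J(A)=0$ for $J\notin\mathcal M$. The cell is irreducible if it is non-empty and the reduced row echelon matrix of each of its points has no zero column and in each row a non-zero entry besides the pivot. The contour plot $\mathcal C_\infty(\mathcal M)$ is the locus in $\mathbb R^2$ where $\max_{J\in\mathcal M}\sum_{j\in J}\phi_j(\bar x,\bar y)$ is not linear. For $r\in[n]$ let $I_r$ be the lexicographically minimal element of $\mathcal M$ for the order $r<r+1<\dots<n<1<\dots<r-1$. For an irreducible cell, $I_{i+1}=(I_i\setminus\{i\})\cup\{j\}$ with $j\ne i$ (indices modulo $n$), and $\pi=\pi(\mathcal M)\in S_n$ is defined by $\pi(j)=i$. A Le-diagram of type $(k,n)$ is a Young diagram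 inside a $k\times(n-k)$ rectangle with boxes filled by $0$ and $+$ such that no $0$ has both a $+$ above it in its column and a $+$ to its left in its row. Label the steps of its southeast border by $1,\dots,n$ from the northeast corner. Replace each $+$ by an elbow (one arc joining the bottom to the left side, one arc joining the right to the top side) and each $0$ by a cross, follow the pipes from southeast to northwest, and label the northwest end of each pipe by the label of its origin. The permutation $\pi(L)$ sends the label of each vertical (horizontal) step of the southeast border to the label at the other end of its row (column). The dual $L^*$ of $L$ is the Le-diagram with $\pi(L^*)=\iota\circ\pi(L)^{-1}\circ\iota$, where $\iota(j)=n+1-j$. The graph $G_-(L)$ is obtained from the pipes as follows. In every elbow, put a white vertex on the arc from the right to the top side and a black vertex on the arc from the bottom to the left side, and join the two by an edge. Erase the part of each row to the right of its last $+$ and the part of each column below its last $+$. Forget all vertices of degree $2$. Crossings are not vertices. The boundary vertices are the ends of the pipes on the west and north sides, with the pipe labels; those on the west side are placed at the top and those on the north side at the bottom. In a plane graph of this kind (a generalized plabic graph), the trip $T_i$ starts at the boundary vertex $i$, turns right at black and left at white vertices, goes straight through crossings, and ends at a boundary vertex $\pi_G(i)$, where $\pi_G$ is the trip permutation. Each edge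 is labelled by all $i$ for which $T_i$ travels along it; an edge with labels $i<j$ is said to be labelled $[i,j]$. **Theorem.** Let $S^{tnn}_{\mathcal M}=S^{tnn}_L=S^{tnn}_\pi$ be an irreducible positroid cell, that is, $\pi=\pi(\mathcal M)=\pi(L)$. Let $G_+(L)$ be the graph obtained from $G_-(L^*)$ by replacing every boundary label $j$ by $\pi(n+1-j)$ and drawing the resulting coloured graph as its mirror image (orientation reversed, colours kept, west side still at the top). Then: 1. $G_+(L)$ has trip permutation $\pi$. Every edge of $G_+(L)$ gets exactly two labels $i<j$. Every internal vertex is trivalent, with edges labelled $[i,\ell],[i,p],[\ell,p]$ for some $i<\ell<p$, and distinct vertices have distinct label triples. 2. $G_+(L)$ explicitly yields $\mathcal C_\infty(\mathcal M)$. Place the vertex with labels $i,\ell,p$ at $(\bar x,\bar y)=(\kappa_i\kappa_\ell+\kappa_i\kappa_p+\kappa_\ell\kappa_p,\,-(\kappa_i+\kappa_\ell+\kappa_p))$. Draw each edge between two internal vertices as a straight segment. Draw each edge labelled $[i,j]$ from an internal vertex to a boundary vertex as a ray of slope $\kappa_i+\kappa_j$, that is, with direction $\pm(-(\kappa_i+\kappa_j),1)$,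 going up if the boundary vertex is at the top and down if it is at the bottom. Draw each edge labelled $[i,j]$ between two boundary vertices as the whole line $\phi_i=\phi_j$. Then the union of these edges is $\mathcal C_\infty(\mathcal M)$. 3. Each edge labelled $[i,j]$ is a line-soliton of type $[i,j]$: it lies on the line $\phi_i=\phi_j$ (so bounded edges also have slope $\kappa_i+\kappa_j$), and at each of its points there is a set $S$ with $i,j\notin S$ such that $S\cup\{i\}$ and $S\cup\{j\}$ both belong to $\mathcal M$ and attain the maximum. Distinct edges meet in at most one point. -/

import Mathlib

/-! ### Positroid cells of the totally non-negative Grassmannian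

The ground set `[n] = {1, …, n}` is modelled by `Fin n`, so the index `j` of the usual notation is
`j - 1` here, the involution `j ↦ n + 1 - j` is `Fin.rev`, and `i ↦ i + 1 (mod n)` is
`finRotate n`. -/

/-- The maximal minor of `A` in the column set `{e 0 < e 1 < ⋯}`. -/
noncomputable def maxMinor {k n : ℕ} (A : Matrix (Fin k) (Fin n) ℝ) (e : Fin k ↪o Fin n) : ℝ :=
  (A.submatrix id e).det

/-- The full-rank matrix `A` represents a point of `S_M^{tnn}`: its maximal minors are positive on
`M` and vanish outside `M`. -/
def InCell {k n : ℕ} (M : Finset (Finset (Fin n))) (A : Matrix (Fin k) (Fin n) ℝ) : Prop :=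
  A.rank = k ∧ (∀ J ∈ M, J.card = k) ∧
    ∀ e : Fin k ↪o Fin n,
      (Finset.univ.map e.toEmbedding ∈ M → 0 < maxMinor A e) ∧
      (Finset.univ.map e.toEmbedding ∉ M → maxMinor A e = 0)

/-- `A` is in reduced row echelon form, the pivot of row `i` being in column `p i`. -/
structure IsRREF {k n : ℕ} (A : Matrix (Fin k) (Fin n) ℝ) (p : Fin k → Fin n) : Prop where
  strictMono : StrictMono p
  pivot : ∀ i i', A i' (p i) = if i' = i then 1 else 0
  left_zero : ∀ i j, j < p i → A i j = 0

/-- `S_M^{tnn} ⊆ (Gr_{k,n})_{≥ 0}` is a (non-empty) irreducible positroid cell: in the reduced row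
echelon matrix of each of its points every column is non-zero and every row has a non-zero
entry besides its pivot. -/
def IsIrreduciblePositroid (k : ℕ) {n : ℕ} (M : Finset (Finset (Fin n))) : Prop :=
  (∃ A : Matrix (Fin k) (Fin n) ℝ, InCell M A) ∧
    ∀ (A : Matrix (Fin k) (Fin n) ℝ) (p : Fin k → Fin n), InCell M A → IsRREF A p →
      (∀ j, ∃ i, A i j ≠ 0) ∧ ∀ i, ∃ j, j ≠ p i ∧ A i j ≠ 0

/-- `I` is the lexicographically minimal element of `M` with respect to the order
`r < r + 1 < ⋯ < n < 1 < ⋯ < r - 1`. The position of `a` in this order is the difference `a - r`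
taken modulo `n`; for sets of equal size the lexicographically smaller one is the one that contains
the smallest element of the symmetric difference. -/
def IsLexMin {n : ℕ} (M : Finset (Finset (Fin n))) (r : Fin n) (I : Finset (Fin n)) : Prop :=
  I ∈ M ∧ ∀ J ∈ M, J ≠ I → ∃ a ∈ I \ J, ∀ b ∈ J \ I, a - r < b - r

/-- `π = π(𝓘(M))`: if `(I_1, …, I_n)` is the Grassmann necklace of `M` and
`I_{i+1} = (I_i \ {i}) ∪ {j}` with `j ≠ i`, then `π(j) = i`. -/
def HasNecklacePerm {n : ℕ} (M : Finset (Finset (Fin n))) (π : Equiv.Perm (Fin n)) : Prop :=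
  ∃ I : Fin n → Finset (Fin n), (∀ r, IsLexMin M r (I r)) ∧
    ∀ i, π.symm i ≠ i ∧ I (finRotate n i) = insert (π.symm i) ((I i).erase i)

/-- The dual permutation `ι ∘ π⁻¹ ∘ ι`, where `ι(j) = n + 1 - j`. -/
def dualPerm {n : ℕ} (π : Equiv.Perm (Fin n)) : Equiv.Perm (Fin n) :=
  Fin.revPerm * π⁻¹ * Fin.revPerm

/-! ### Le-diagrams -/

/-- A Le-diagram of type `(k, k + m)`: a Young diagram inside the `k × m` rectangle (the box in
row `i` from the top and column `j` from the left is `(i, j)`, both counted from `0`), together with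
the set of boxes filled with `+` (the others are filled with `0`). -/
structure LeDiagram (k m : ℕ) where
  shape : YoungDiagram
  row_lt : ∀ X ∈ shape, X.1 < k
  col_lt : ∀ X ∈ shape, X.2 < m
  plus : Finset (ℕ × ℕ)
  plus_subset : ∀ X ∈ plus, X ∈ shape
  /-- No `0` has both a `+` above it in its column and a `+` to its left in its row. -/
  le_property : ∀ i j i' j', (i, j) ∈ shape → i' < i → j' < j →
    (i', j) ∈ plus → (i, j') ∈ plus → (i, j) ∈ plus

namespace LeDiagram

variable {k m : ℕ} (L : LeDiagram k m)

theorem colLen_le (c : ℕ) : L.shape.colLen c ≤ k := by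
  by_contra h
  exact absurd (L.row_lt (k, c) (YoungDiagram.mem_iff_lt_colLen.2 (not_le.1 h))) (lt_irrefl k)

/-- The label of the vertical step of row `r` on the southeast border, whose `k + m` steps are
labelled consecutively starting at the northeast corner of the rectangle. -/
def rowLabel (r : Fin k) : Fin (k + m) :=
  ⟨r + (m - L.shape.rowLen r), by have := r.2; omega⟩

/-- The label of the horizontal step of column `c` on the southeast border. -/
def colLabel (c : Fin m) : Fin (k + m) :=
  ⟨(m - 1 - c) + L.shape.colLen c, by have := c.2; have := L.colLen_le c; omega⟩

mutual

/-- The label of the pipe that passes through the vertical unit segment at the left of box `(r, c)`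
(at the right of box `(r, c - 1)`), found by following the pipe back to its origin on the southeast
border. In a box with `+` (an elbow) the pipe that leaves through the left side has entered through
the bottom side, in a box with `0` (a cross) through the right side. -/
def vLabel (r : Fin k) (c : ℕ) : Fin (k + m) :=
  if h : ((r : ℕ), c) ∈ L.shape then
    if ((r : ℕ), c) ∈ L.plus then hLabel (r + 1) ⟨c, L.col_lt _ h⟩ else vLabel r (c + 1)
  else L.rowLabel r
termination_by k + m - r - c
decreasing_by
  all_goals
    have h1 := L.col_lt _ h
    have h2 := r.2
    simp only at h1 ⊢
    omega

/-- The label of the pipe that passes through the horizontal unit segment at the top of box `(r, c)`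
(at the bottom of box `(r - 1, c)`). In a box with `+` the pipe that leaves through the top side has
entered through the right side, in a box with `0` through the bottom side. -/
def hLabel (r : ℕ) (c : Fin m) : Fin (k + m) :=
  if h : (r, (c : ℕ)) ∈ L.shape then
    if (r, (c : ℕ)) ∈ L.plus then vLabel ⟨r, L.row_lt _ h⟩ (c + 1) else hLabel (r + 1) c
  else L.colLabel c
termination_by k + m - r - c
decreasing_by
  all_goals
    have h1 := L.row_lt _ h
    have h2 := c.2
    simp only at h1 ⊢
    omega

end

/-- `π = π(L)`: the label of each step of the southeast border is sent to the label of the pipe that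
ends at the opposite side of the same row or column. -/
def HasPerm (π : Equiv.Perm (Fin (k + m))) : Prop :=
  (∀ r : Fin k, π (L.rowLabel r) = L.vLabel r 0) ∧
    ∀ c : Fin m, π (L.colLabel c) = L.hLabel 0 c

/-- `L'` is the dual of `L`: `π(L')` is the dual of `π(L)`. -/
def IsDual (L L' : LeDiagram k m) : Prop :=
  ∃ π, L.HasPerm π ∧ L'.HasPerm (dualPerm π)

end LeDiagram

/-! ### Generalized plabic graphs -/

/-- The data of a generalized plabic graph drawn in a disk: coloured internal vertices, boundary
vertices labelled by `Fin n`, half-edges (darts), and the counterclockwise rotation of the darts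
around each internal vertex. Edges may cross each other; crossings are not vertices, and an edge
goes straight through them, so they leave no trace in the data. Only darts that are joined to some
dart are present in the graph, and only vertices with a present dart. -/
structure PlabicGraph (n : ℕ) where
  Vertex : Type
  Bdry : Type
  Dart : Type
  /-- The black vertices; the others are white. -/
  black : Vertex → Prop
  /-- The vertex at which a dart is based. -/
  base : Dart → Vertex ⊕ Bdry
  /-- `Joined d e`: the darts `d` and `e` are the two halves of one edge. -/
  Joined : Dart → Dart → Prop
  /-- The next dart in counterclockwise order around the same vertex. -/
  ccw : Equiv.Perm Dart
  label : Bdry → Fin n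
  /-- The boundary vertices on the upper part of the boundary of the disk; the others are on the
  lower part. -/
  top : Bdry → Prop

namespace PlabicGraph

variable {n : ℕ} (G : PlabicGraph n)

def Present (d : G.Dart) : Prop := ∃ e, G.Joined d e

def IsVertex (v : G.Vertex) : Prop := ∃ d, G.base d = .inl v ∧ G.Present d

def IsDegreeTwo (v : G.Vertex) : Prop := {d | G.base d = .inl v ∧ G.Present d}.ncard = 2

/-- `Chain d e`: starting along `d` and passing through vertices of degree two only, one may
arrive along `e`. -/
inductive Chain : G.Dart → G.Dart → Prop
  | edge {d e} : G.Joined d e → Chain d e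
  | pass {d e f g v} : Chain d e → G.base e = .inl v → G.base f = .inl v → G.IsDegreeTwo v →
      e ≠ f → G.Joined f g → Chain d g

/-- The dart `d` is present and is not based at a vertex of degree two. -/
def Essential (d : G.Dart) : Prop :=
  G.Present d ∧ ∀ v, G.base d = .inl v → ¬ G.IsDegreeTwo v

/-- Forget the vertices of degree two. -/
def forgetDegreeTwo : PlabicGraph n :=
  { G with Joined := fun d e => G.Essential d ∧ G.Essential e ∧ G.Chain d e }

/-- Replace each boundary label `j` by `f j`. -/
def relabel (f : Fin n → Fin n) : PlabicGraph n :=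
  { G with label := fun b => f (G.label b) }

/-- The mirror image: the same coloured graph, drawn with the opposite orientation. -/
def mirror : PlabicGraph n :=
  { G with ccw := G.ccw.symm }

/-- `OnTrip i d`: the trip `T_i` travels along the edge of `d`, away from the base of `d`. The trip
starts at the boundary vertex `i`; arriving at a vertex along `e`, it turns right at a black vertex
(the counterclockwise successor of `e`) and left at a white one (the clockwise successor). -/
inductive OnTrip (i : Fin n) : G.Dart → Prop
  | start {d b} : G.base d = .inr b → G.label b = i → G.Present d → OnTrip i d
  | turnRight {d e v} : OnTrip i d → G.Joined d e → G.base e = .inl v → G.black v →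
      OnTrip i (G.ccw e)
  | turnLeft {d e v} : OnTrip i d → G.Joined d e → G.base e = .inl v → ¬ G.black v →
      OnTrip i (G.ccw.symm e)

/-- The trip permutation is `π`: `T_i` ends at the boundary vertex `π i`. -/
def HasTripPerm (π : Equiv.Perm (Fin n)) : Prop :=
  ∀ i j, (∃ d e b, G.OnTrip i d ∧ G.Joined d e ∧ G.base e = .inr b ∧ G.label b = j) ↔ π i = j

open Classical in
/-- The labels of the edge of `d`: all `i` such that `T_i` travels along this edge. -/
noncomputable def edgeLabels (d : G.Dart) : Finset (Fin n) :=
  Finset.univ.filter fun i => G.OnTrip i d ∨ ∃ e, G.Joined d e ∧ G.OnTrip i e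

open Classical in
/-- All labels of the edges incident to the vertex `v`. -/
noncomputable def vertexLabels (v : G.Vertex) : Finset (Fin n) :=
  Finset.univ.filter fun i => ∃ d, G.base d = .inl v ∧ i ∈ G.edgeLabels d

end PlabicGraph

/-! ### The graph of a Le-diagram -/

/-- The darts of the graph of a Le-diagram. Each box with a `+` is an elbow: one arc joins its top
side to its right side, the other its left side to its bottom side. The first arc carries a white
vertex and the second a black one, joined by a new (diagonal) edge. So the white vertex has darts
to the top, right and diagonal, the black one has darts diagonal, to the left and to the bottom. -/
inductive LeDart (k m : ℕ) : Type
  | whiteTop (X : ℕ × ℕ)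
  | whiteRight (X : ℕ × ℕ)
  | whiteDiag (X : ℕ × ℕ)
  | blackDiag (X : ℕ × ℕ)
  | blackLeft (X : ℕ × ℕ)
  | blackBottom (X : ℕ × ℕ)
  | west (r : Fin k)
  | north (c : Fin m)

namespace LeDart

variable {k m : ℕ}

/-- The vertices are `(true, X)`, the black vertex of box `X`, and `(false, X)`, the white one. The
boundary vertices lie on the west side (one for each row) and on the north side (one for each
column) of the diagram. -/
def base : LeDart k m → (Bool × ℕ × ℕ) ⊕ (Fin k ⊕ Fin m)
  | whiteTop X => .inl (false, X)
  | whiteRight X => .inl (false, X)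
  | whiteDiag X => .inl (false, X)
  | blackDiag X => .inl (true, X)
  | blackLeft X => .inl (true, X)
  | blackBottom X => .inl (true, X)
  | west r => .inr (.inl r)
  | north c => .inr (.inr c)

/-- The counterclockwise order: top, diagonal, right at a white vertex (which is northeast of the
black vertex of the same box) and diagonal, left, bottom at a black one. -/
def ccw : Equiv.Perm (LeDart k m) where
  toFun
    | whiteTop X => whiteDiag X
    | whiteDiag X => whiteRight X
    | whiteRight X => whiteTop X
    | blackDiag X => blackLeft X
    | blackLeft X => blackBottom X
    | blackBottom X => blackDiag X
    | west r => west r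
    | north c => north c
  invFun
    | whiteTop X => whiteRight X
    | whiteDiag X => whiteTop X
    | whiteRight X => whiteDiag X
    | blackDiag X => blackBottom X
    | blackLeft X => blackDiag X
    | blackBottom X => blackLeft X
    | west r => west r
    | north c => north c
  left_inv := by rintro (_ | _ | _ | _ | _ | _ | _ | _) <;> rfl
  right_inv := by rintro (_ | _ | _ | _ | _ | _ | _ | _) <;> rfl

end LeDart

namespace LeDiagram

variable {k m : ℕ} (L : LeDiagram k m)

/-- The edges of the graph. Between boxes with `+` the pipes run straight through the crosses. The
pieces of pipes that end at the southeast border (to the right of the last `+` of a row, below the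
last `+` of a column) are erased, so they do not occur here. -/
inductive Glue : LeDart k m → LeDart k m → Prop
  | diag {X} : X ∈ L.plus → Glue (.whiteDiag X) (.blackDiag X)
  | row {r a b} : (r, a) ∈ L.plus → (r, b) ∈ L.plus → a < b →
      (∀ c, a < c → c < b → (r, c) ∉ L.plus) → Glue (.whiteRight (r, a)) (.blackLeft (r, b))
  | col {a b c} : (a, c) ∈ L.plus → (b, c) ∈ L.plus → a < b →
      (∀ r, a < r → r < b → (r, c) ∉ L.plus) → Glue (.blackBottom (a, c)) (.whiteTop (b, c))
  | west {r : Fin k} {a} : ((r : ℕ), a) ∈ L.plus → (∀ c, c < a → ((r : ℕ), c) ∉ L.plus) →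
      Glue (.west r) (.blackLeft (r, a))
  | north {a} {c : Fin m} : (a, (c : ℕ)) ∈ L.plus → (∀ r, r < a → (r, (c : ℕ)) ∉ L.plus) →
      Glue (.north c) (.whiteTop (a, c))

/-- The graph of `L` before the vertices of degree two are forgotten. Each boundary vertex is
labelled by the pipe that ends there; the diagram is rotated so that its west side is at the top of
the disk, the north side then being at the bottom. -/
def pipeGraph : PlabicGraph (k + m) where
  Vertex := Bool × ℕ × ℕ
  Bdry := Fin k ⊕ Fin m
  Dart := LeDart k m
  black v := v.1 = true
  base := LeDart.base
  Joined d e := L.Glue d e ∨ L.Glue e d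
  ccw := LeDart.ccw
  label := Sum.elim (fun r => L.vLabel r 0) (fun c => L.hLabel 0 c)
  top b := b.isLeft = true

/-- The generalized plabic graph `G_-(L)`. -/
def graphMinus : PlabicGraph (k + m) := L.pipeGraph.forgetDegreeTwo

/-- The generalized plabic graph `G_+(L)`, where `π = π(L)` and `Ldual` is the dual of `L`: the
graph `G_-(Ldual)` with each boundary label `j` replaced by `π (n + 1 - j)`, drawn as its mirror
image. -/
def graphPlus (π : Equiv.Perm (Fin (k + m))) (Ldual : LeDiagram k m) : PlabicGraph (k + m) :=
  (Ldual.graphMinus.relabel fun j => π j.rev).mirror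

end LeDiagram

/-! ### Contour plots -/

/-- `φ_i(x, y) = κ_i x + κ_i² y + κ_i³`. -/
def phase {n : ℕ} (κ : Fin n → ℝ) (i : Fin n) (p : ℝ × ℝ) : ℝ :=
  κ i * p.1 + κ i ^ 2 * p.2 + κ i ^ 3

/-- `∑_{j ∈ J} φ_j(x, y)`. -/
def phaseSum {n : ℕ} (κ : Fin n → ℝ) (J : Finset (Fin n)) (p : ℝ × ℝ) : ℝ :=
  ∑ j ∈ J, phase κ j p

/-- The contour plot `C_∞(M)`: the points near which the maximum of the functions `∑_{j ∈ J} φ_j`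
over `J ∈ M` is not given by one linear (affine) function. -/
def contourPlot {n : ℕ} (κ : Fin n → ℝ) (M : Finset (Finset (Fin n))) : Set (ℝ × ℝ) :=
  {p | ¬ ∃ a b c : ℝ, ∀ᶠ q : ℝ × ℝ in nhds p,
    (⨆ J : {J // J ∈ M}, phaseSum κ J.1 q) = a * q.1 + b * q.2 + c}

/-- `J ∈ M` attains the maximum at the point `p`. -/
def IsDominant {n : ℕ} (κ : Fin n → ℝ) (M : Finset (Finset (Fin n))) (p : ℝ × ℝ)
    (J : Finset (Fin n)) : Prop :=
  J ∈ M ∧ ∀ J' ∈ M, phaseSum κ J' p ≤ phaseSum κ J p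

/-- At `p` there is a balance of two dominant terms `S ∪ {i}` and `S ∪ {j}`, as on a line-soliton of
type `[i, j]`. -/
def IsBalanced {n : ℕ} (κ : Fin n → ℝ) (M : Finset (Finset (Fin n))) (i j : Fin n)
    (p : ℝ × ℝ) : Prop :=
  ∃ S : Finset (Fin n), i ∉ S ∧ j ∉ S ∧
    IsDominant κ M p (insert i S) ∧ IsDominant κ M p (insert j S)

namespace PlabicGraph

variable {n : ℕ} (G : PlabicGraph n) (κ : Fin n → ℝ)

/-- A vertex with labels `i, l, m` is placed at the point with coordinates
`(κ_i κ_l + κ_i κ_m + κ_l κ_m, - (κ_i + κ_l + κ_m))`. -/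
noncomputable def position (v : G.Vertex) : ℝ × ℝ :=
  (∑ s ∈ (G.vertexLabels v).powersetCard 2, ∏ i ∈ s, κ i, - ∑ i ∈ G.vertexLabels v, κ i)

/-- The slope `κ_i + κ_j` of an edge of type `[i, j]`. It is the tangent of the angle measured
counterclockwise from the positive `y`-axis, so the edge has direction `(- (κ_i + κ_j), 1)`. -/
noncomputable def slope (d : G.Dart) : ℝ := ∑ i ∈ G.edgeLabels d, κ i

/-- The unbounded edge of `d` from the vertex `v` to the boundary vertex `b`, as a ray that starts at
the position of `v` and goes up or down according to the place of `b`. -/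
def ray (d : G.Dart) (v : G.Vertex) (b : G.Bdry) : Set (ℝ × ℝ) :=
  {q | ∃ a : ℝ, (G.top b → 0 ≤ a) ∧ (¬ G.top b → a ≤ 0) ∧
    q = G.position κ v + a • ((- G.slope κ d, 1) : ℝ × ℝ)}

/-- The placement in the plane of the edge with darts `d` and `e`: a segment if it is bounded, a ray
if one end is on the boundary, and the whole line `φ_i = φ_j` if it has type `[i, j]` and joins two
boundary vertices. -/
def edgeSet (d e : G.Dart) : Set (ℝ × ℝ) :=
  match G.base d, G.base e with
  | .inl v, .inl w => segment ℝ (G.position κ v) (G.position κ w)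
  | .inl v, .inr b => G.ray κ d v b
  | .inr b, .inl v => G.ray κ d v b
  | .inr _, .inr _ =>
      {q | ∃ i ∈ G.edgeLabels d, ∃ j ∈ G.edgeLabels d, i < j ∧ phase κ i q = phase κ j q}

end PlabicGraph

/-! ### Exchange properties of the bases of a vector configuration -/

section VectorConfiguration

variable {ι E : Type*} [AddCommGroup E] [Module ℝ E]

-- A point of the cell is a matrix whose columns have `M` as their set of bases. Fix a point `p` of
-- the plane and give `j` the weight `φ_j(p)`; the dominant terms at `p` are the bases of maximal
-- weight. By the greedy principle, `i` and `j` with equal weight are balanced exactly when their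
-- columns are non-zero and parallel modulo the span of the heavier columns, ties being resolved in
-- a suitable way (`parallelMod_of_balanced`, `exists_balanced_of_parallelMod`). Symmetric exchange
-- shows that every point of the contour plot has such a balance.
--
-- Reverse the ground set and put `κ' l = - κ (rev l)`. On a line `φ_i = φ_j` the phase differences
-- are the values of a cubic with roots `κ' i`, `κ' j` and a third root `r`, which is a coordinate
-- on the line. Hence the set of heavier elements depends only on the gap `σ` of the sequence `κ'`
-- in which `r` lies. This set, `upperSet i j σ`, is always an initial segment together with an
-- interval. What remains is independent of `κ`: for which `(i, j, σ)` are the columns `i`, `j`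
-- parallel modulo `upperSet i j σ`?
--
-- The Grassmann necklace answers this for cyclic intervals, and this is the information read off at
-- the north and west sides of the dual Le-diagram. It is carried through the diagram box by box,
-- from northwest to southeast, so that every pipe label becomes a threshold for a membership in a
-- span. At a cross, linear algebra suffices (`labels_cross`). At an elbow there are two
-- possibilities, one of which contradicts total positivity (`not_crossing`, `labels_elbow`). The
-- Le-property guarantees that in each box the labels are ordered as these lemmas require
-- (`vLabel_lt_hLabel`). The parallel triples then correspond to the edges of the pipe graph:
-- vertical, horizontal or diagonal, according to whether `r` is below, above or between `κ' i` and
-- `κ' j` (`exists_joined_of_parallelMod`, `parallelMod_of_joined`).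
--
-- On the side of the graph, the trip travelling along a dart is computed by an invariant
-- (`onTrip_iff`). So the two labels of an edge name its line, and the third label at each end says
-- where `r` starts and stops. Comparison with the parallel triples gives the contour plot.

theorem LinearIndepOn.mem_span_image_inter {a : ι → E} {J T : Set ι} {x : E}
    (hJ : LinearIndepOn ℝ a J) (hx : x ∈ Submodule.span ℝ (a '' J))
    (h : ∀ b ∈ J, b ∉ T → x ∈ Submodule.span ℝ (a '' (J \ {b}))) :
    x ∈ Submodule.span ℝ (a '' (J ∩ T)) := by
  rw [Finsupp.mem_span_image_iff_linearCombination] at hx ⊢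
  obtain ⟨f, hf, rfl⟩ := hx
  refine ⟨f, fun b hb => ?_, rfl⟩
  have hbJ : b ∈ J := hf hb
  refine ⟨hbJ, ?_⟩
  by_contra hbT
  obtain ⟨g, hg, hgf⟩ := (Finsupp.mem_span_image_iff_linearCombination ℝ).1 (h b hbJ hbT)
  -- Coordinates over an independent family are unique, so the combination that avoids `b` is `f`
  -- itself.
  have hfg : g = f := linearIndepOn_iffₛ.1 hJ g (fun y hy => (hg hy).1) f hf hgf
  subst hfg
  exact (hg hb).2 rfl

/-- The vectors `a i` and `a j` are parallel and non-zero modulo the span of the vectors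
indexed by `U`. -/
def ParallelMod (a : ι → E) (U : Set ι) (i j : ι) : Prop :=
  a j ∉ Submodule.span ℝ (a '' U) ∧ a j ∈ Submodule.span ℝ (a '' insert i U)

theorem ParallelMod.symm {a : ι → E} {U : Set ι} {i j : ι} (h : ParallelMod a U i j) :
    ParallelMod a U j i := by
  obtain ⟨h1, h2⟩ := h
  refine ⟨fun hi => h1 ?_, ?_⟩
  · rw [Set.image_insert_eq, Submodule.span_insert_eq_span hi] at h2
    exact h2
  · rw [Set.image_insert_eq] at h2 ⊢
    exact mem_span_insert_exchange h2 h1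

variable [DecidableEq ι]

/-- `M` is the set of the bases of the vector configuration `a`. -/
structure Represents (M : Finset (Finset ι)) (a : ι → E) : Prop where
  nonempty : M.Nonempty
  indep : ∀ J ∈ M, LinearIndepOn ℝ a (J : Set ι)
  spans : ∀ J ∈ M, ∀ l, a l ∈ Submodule.span ℝ (a '' (J : Set ι))
  exchange : ∀ J ∈ M, ∀ b ∈ J, ∀ l, a l ∉ Submodule.span ℝ (a '' ((J : Set ι) \ {b})) →
    insert l (J.erase b) ∈ M

theorem notMem_erase_of_notMem_span {a : ι → E} {J : Finset ι} {b l : ι}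
    (h : a l ∉ Submodule.span ℝ (a '' ((J : Set ι) \ {b}))) : l ∉ J.erase b := fun hl =>
  h (Submodule.subset_span ⟨l, by simpa [and_comm] using hl, rfl⟩)

theorem Represents.notMem_span_erase {M : Finset (Finset ι)} {a : ι → E} (hM : Represents M a)
    {J : Finset ι} (hJ : J ∈ M) {b : ι} (hb : b ∈ J) :
    a b ∉ Submodule.span ℝ (a '' ((J : Set ι) \ {b})) := by
  have h := hM.indep J hJ
  rw [linearIndepOn_iff_notMem_span] at h
  exact h b hb

/-- If no `b` worked, every `b` that occurs in the expansion of `a l` over `J` would lie in the span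
of `J' \ {l}`. Then `a l` would lie there too, against the independence of `J'`. -/
theorem Represents.symmetric_exchange {M : Finset (Finset ι)} {a : ι → E} (hM : Represents M a)
    {J J' : Finset ι} (hJ : J ∈ M) (hJ' : J' ∈ M) {l : ι} (hl : l ∈ J') (hlJ : l ∉ J) :
    ∃ b ∈ J, b ∉ J' ∧ insert l (J.erase b) ∈ M ∧ insert b (J'.erase l) ∈ M := by
  by_contra! hcon
  have key : a l ∈ Submodule.span ℝ
      (a '' ((J : Set ι) ∩ {b | a b ∈ Submodule.span ℝ (a '' ((J' : Set ι) \ {l}))})) := by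
    refine (hM.indep J hJ).mem_span_image_inter (hM.spans J hJ l) fun b hb hb' => ?_
    by_contra h
    refine hcon b hb (fun hbJ' => hb' (Submodule.subset_span ⟨b, ⟨hbJ', ?_⟩, rfl⟩))
      (hM.exchange J hJ b hb l h) (hM.exchange J' hJ' l hl b hb')
    rintro rfl
    exact hlJ hb
  refine hM.notMem_span_erase hJ' hl (Submodule.span_le.2 ?_ key)
  rintro _ ⟨b, hb, rfl⟩
  exact hb.2

/-- `J ∈ M` has the maximal weight. -/
def IsMaxWeight (M : Finset (Finset ι)) (w : ι → ℝ) (J : Finset ι) : Prop :=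
  J ∈ M ∧ ∀ J' ∈ M, ∑ j ∈ J', w j ≤ ∑ j ∈ J, w j

theorem sum_insert_erase {w : ι → ℝ} {J : Finset ι} {b l : ι} (hb : b ∈ J) (hl : l ∉ J.erase b) :
    ∑ j ∈ insert l (J.erase b), w j = ∑ j ∈ J, w j + (w l - w b) := by
  rw [Finset.sum_insert hl, ← Finset.add_sum_erase J w hb]
  ring

theorem IsMaxWeight.le_of_exchange {M : Finset (Finset ι)} {a : ι → E} (hM : Represents M a)
    {w : ι → ℝ} {J : Finset ι} (hJ : IsMaxWeight M w J) {b l : ι} (hb : b ∈ J)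
    (h : a l ∉ Submodule.span ℝ (a '' ((J : Set ι) \ {b}))) : w l ≤ w b := by
  have h1 := hJ.2 _ (hM.exchange J hJ.1 b hb l h)
  rw [sum_insert_erase hb (notMem_erase_of_notMem_span h)] at h1
  linarith

theorem IsMaxWeight.exchange {M : Finset (Finset ι)} {a : ι → E} (hM : Represents M a)
    {w : ι → ℝ} {J : Finset ι} (hJ : IsMaxWeight M w J) {b l : ι} (hb : b ∈ J)
    (h : a l ∉ Submodule.span ℝ (a '' ((J : Set ι) \ {b}))) (hw : w b ≤ w l) :
    IsMaxWeight M w (insert l (J.erase b)) := by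
  refine ⟨hM.exchange J hJ.1 b hb l h, fun J' hJ' => (hJ.2 J' hJ').trans ?_⟩
  rw [sum_insert_erase hb (notMem_erase_of_notMem_span h)]
  linarith

/-- Greedy principle: the expansion of an element over a basis of maximal weight uses only elements
at least as heavy. So the elements heavier than `i` are spanned by members of `S`, and `a j` is
spanned by `a i` and members of `S` that are no lighter. Elements tied with `i` are admitted to the
modulus according to their membership in `S`. -/
theorem parallelMod_of_balanced {M : Finset (Finset ι)} {a : ι → E} (hM : Represents M a)
    {w : ι → ℝ} {S : Finset ι} {i j : ι} (hiS : i ∉ S) (hjS : j ∉ S) (hij : i ≠ j)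
    (hw : w i = w j) (hi : IsMaxWeight M w (insert i S)) (hj : IsMaxWeight M w (insert j S)) :
    ParallelMod a {l | w i < w l ∨ (w l = w i ∧ l ∈ S)} i j := by
  constructor
  · have hjn := hM.notMem_span_erase hj.1 (Finset.mem_insert_self j S)
    refine fun h => hjn (Submodule.span_le.2 ?_ h)
    rintro _ ⟨u, hu, rfl⟩
    have hsub : ((insert i S : Finset ι) : Set ι) ∩ {l | w i < w l} ⊆
        ((insert j S : Finset ι) : Set ι) \ {j} := by
      rintro l ⟨hl, hl'⟩
      simp only [Finset.coe_insert, Set.mem_insert_iff, Finset.mem_coe] at hl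
      rcases hl with rfl | hl
      · exact (lt_irrefl (w l) hl').elim
      · exact ⟨by simp [hl], fun h => hjS (h ▸ hl)⟩
    rcases hu with hu | hu
    · refine Submodule.span_mono (Set.image_mono hsub) ?_
      refine (hM.indep _ hi.1).mem_span_image_inter (hM.spans _ hi.1 u) fun b hb hb' => ?_
      by_contra h'
      have := hi.le_of_exchange hM hb h'
      simp only [Set.mem_ofPred_eq, not_lt] at hb'
      linarith
    · exact Submodule.subset_span ⟨u, ⟨by simp [hu.2], fun h => hjS (h ▸ hu.2)⟩, rfl⟩
  · refine Submodule.span_mono (Set.image_mono Set.inter_subset_right)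
      ((hM.indep _ hi.1).mem_span_image_inter (hM.spans _ hi.1 j) fun b hb hb' => ?_)
    by_contra h'
    have h1 := hi.le_of_exchange hM hb h'
    simp only [Set.mem_insert_iff, Set.mem_ofPred_eq, not_or, not_lt, not_and] at hb'
    simp only [Finset.coe_insert, Set.mem_insert_iff, Finset.mem_coe] at hb
    rcases hb with rfl | hb
    · exact hb'.1 rfl
    · exact hb'.2.2 (le_antisymm hb'.2.1 (hw ▸ h1)) hb

-- `U` may contain any selection of the elements tied with `i`. Among the bases of maximal weight
-- take one that meets `U` in as many elements as possible. Its elements in `U` span `U`, because an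
-- element outside `U` occurring in the expansion of some `u ∈ U` could be traded for `u` without
-- losing weight. Then `i` is brought in at the expense of an element outside `U`, and is finally
-- traded for `j`.
open Classical in
theorem exists_balanced_of_parallelMod {M : Finset (Finset ι)} {a : ι → E} (hM : Represents M a)
    {w : ι → ℝ} {i j : ι} (hij : i ≠ j) (hw : w i = w j) {U : Set ι}
    (hU : ∀ l, w i < w l → l ∈ U) (hU' : ∀ l ∈ U, w i ≤ w l) (hpar : ParallelMod a U i j) :
    ∃ S, i ∉ S ∧ j ∉ S ∧ IsMaxWeight M w (insert i S) ∧ IsMaxWeight M w (insert j S) := by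
  have hne : (M.filter fun J => IsMaxWeight M w J).Nonempty := by
    obtain ⟨J, hJ, hJ'⟩ := Finset.exists_max_image M (fun J => ∑ j ∈ J, w j) hM.nonempty
    exact ⟨J, Finset.mem_filter.2 ⟨hJ, hJ, hJ'⟩⟩
  obtain ⟨J, hJ, hJU⟩ := Finset.exists_max_image _ (fun J => (J.filter (· ∈ U)).card) hne
  have hJ := (Finset.mem_filter.1 hJ).2
  have hJU : ∀ J', IsMaxWeight M w J' → (J'.filter (· ∈ U)).card ≤ (J.filter (· ∈ U)).card :=
    fun J' h => hJU J' (Finset.mem_filter.2 ⟨h.1, h⟩)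
  -- the elements of `J` in `U` span `U`
  have span_of_max : ∀ J, IsMaxWeight M w J →
      (∀ J', IsMaxWeight M w J' → (J'.filter (· ∈ U)).card ≤ (J.filter (· ∈ U)).card) →
      ∀ u ∈ U, a u ∈ Submodule.span ℝ (a '' ((J : Set ι) ∩ U)) := by
    intro J hJ hJU u hu
    refine (hM.indep J hJ.1).mem_span_image_inter (hM.spans J hJ.1 u) fun b hb hbU => ?_
    by_contra h
    have h1 := hJ.le_of_exchange hM hb h
    have h2 : w b ≤ w i := not_lt.1 fun h => hbU (hU b h)
    have h3 := hU' u hu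
    have h4 := hJU _ (hJ.exchange hM hb h (by linarith))
    rw [Finset.filter_insert, if_pos hu, Finset.card_insert_of_notMem, Finset.filter_erase,
      Finset.erase_eq_of_notMem] at h4
    · omega
    · simp [hbU]
    · intro h'
      exact notMem_erase_of_notMem_span h (Finset.mem_filter.1 h').1
  have hiU := hpar.symm.1
  have hjU := hpar.1
  obtain ⟨J, hJ, hJU, hiJ⟩ : ∃ J, IsMaxWeight M w J ∧
      (∀ J', IsMaxWeight M w J' → (J'.filter (· ∈ U)).card ≤ (J.filter (· ∈ U)).card) ∧ i ∈ J := by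
    by_cases hiJ : i ∈ J
    · exact ⟨J, hJ, hJU, hiJ⟩
    obtain ⟨b, hb, hbU, h⟩ : ∃ b ∈ J, b ∉ U ∧
        a i ∉ Submodule.span ℝ (a '' ((J : Set ι) \ {b})) := by
      by_contra! hcon
      exact hiU (Submodule.span_mono (Set.image_mono Set.inter_subset_right)
        ((hM.indep J hJ.1).mem_span_image_inter (hM.spans J hJ.1 i) hcon))
    have h2 : w b ≤ w i := not_lt.1 fun h => hbU (hU b h)
    refine ⟨insert i (J.erase b), hJ.exchange hM hb h h2, fun J' hJ' => (hJU J' hJ').trans ?_,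
      Finset.mem_insert_self _ _⟩
    refine Finset.card_le_card fun x hx => ?_
    rw [Finset.mem_filter] at hx ⊢
    refine ⟨Finset.mem_insert_of_mem (Finset.mem_erase.2 ⟨?_, hx.1⟩), hx.2⟩
    rintro rfl
    exact hbU hx.2
  have hspan := span_of_max J hJ hJU
  have hiU' : i ∉ U := fun h => hiU (Submodule.subset_span ⟨i, h, rfl⟩)
  -- Otherwise `a i`, a combination of `a j` and of elements of `U`, would lie in the span of `J \
  -- {i}` as well.
  have hj : a j ∉ Submodule.span ℝ (a '' ((J : Set ι) \ {i})) := by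
    intro h
    refine hM.notMem_span_erase hJ.1 hiJ (Submodule.span_le.2 ?_ hpar.symm.2)
    rintro _ ⟨u, hu, rfl⟩
    rcases hu with rfl | hu
    · exact h
    · refine Submodule.span_mono (Set.image_mono ?_) (hspan u hu)
      rintro x ⟨hx, hxU⟩
      exact ⟨hx, fun h => hiU' (h ▸ hxU)⟩
  refine ⟨J.erase i, Finset.notMem_erase _ _, notMem_erase_of_notMem_span hj, ?_, ?_⟩
  · rw [Finset.insert_erase hiJ]
    exact hJ
  · exact hJ.exchange hM hiJ hj hw.le

end VectorConfiguration

/-! ### Positroids as sets of bases -/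

section Cell

variable {k n : ℕ} {M : Finset (Finset (Fin n))} {A : Matrix (Fin k) (Fin n) ℝ}

theorem maxMinor_ne_zero_iff (A : Matrix (Fin k) (Fin n) ℝ) (e : Fin k ↪o Fin n) :
    maxMinor A e ≠ 0 ↔
      LinearIndepOn ℝ A.col (Finset.univ.map e.toEmbedding : Finset (Fin n)) := by
  have h : ((Finset.univ.map e.toEmbedding : Finset (Fin n)) : Set (Fin n)) = Set.range e := by
    ext x
    simp
  rw [h, linearIndepOn_range_iff e.injective, ← isUnit_iff_ne_zero, maxMinor,
    ← Matrix.isUnit_iff_isUnit_det, ← Matrix.linearIndependent_cols_iff_isUnit]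
  rfl

theorem exists_orderEmb_map_eq {J : Finset (Fin n)} (hJ : J.card = k) :
    ∃ e : Fin k ↪o Fin n, Finset.univ.map e.toEmbedding = J := by
  refine ⟨J.orderEmbOfFin hJ, Finset.coe_injective ?_⟩
  rw [Finset.coe_map, Finset.coe_univ, Set.image_univ]
  exact Finset.range_orderEmbOfFin J hJ

theorem InCell.mem_iff (hA : InCell M A) (J : Finset (Fin n)) :
    J ∈ M ↔ J.card = k ∧ LinearIndepOn ℝ A.col (J : Set (Fin n)) := by
  constructor
  · intro hJ
    obtain ⟨e, rfl⟩ := exists_orderEmb_map_eq (hA.2.1 J hJ)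
    exact ⟨hA.2.1 _ hJ, (maxMinor_ne_zero_iff A e).1 ((hA.2.2 e).1 hJ).ne'⟩
  · rintro ⟨hJ, hJ'⟩
    obtain ⟨e, rfl⟩ := exists_orderEmb_map_eq hJ
    by_contra h
    exact (maxMinor_ne_zero_iff A e).2 hJ' ((hA.2.2 e).2 h)

theorem InCell.span_col_eq_top (hA : InCell M A) :
    Submodule.span ℝ (Set.range A.col) = ⊤ := by
  apply Submodule.eq_top_of_finrank_eq
  rw [← Matrix.rank_eq_finrank_span_cols, hA.1, Module.finrank_fin_fun]

theorem InCell.represents (hA : InCell M A) : Represents M A.col where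
  nonempty := by
    obtain ⟨b, -, -, hb, hb'⟩ := exists_linearIndepOn_extension (K := ℝ) (v := A.col)
      (linearIndepOn_empty ℝ A.col) (Set.empty_subset Set.univ)
    classical
    refine ⟨b.toFinset, (hA.mem_iff _).2 ⟨?_, by simpa using hb'⟩⟩
    have h1 : Submodule.span ℝ (A.col '' b) = ⊤ := by
      rw [eq_top_iff, ← hA.span_col_eq_top]
      exact Submodule.span_le.2 (by simpa using hb)
    have h2 := finrank_span_eq_card hb'
    rw [show Set.range (fun x : b => A.col x) = A.col '' b by ext; simp, h1, finrank_top,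
      Module.finrank_fin_fun] at h2
    rw [Set.toFinset_card, ← h2]
  indep J hJ := ((hA.mem_iff J).1 hJ).2
  spans J hJ l := by
    obtain ⟨h1, h2⟩ := (hA.mem_iff J).1 hJ
    have h3 := finrank_span_eq_card h2
    rw [show Set.range (fun x : (J : Set (Fin n)) => A.col x) = A.col '' J by ext; simp] at h3
    have h4 : Submodule.span ℝ (A.col '' (J : Set (Fin n))) = ⊤ := by
      apply Submodule.eq_top_of_finrank_eq
      rw [h3, Module.finrank_fin_fun]
      simpa using h1
    rw [h4]
    trivial
  exchange J hJ b hb l h := by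
    obtain ⟨h1, h2⟩ := (hA.mem_iff J).1 hJ
    refine (hA.mem_iff _).2 ⟨?_, ?_⟩
    · rw [Finset.card_insert_of_notMem (notMem_erase_of_notMem_span h),
        Finset.card_erase_of_mem hb, h1]
      have : 0 < J.card := Finset.card_pos.2 ⟨b, hb⟩
      omega
    · rw [Finset.coe_insert, Finset.coe_erase]
      exact (h2.mono Set.sdiff_subset).insert h

end Cell

/-! ### The contour plot in terms of parallel elements -/

section Contour

variable {n : ℕ} {κ : Fin n → ℝ} {M : Finset (Finset (Fin n))}

theorem phaseSum_eq (κ : Fin n → ℝ) (J : Finset (Fin n)) (p : ℝ × ℝ) :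
    phaseSum κ J p = (∑ j ∈ J, κ j) * p.1 + (∑ j ∈ J, κ j ^ 2) * p.2 + ∑ j ∈ J, κ j ^ 3 := by
  simp [phaseSum, phase, Finset.sum_add_distrib, Finset.sum_mul]

theorem le_iSup_phaseSum {J : Finset (Fin n)} (hJ : J ∈ M) (q : ℝ × ℝ) :
    phaseSum κ J q ≤ ⨆ J : {J // J ∈ M}, phaseSum κ J.1 q :=
  le_ciSup (f := fun J : {J // J ∈ M} => phaseSum κ J.1 q) (Set.finite_range _).bddAbove ⟨J, hJ⟩

theorem IsDominant.iSup_eq {p : ℝ × ℝ} {J : Finset (Fin n)} (hJ : IsDominant κ M p J) :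
    (⨆ J : {J // J ∈ M}, phaseSum κ J.1 p) = phaseSum κ J p :=
  haveI : Nonempty {J // J ∈ M} := ⟨⟨J, hJ.1⟩⟩
  le_antisymm (ciSup_le fun J' => hJ.2 J'.1 J'.2) (le_iSup_phaseSum hJ.1 p)

/-- The term of `J` stays below the maximum and touches it at `p`. If the maximum is affine near
`p`, the two must have the same derivative. The `x`-direction alone is enough, because `∑ κ_j`
already separates `S ∪ {i}` from `S ∪ {j}`. -/
theorem IsDominant.slope_eq {p : ℝ × ℝ} {J : Finset (Fin n)} (hJ : IsDominant κ M p J)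
    {a b c : ℝ} (h : ∀ᶠ q : ℝ × ℝ in nhds p,
      (⨆ J : {J // J ∈ M}, phaseSum κ J.1 q) = a * q.1 + b * q.2 + c) :
    ∑ j ∈ J, κ j = a := by
  have h0 := h.self_of_nhds
  rw [hJ.iSup_eq, phaseSum_eq] at h0
  have hc : Filter.Tendsto (fun t : ℝ => (p.1 + t, p.2)) (nhds 0) (nhds p) := by
    have : Continuous fun t : ℝ => (p.1 + t, p.2) := by fun_prop
    simpa using this.tendsto 0
  obtain ⟨ε, hε, hball⟩ := Metric.eventually_nhds_iff.1 (hc.eventually h)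
  have key : ∀ t : ℝ, |t| < ε → (∑ j ∈ J, κ j) * t ≤ a * t := by
    intro t ht
    have h1 := hball (y := t) (by simpa using ht)
    have h2 := le_iSup_phaseSum (κ := κ) hJ.1 (p.1 + t, p.2)
    rw [h1, phaseSum_eq] at h2
    simp only at h2
    linarith
  have h1 := key (ε / 2) (by rw [abs_of_pos] <;> linarith)
  have h2 := key (-(ε / 2)) (by rw [abs_neg, abs_of_pos] <;> linarith)
  have h3 : (∑ j ∈ J, κ j - a) * (ε / 2) = 0 := by nlinarith
  rcases mul_eq_zero.1 h3 with h | h <;> linarith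

theorem IsBalanced.mem_contourPlot (hκ : Function.Injective κ) {p : ℝ × ℝ} {i j : Fin n}
    (hij : i ≠ j) (h : IsBalanced κ M i j p) : p ∈ contourPlot κ M := by
  rintro ⟨a, b, c, hlin⟩
  obtain ⟨S, hi, hj, hdi, hdj⟩ := h
  have h1 := hdi.slope_eq hlin
  have h2 := hdj.slope_eq hlin
  rw [Finset.sum_insert hi] at h1
  rw [Finset.sum_insert hj] at h2
  exact hij (hκ (by linarith))

/-- A unique dominant term stays dominant near `p`, which makes the maximum affine there. With two
dominant bases, symmetric exchange makes the opposite swaps of `b` and `l` in both of them. Neither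
swap may raise the weight, so `φ_b = φ_l` and both swaps keep it. -/
theorem exists_balanced_of_mem_contourPlot {E : Type*} [AddCommGroup E] [Module ℝ E]
    {v : Fin n → E} (hM : Represents M v) {p : ℝ × ℝ} (hp : p ∈ contourPlot κ M) :
    ∃ i j, i ≠ j ∧ phase κ i p = phase κ j p ∧ IsBalanced κ M i j p := by
  obtain ⟨J, hJ, hJmax⟩ := Finset.exists_max_image M (fun J => phaseSum κ J p) hM.nonempty
  have hJd : IsDominant κ M p J := ⟨hJ, hJmax⟩
  by_cases huniq : ∀ J', IsDominant κ M p J' → J' = J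
  · refine absurd ?_ hp
    have hlt : ∀ J' ∈ M, J' ≠ J → ∀ᶠ q in nhds p, phaseSum κ J' q < phaseSum κ J q := by
      intro J' hJ' hne
      have hcont : ∀ J : Finset (Fin n), Continuous (phaseSum κ J) := by
        intro J
        simp_rw [funext (phaseSum_eq κ J)]
        fun_prop
      refine ((hcont J').tendsto p).eventually_lt ((hcont J).tendsto p) ?_
      by_contra hle
      exact hne (huniq J' ⟨hJ', fun J'' h'' => (hJmax J'' h'').trans (not_lt.1 hle)⟩)
    refine ⟨∑ j ∈ J, κ j, ∑ j ∈ J, κ j ^ 2, ∑ j ∈ J, κ j ^ 3, Filter.Eventually.mono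
      ((Filter.eventually_all_finset M).2 fun J' hJ' =>
        Filter.eventually_imp_distrib_left.2 (hlt J' hJ')) fun q hq => ?_⟩
    · have : IsDominant κ M q J := by
        refine ⟨hJ, fun J' hJ' => ?_⟩
        by_cases hne : J' = J
        · rw [hne]
        · exact (hq J' hJ' hne).le
      rw [this.iSup_eq, phaseSum_eq]
  · push Not at huniq
    obtain ⟨J', hJ'd, hne⟩ := huniq
    -- A proper inclusion of bases is excluded by exchange rather than by counting.
    have hcard : ¬ J' ⊆ J := by
      intro hsub
      obtain ⟨l, hl, hl'⟩ := Finset.exists_of_ssubset (hsub.ssubset_of_ne hne)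
      obtain ⟨b, hb, hb', -⟩ := hM.symmetric_exchange hJ'd.1 hJ hl hl'
      exact hb' (hsub hb)
    obtain ⟨l, hl, hlJ⟩ := Finset.not_subset.1 hcard
    obtain ⟨b, hb, hbJ', h1, h2⟩ := hM.symmetric_exchange hJ hJ'd.1 hl hlJ
    have e1 := hJd.2 _ h1
    have e2 := hJ'd.2 _ h2
    have hlJ' : l ∉ J.erase b := fun h => hlJ (Finset.mem_of_mem_erase h)
    have hbJ'' : b ∉ J'.erase l := fun h => hbJ' (Finset.mem_of_mem_erase h)
    unfold phaseSum at e1 e2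
    rw [sum_insert_erase hb hlJ'] at e1
    rw [sum_insert_erase hl hbJ''] at e2
    refine ⟨b, l, fun h => hlJ (h ▸ hb), by linarith, J.erase b, Finset.notMem_erase _ _, hlJ',
      by rwa [Finset.insert_erase hb], h1, fun J'' h'' => ?_⟩
    have := hJd.2 J'' h''
    unfold phaseSum at this ⊢
    rw [sum_insert_erase hb hlJ']
    linarith

end Contour

/-! ### Points on the lines `φ_i = φ_j` -/

section Lines

variable {n : ℕ}

/-- The point of the line `φ_i = φ_j` at which the third root is `r`, in terms of the reversed
parameters `κ' l = - κ (n + 1 - l)`. -/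
def linePoint (κ' : Fin n → ℝ) (i j : Fin n) (r : ℝ) : ℝ × ℝ :=
  (κ' i * κ' j + (κ' i + κ' j) * r, κ' i + κ' j + r)

/-- As a function of `κ_l`, the difference of the phases is a monic cubic with roots at the two
given parameters and at `-r`. The overall sign comes from passing to `κ' = -κ`. -/
theorem phase_linePoint_sub (κ : Fin n → ℝ) (κ' : Fin n → ℝ) (hκ' : ∀ l, κ' l = - κ l.rev)
    (i j : Fin n) (r : ℝ) (l : Fin n) :
    phase κ l.rev (linePoint κ' i j r) - phase κ i.rev (linePoint κ' i j r) =
      - ((κ' l - κ' i) * (κ' l - κ' j) * (κ' l - r)) := by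
  simp only [phase, linePoint, hκ']
  ring

theorem exists_eq_linePoint (κ : Fin n → ℝ) (κ' : Fin n → ℝ) (hκ' : ∀ l, κ' l = - κ l.rev)
    {i j : Fin n} (hij : κ' i ≠ κ' j) {p : ℝ × ℝ} (h : phase κ i.rev p = phase κ j.rev p) :
    ∃ r, p = linePoint κ' i j r := by
  refine ⟨p.2 - κ' i - κ' j, Prod.ext ?_ (by simp [linePoint])⟩
  have hi := hκ' i
  have hj := hκ' j
  have h1 : κ i.rev = - κ' i := by linarith
  have h2 : κ j.rev = - κ' j := by linarith
  have h3 : κ' i - κ' j ≠ 0 := sub_ne_zero.2 hij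
  simp only [phase, h1, h2] at h
  simp only [linePoint]
  apply mul_left_cancel₀ h3
  linear_combination - h

/-- The elements `l` with `φ_l > φ_i = φ_j` where the third root lies between the elements of the
ground set that are `< σ` and those that are `≥ σ`. -/
def upperSet (i j : Fin n) (σ : ℕ) : Set (Fin n) :=
  {l | (l < i ∧ l.val < σ) ∨ (i < l ∧ l < j ∧ σ ≤ l.val) ∨ (j < l ∧ l.val < σ)}

/-- `r` separates the values of `κ'` at the elements `< σ` from those at the elements `≥ σ`. -/
def Separates (κ' : Fin n → ℝ) (σ : ℕ) (r : ℝ) : Prop :=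
  ∀ l : Fin n, (l.val < σ → κ' l ≤ r) ∧ (σ ≤ l.val → r ≤ κ' l)

theorem exists_separates {κ' : Fin n → ℝ} (hκ' : StrictMono κ') (r : ℝ) :
    ∃ σ ≤ n, ∀ l : Fin n, l.val < σ ↔ κ' l < r := by
  classical
  refine ⟨(Finset.univ.filter fun l => κ' l < r).card, (Finset.card_le_univ _).trans (by simp),
    fun l => ⟨fun h => ?_, fun h => ?_⟩⟩
  · by_contra hl
    have hsub : (Finset.univ.filter fun l => κ' l < r) ⊆ Finset.Iio l := by
      intro x hx
      rw [Finset.mem_filter] at hx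
      exact Finset.mem_Iio.2 (hκ'.lt_iff_lt.1 (hx.2.trans_le (not_lt.1 hl)))
    have := Finset.card_le_card hsub
    rw [Fin.card_Iio] at this
    omega
  · have hsub : Finset.Iic l ⊆ (Finset.univ.filter fun l => κ' l < r) := by
      intro x hx
      exact Finset.mem_filter.2 ⟨Finset.mem_univ _,
        (hκ'.monotone (Finset.mem_Iic.1 hx)).trans_lt h⟩
    have := Finset.card_le_card hsub
    rw [Fin.card_Iic] at this
    omega

/-- The two implications leave a gap at ties: `r` may be equal to some `κ' l`, and then the choice
of `σ` decides whether `l` is counted as heavier. This is the freedom in `U` allowed by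
`exists_balanced_of_parallelMod`. -/
theorem phase_linePoint_pos {κ κ' : Fin n → ℝ} (hκ' : ∀ l, κ' l = - κ l.rev)
    (hmono : StrictMono κ') {i j : Fin n} (hij : i < j) {σ : ℕ} {r : ℝ}
    (hr : Separates κ' σ r) (l : Fin n) :
    (phase κ i.rev (linePoint κ' i j r) < phase κ l.rev (linePoint κ' i j r) →
      l ∈ upperSet i j σ) ∧
    (l ∈ upperSet i j σ →
      phase κ i.rev (linePoint κ' i j r) ≤ phase κ l.rev (linePoint κ' i j r)) := by
  have hsub := phase_linePoint_sub κ κ' hκ' i j r l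
  have h1 := (hr l).1
  have h2 := (hr l).2
  have hσ : l.val < σ ∨ σ ≤ l.val := lt_or_ge _ _
  change _ ∧ ((l < i ∧ l.val < σ) ∨ (i < l ∧ l < j ∧ σ ≤ l.val) ∨ (j < l ∧ l.val < σ) → _)
  change (_ → (l < i ∧ l.val < σ) ∨ (i < l ∧ l < j ∧ σ ≤ l.val) ∨ (j < l ∧ l.val < σ)) ∧ _
  have key : phase κ i.rev (linePoint κ' i j r) < phase κ l.rev (linePoint κ' i j r) ↔
      (κ' l - κ' i) * (κ' l - κ' j) * (κ' l - r) < 0 := by constructor <;> intro <;> linarith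
  have key' : phase κ i.rev (linePoint κ' i j r) ≤ phase κ l.rev (linePoint κ' i j r) ↔
      (κ' l - κ' i) * (κ' l - κ' j) * (κ' l - r) ≤ 0 := by constructor <;> intro <;> linarith
  rw [key, key']
  rcases lt_trichotomy l i with hli | rfl | hli
  · have e1 := hmono hli
    have e2 := hmono (hli.trans hij)
    have hpos : 0 < (κ' l - κ' i) * (κ' l - κ' j) :=
      mul_pos_of_neg_of_neg (by linarith) (by linarith)
    constructor
    · intro h
      rcases hσ with hσ | hσ
      · exact Or.inl ⟨hli, hσ⟩
      · exact absurd h (not_lt.2 (mul_nonneg hpos.le (by linarith [h2 hσ])))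
    · rintro (⟨-, h⟩ | ⟨h, -⟩ | ⟨h, -⟩)
      · exact mul_nonpos_of_nonneg_of_nonpos hpos.le (by linarith [h1 h])
      · exact absurd h hli.asymm
      · exact absurd (hij.trans h) hli.asymm
  · simp
  rcases lt_trichotomy l j with hlj | rfl | hlj
  · have e1 := hmono hli
    have e2 := hmono hlj
    have hneg : (κ' l - κ' i) * (κ' l - κ' j) < 0 :=
      mul_neg_of_pos_of_neg (by linarith) (by linarith)
    constructor
    · intro h
      rcases hσ with hσ | hσ
      · exact absurd h (not_lt.2 (mul_nonneg_of_nonpos_of_nonpos hneg.le (by linarith [h1 hσ])))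
      · exact Or.inr (Or.inl ⟨hli, hlj, hσ⟩)
    · rintro (⟨h, -⟩ | ⟨-, -, h⟩ | ⟨h, -⟩)
      · exact absurd h hli.asymm
      · exact mul_nonpos_of_nonpos_of_nonneg hneg.le (by linarith [h2 h])
      · exact absurd h hlj.asymm
  · simp
  · have e1 := hmono hli
    have e2 := hmono hlj
    have hpos : 0 < (κ' l - κ' i) * (κ' l - κ' j) := mul_pos (by linarith) (by linarith)
    constructor
    · intro h
      rcases hσ with hσ | hσ
      · exact Or.inr (Or.inr ⟨hlj, hσ⟩)
      · exact absurd h (not_lt.2 (mul_nonneg hpos.le (by linarith [h2 hσ])))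
    · rintro (⟨h, -⟩ | ⟨-, h, -⟩ | ⟨-, h⟩)
      · exact absurd h hli.asymm
      · exact absurd h hlj.asymm
      · exact mul_nonpos_of_nonneg_of_nonpos hpos.le (by linarith [h1 h])

/-- The lines `φ_i = φ_j` for different pairs meet in at most one point. -/
theorem linePoint_inj {κ' : Fin n → ℝ} (hmono : StrictMono κ') {i j i' j' : Fin n} (hij : i < j)
    (hij' : i' < j') (hne : ¬ (i = i' ∧ j = j')) {r s r' s' : ℝ}
    (h1 : linePoint κ' i j r = linePoint κ' i' j' r')
    (h2 : linePoint κ' i j s = linePoint κ' i' j' s') : r = s := by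
  by_contra hrs
  simp only [linePoint, Prod.mk.injEq] at h1 h2
  obtain ⟨a1, a2⟩ := h1
  obtain ⟨b1, b2⟩ := h2
  have hsum : (κ' i + κ' j) = κ' i' + κ' j' := by
    have : (r - s) * (κ' i + κ' j) = (r - s) * (κ' i' + κ' j') := by
      have : r' - s' = r - s := by linarith
      linear_combination a1 - b1 + (κ' i' + κ' j') * this
    exact mul_left_cancel₀ (sub_ne_zero.2 hrs) this
  have hr : r = r' := by linarith
  have hprod : κ' i * κ' j = κ' i' * κ' j' := by
    rw [hsum, hr] at a1
    linarith
  have hfac : (κ' i - κ' i') * (κ' i - κ' j') = 0 := by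
    linear_combination κ' i * hsum - hprod
  have e1 := hmono hij
  have e2 := hmono hij'
  rcases mul_eq_zero.1 hfac with h | h
  · exact hne ⟨hmono.injective (by linarith), hmono.injective (by linarith)⟩
  · linarith

theorem parallelMod_rev_iff {E : Type*} [AddCommGroup E] [Module ℝ E] (b : Fin n → E)
    (U : Set (Fin n)) (i j : Fin n) :
    ParallelMod (fun l => b l.rev) U i j ↔ ParallelMod b (Fin.rev '' U) i.rev j.rev := by
  simp only [ParallelMod, ← Set.image_insert_eq, Set.image_image]

theorem isBalanced_of_parallelMod_upperSet {E : Type*} [AddCommGroup E] [Module ℝ E]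
    {M : Finset (Finset (Fin n))} {b : Fin n → E} (hM : Represents M b) {κ κ' : Fin n → ℝ}
    (hκ' : ∀ l, κ' l = - κ l.rev) (hmono : StrictMono κ') {i j : Fin n} (hij : i < j) {σ : ℕ}
    {r : ℝ} (hr : Separates κ' σ r)
    (hpar : ParallelMod (fun l => b l.rev) (upperSet i j σ) i j) :
    IsBalanced κ M i.rev j.rev (linePoint κ' i j r) := by
  refine exists_balanced_of_parallelMod hM (w := fun l => phase κ l (linePoint κ' i j r))
    (Fin.rev_injective.ne hij.ne) ?_ ?_ ?_ ((parallelMod_rev_iff _ _ _ _).1 hpar)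
  · have := phase_linePoint_sub κ κ' hκ' i j r j
    rw [sub_self, mul_zero, zero_mul, neg_zero] at this
    linarith
  · intro l hl
    exact ⟨l.rev, (phase_linePoint_pos hκ' hmono hij hr l.rev).1 (by rwa [Fin.rev_rev]),
      Fin.rev_rev l⟩
  · rintro _ ⟨l, hl, rfl⟩
    exact (phase_linePoint_pos hκ' hmono hij hr l).2 hl

theorem notMem_upperSet_left (i j : Fin n) (σ : ℕ) : i < j → i ∉ upperSet i j σ := by
  rintro hij (⟨h, -⟩ | ⟨h, -⟩ | ⟨h, -⟩)
  · exact lt_irrefl _ h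
  · exact lt_irrefl _ h
  · exact hij.asymm h

theorem notMem_upperSet_right (i j : Fin n) (σ : ℕ) : i < j → j ∉ upperSet i j σ := by
  rintro hij (⟨h, -⟩ | ⟨-, h, -⟩ | ⟨h, -⟩)
  · exact hij.asymm h
  · exact lt_irrefl _ h
  · exact lt_irrefl _ h

theorem exists_parallelMod_upperSet {E : Type*} [AddCommGroup E] [Module ℝ E]
    {M : Finset (Finset (Fin n))} {b : Fin n → E} (hM : Represents M b) {κ κ' : Fin n → ℝ}
    (hκ' : ∀ l, κ' l = - κ l.rev) (hmono : StrictMono κ') {p : ℝ × ℝ}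
    (hp : p ∈ contourPlot κ M) :
    ∃ i j σ r, i < j ∧ σ ≤ n ∧ p = linePoint κ' i j r ∧ Separates κ' σ r ∧
      ParallelMod (fun l => b l.rev) (upperSet i j σ) i j := by
  obtain ⟨i, j, hij, heq, S, hiS, hjS, hi, hj⟩ : ∃ i j : Fin n, i < j ∧
      phase κ i.rev p = phase κ j.rev p ∧ IsBalanced κ M i.rev j.rev p := by
    obtain ⟨i, j, hij, heq, hbal⟩ := exists_balanced_of_mem_contourPlot hM hp
    rcases hij.lt_or_gt with h | h
    · obtain ⟨S, hi, hj, hdi, hdj⟩ := hbal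
      exact ⟨j.rev, i.rev, Fin.rev_lt_rev.2 h, by simpa using heq.symm,
        S, by simpa using hj, by simpa using hi, by simpa using hdj, by simpa using hdi⟩
    · exact ⟨i.rev, j.rev, Fin.rev_lt_rev.2 h, by simpa using heq, by simpa using hbal⟩
  obtain ⟨r, rfl⟩ := exists_eq_linePoint κ κ' hκ' (hmono hij).ne heq
  have hpar := parallelMod_of_balanced hM hiS hjS (Fin.rev_injective.ne hij.ne) heq hi hj
  obtain ⟨s, hsn, hs⟩ := exists_separates hmono r
  obtain ⟨σ, hσn, hσ, hσ'⟩ : ∃ σ ≤ n, Separates κ' σ r ∧ ∀ l, l ≠ i → l ≠ j → κ' l = r →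
      (l.rev ∈ S ↔ l ∈ upperSet i j σ) := by
    have hsep : Separates κ' s r := fun l =>
      ⟨fun h => ((hs l).1 h).le, fun h => not_lt.1 fun h' => h.not_gt ((hs l).2 h')⟩
    by_cases hcase : ∀ l, l ≠ i → l ≠ j → κ' l = r → (l.rev ∈ S ↔ l ∈ upperSet i j s)
    · exact ⟨s, hsn, hsep, hcase⟩
    push Not at hcase
    -- Here `r = κ' l₀`, and `l₀`, which has index `s`, lies on the wrong side. Replacing `s` by `s
    -- + 1` keeps `r` separated and changes the membership of `l₀` alone in the upper set.
    obtain ⟨l₀, h1, h2, rfl, h4⟩ := hcase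
    have hl₀ : l₀.val = s := by
      refine le_antisymm (not_lt.1 fun h => ?_) (not_lt.1 fun h => ?_)
      · exact absurd ((hs ⟨s, h.trans l₀.2⟩).2 (hmono h)) (lt_irrefl s)
      · exact lt_irrefl _ ((hs l₀).1 h)
    refine ⟨s + 1, hl₀ ▸ l₀.2, fun l => ⟨fun h => hmono.monotone (Fin.le_def.2 (by omega)),
      fun h => hmono.monotone (Fin.le_def.2 (by omega))⟩, fun l hl hl' hll => ?_⟩
    obtain rfl := hmono.injective hll
    have : l ∈ upperSet i j (s + 1) ↔ ¬ l ∈ upperSet i j s := by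
      change ((l < i ∧ l.val < s + 1) ∨ (i < l ∧ l < j ∧ s + 1 ≤ l.val) ∨ (j < l ∧ l.val < s + 1))
        ↔ ¬ ((l < i ∧ l.val < s) ∨ (i < l ∧ l < j ∧ s ≤ l.val) ∨ (j < l ∧ l.val < s))
      rw [Ne, Fin.ext_iff] at hl hl'
      simp only [Fin.lt_def] at hij ⊢
      omega
    rw [this]
    tauto
  refine ⟨i, j, σ, r, hij, hσn, rfl, hσ, (parallelMod_rev_iff _ _ _ _).2 ?_⟩
  convert hpar using 1
  have hmem : ∀ l : Fin n, l ∈ upperSet i j σ ↔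
      phase κ i.rev (linePoint κ' i j r) < phase κ l.rev (linePoint κ' i j r) ∨
      (phase κ l.rev (linePoint κ' i j r) = phase κ i.rev (linePoint κ' i j r) ∧ l.rev ∈ S) := by
    intro l
    obtain ⟨h1, h2⟩ := phase_linePoint_pos hκ' hmono hij hσ l
    rcases lt_trichotomy (phase κ i.rev (linePoint κ' i j r))
      (phase κ l.rev (linePoint κ' i j r)) with h | h | h
    · exact iff_of_true (h1 h) (Or.inl h)
    · have hz := phase_linePoint_sub κ κ' hκ' i j r l
      rw [h, sub_self, eq_comm, neg_eq_zero] at hz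
      have hiff : l ∈ upperSet i j σ ↔ l.rev ∈ S := by
        by_cases hli : l = i
        · subst hli
          exact iff_of_false (notMem_upperSet_left _ _ _ hij) hiS
        by_cases hlj : l = j
        · subst hlj
          exact iff_of_false (notMem_upperSet_right _ _ _ hij) hjS
        have h3 := sub_ne_zero.2 (hmono.injective.ne hli)
        have h4 := sub_ne_zero.2 (hmono.injective.ne hlj)
        refine (hσ' l hli hlj ?_).symm
        exact sub_eq_zero.1 ((mul_eq_zero.1 hz).resolve_left (mul_ne_zero h3 h4))
      rw [hiff, ← h]
      simp
    · refine iff_of_false (fun h' => (h2 h').not_gt h) ?_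
      rintro (h' | h')
      · exact h.asymm h'
      · exact h.ne h'.1
  ext l
  constructor
  · rintro ⟨l, hl, rfl⟩
    exact (hmem l).1 hl
  · intro hl
    refine ⟨l.rev, (hmem l.rev).2 ?_, Fin.rev_rev l⟩
    rw [Fin.rev_rev]
    exact hl

end Lines

/-! ### The Grassmann necklace -/

section Necklace

variable {n : ℕ}

theorem Fin.val_sub_eq_ite (l x : Fin n) :
    (l - x).val = if x ≤ l then l.val - x.val else n + l.val - x.val := by
  rw [Fin.sub_def]
  have h1 := l.2
  have h2 := x.2
  simp only [Fin.le_def]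
  split_ifs with h
  · rw [show n - x.val + l.val = (l.val - x.val) + n by omega, Nat.add_mod_right,
      Nat.mod_eq_of_lt (by omega)]
  · rw [Nat.mod_eq_of_lt (by omega)]
    omega

/-- The open cyclic interval from `x` to `y`. -/
def cyclicIoo (x y : Fin n) : Set (Fin n) :=
  {l | (x < l ∧ l < y) ∨ (y < x ∧ (x < l ∨ l < y))}

theorem mem_cyclicIoo {x y l : Fin n} :
    l ∈ cyclicIoo x y ↔ (x < l ∧ l < y) ∨ (y < x ∧ (x < l ∨ l < y)) := Iff.rfl

theorem sub_lt_sub_iff_cyclic {x y l : Fin n} (hxy : y ≠ x) :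
    l - x < y - x ↔ l = x ∨ l ∈ cyclicIoo x y := by
  rw [Fin.lt_def, Fin.val_sub_eq_ite, Fin.val_sub_eq_ite, mem_cyclicIoo]
  have h1 := l.2
  have h2 := x.2
  have h3 := y.2
  rw [Ne, Fin.ext_iff] at hxy
  simp only [Fin.lt_def, Fin.le_def, Fin.ext_iff]
  split_ifs <;> omega

theorem val_finRotate_sub (x y l : Fin n) (hxy : y ≠ x) :
    l - finRotate n x < y - finRotate n x ↔ l ∈ cyclicIoo x y := by
  obtain _ | n := n
  · exact x.elim0
  rw [Fin.lt_def, Fin.val_sub_eq_ite, Fin.val_sub_eq_ite, mem_cyclicIoo]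
  simp only [Fin.lt_def, Fin.le_def, coe_finRotate, Fin.ext_iff, Fin.val_last]
  have h1 := l.2
  have h2 := x.2
  have h3 := y.2
  rw [Ne, Fin.ext_iff] at hxy
  split_ifs <;> omega

variable {E : Type*} [AddCommGroup E] [Module ℝ E] {M : Finset (Finset (Fin n))} {b : Fin n → E}

/-- The lexicographically minimal basis is the greedy one. A member depending on its predecessors
could be traded for an earlier element, and a non-member independent of them could replace a later
member; either trade would lower `I`. -/
theorem IsLexMin.mem_iff (hM : Represents M b) {r : Fin n} {I : Finset (Fin n)}
    (hI : IsLexMin M r I) (y : Fin n) :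
    y ∈ I ↔ b y ∉ Submodule.span ℝ (b '' {l | l - r < y - r}) := by
  constructor
  · intro hy hspan
    obtain ⟨l, hl, h⟩ : ∃ l, l - r < y - r ∧
        b l ∉ Submodule.span ℝ (b '' ((I : Set (Fin n)) \ {y})) := by
      by_contra! hcon
      refine hM.notMem_span_erase hI.1 hy (Submodule.span_le.2 ?_ hspan)
      rintro _ ⟨l, hl, rfl⟩
      exact hcon l hl
    have hlI := notMem_erase_of_notMem_span h
    have hly : l ≠ y := by
      rintro rfl
      exact lt_irrefl _ hl
    have hJ := hM.exchange I hI.1 y hy l h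
    have hne : insert l (I.erase y) ≠ I := by
      intro h'
      have : y ∈ insert l (I.erase y) := by rw [h']; exact hy
      simp [hly.symm] at this
    obtain ⟨c, hc, hc'⟩ := hI.2 _ hJ hne
    obtain rfl : c = y := by
      by_contra hcy
      simp [hcy] at hc
      exact hc.2.2 hc.1
    refine (hc' l ?_).asymm hl
    have : l ∉ I := fun h => hlI (Finset.mem_erase.2 ⟨hly, h⟩)
    simp [this]
  · intro hspan
    by_contra hy
    obtain ⟨c, hc, hcT, h⟩ : ∃ c ∈ I, ¬ c - r < y - r ∧
        b y ∉ Submodule.span ℝ (b '' ((I : Set (Fin n)) \ {c})) := by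
      by_contra! hcon
      exact hspan (Submodule.span_mono (Set.image_mono Set.inter_subset_right)
        ((hM.indep I hI.1).mem_span_image_inter (hM.spans I hI.1 y)
          fun c hc hcT => hcon c hc (not_lt.1 hcT)))
    have hyc : y ≠ c := fun h => hy (h ▸ hc)
    have hne : insert y (I.erase c) ≠ I := by
      intro h'
      exact hy (h' ▸ Finset.mem_insert_self _ _)
    obtain ⟨d, hd, hd'⟩ := hI.2 _ (hM.exchange I hI.1 c hc y h) hne
    obtain rfl : d = c := by
      by_contra hdc
      simp [hdc] at hd
      exact hd.2.2 hd.1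
    exact hcT (hd' y (by simp [hy]))

theorem finRotate_induction {P : Fin n → Prop} (h : ∀ r, P r → P (finRotate n r)) {x : Fin n}
    (hx : P x) (y : Fin n) : P y := by
  by_cases hn : 2 ≤ n
  · obtain ⟨t, rfl⟩ := (isCycle_finRotate_of_le hn).exists_pow_eq (x := x) (y := y)
      (by rw [← Equiv.Perm.mem_support, support_finRotate_of_le hn]; exact Finset.mem_univ _)
      (by rw [← Equiv.Perm.mem_support, support_finRotate_of_le hn]; exact Finset.mem_univ _)
    induction t with
    | zero => simpa using hx
    | succ t ih =>
      rw [pow_succ', Equiv.Perm.mul_apply]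
      exact h _ ih
  · obtain rfl : x = y := by
      have := x.2
      have := y.2
      ext
      omega
    exact hx

/-- The element `y = π⁻¹ x` is the one that enters between `I_x` and `I_{x+1}`. In greedy terms it
is independent of the open cyclic interval from `x` to `y`, but depends on this interval once `x` is
added. -/
theorem HasNecklacePerm.parallelMod (hM : Represents M b) {π : Equiv.Perm (Fin n)}
    (hπ : HasNecklacePerm M π) (x : Fin n) :
    π.symm x ≠ x ∧ ParallelMod b (cyclicIoo x (π.symm x)) x (π.symm x) := by
  obtain ⟨I, hI, hstep⟩ := hπ
  set y := π.symm x with hy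
  have hyx : y ≠ x := (hstep x).1
  refine ⟨hyx, ?_⟩
  have hmem : y ∈ I (finRotate n x) := by
    rw [(hstep x).2]
    exact Finset.mem_insert_self _ _
  -- The element `y` is dropped in the step after `I_y` and can come back only in the step after
  -- `I_x`. If `I_x` contained it already, following the cycle from `I_{y+1}` would show that no
  -- `I_r` contains it, a contradiction at `x`.
  have hnot : y ∉ I x := by
    intro hyx'
    have h1 : y ∉ I (finRotate n y) := by
      rw [(hstep y).2]
      simpa using (hstep y).1.symm
    refine finRotate_induction (P := fun r => y ∉ I r) (fun r hr hr' => ?_) h1 x hyx'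
    rw [(hstep r).2, Finset.mem_insert] at hr'
    rcases hr' with h | h
    · have : r = x := π.symm.injective (h.symm.trans hy)
      exact hr (this ▸ hyx')
    · exact hr (Finset.mem_of_mem_erase h)
  rw [(hI _).mem_iff hM] at hmem hnot
  rw [not_not] at hnot
  refine ⟨?_, ?_⟩
  · convert hmem using 4
    ext l
    exact (val_finRotate_sub x y _ hyx).symm
  · convert hnot using 4
    ext l
    exact (sub_lt_sub_iff_cyclic hyx).symm

/-- The dual permutation describes the cyclic intervals of the reversed configuration. -/
theorem HasNecklacePerm.parallelMod_rev (hM : Represents M b) {π : Equiv.Perm (Fin n)}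
    (hπ : HasNecklacePerm M π) (z : Fin n) :
    dualPerm π z ≠ z ∧
      ParallelMod (fun l => b l.rev) (cyclicIoo (dualPerm π z) z) z (dualPerm π z) := by
  obtain ⟨h1, h2⟩ := hπ.parallelMod hM z.rev
  have hd : dualPerm π z = (π.symm z.rev).rev := rfl
  refine ⟨fun h => h1 ?_, ?_⟩
  · rw [hd] at h
    have := congrArg Fin.rev h
    rwa [Fin.rev_rev] at this
  · rw [parallelMod_rev_iff, hd, Fin.rev_rev]
    convert h2 using 1
    ext l
    constructor
    · rintro ⟨l, hl, rfl⟩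
      rw [mem_cyclicIoo] at hl ⊢
      simp only [Fin.lt_def, Fin.val_rev] at hl ⊢
      omega
    · intro hl
      refine ⟨l.rev, ?_, Fin.rev_rev l⟩
      rw [mem_cyclicIoo] at hl ⊢
      simp only [Fin.lt_def, Fin.val_rev] at hl ⊢
      omega

end Necklace

/-! ### Total positivity forbids crossing pairs of parallel elements -/

section Positivity

variable {k n : ℕ}

/-- Sorting `f` multiplies the determinant and the Vandermonde product by the same sign, so
positivity of the minors can be used for columns in any order. A repeated column makes the
determinant vanish. -/
theorem InCell.det_mul_prod_nonneg {M : Finset (Finset (Fin n))} {A : Matrix (Fin k) (Fin n) ℝ}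
    (hA : InCell M A) (f : Fin k → Fin n) :
    0 ≤ (A.submatrix id f).det * ∏ x, ∏ y ∈ Finset.Ioi x, (((f y).val : ℝ) - ((f x).val : ℝ)) := by
  by_cases hf : Function.Injective f
  · set τ := Tuple.sort f
    have hmono : StrictMono (f ∘ τ) :=
      (Tuple.monotone_sort f).strictMono_of_injective (hf.comp τ.injective)
    set e : Fin k ↪o Fin n := OrderEmbedding.ofStrictMono _ hmono with he
    have h1 : 0 ≤ maxMinor A e := by
      by_cases h : Finset.univ.map e.toEmbedding ∈ M
      · exact ((hA.2.2 e).1 h).le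
      · exact ((hA.2.2 e).2 h).ge
    have h2 : maxMinor A e = Equiv.Perm.sign τ * (A.submatrix id f).det := by
      rw [maxMinor, ← Matrix.det_permute', Matrix.submatrix_submatrix]
      rfl
    have h3 : ∏ x, ∏ y ∈ Finset.Ioi x, (((e y).val : ℝ) - ((e x).val : ℝ)) =
        Equiv.Perm.sign τ *
          ∏ x, ∏ y ∈ Finset.Ioi x, (((f y).val : ℝ) - ((f x).val : ℝ)) := by
      rw [← Matrix.det_vandermonde fun x => ((e x).val : ℝ),
        ← Matrix.det_vandermonde fun x => ((f x).val : ℝ), ← Matrix.det_permute]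
      rfl
    have h4 : 0 ≤ ∏ x, ∏ y ∈ Finset.Ioi x, (((e y).val : ℝ) - ((e x).val : ℝ)) := by
      refine Finset.prod_nonneg fun x _ => Finset.prod_nonneg fun y hy => ?_
      have := e.strictMono (Finset.mem_Ioi.1 hy)
      rw [sub_nonneg]
      exact_mod_cast this.le
    have h5 := mul_nonneg h1 h4
    rw [h2, h3] at h5
    have hsign : ((Equiv.Perm.sign τ : ℤ) : ℝ) * ((Equiv.Perm.sign τ : ℤ) : ℝ) = 1 := by
      rcases Int.units_eq_one_or (Equiv.Perm.sign τ) with h | h <;> simp [h]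
    calc _ ≤ _ := h5
      _ = (((Equiv.Perm.sign τ : ℤ) : ℝ) * ((Equiv.Perm.sign τ : ℤ) : ℝ)) *
        ((A.submatrix id f).det *
          ∏ x, ∏ y ∈ Finset.Ioi x, (((f y).val : ℝ) - ((f x).val : ℝ))) := by ring
      _ = _ := by rw [hsign, one_mul]
  · obtain ⟨x, y, hxy, hne⟩ : ∃ x y, f x = f y ∧ x ≠ y := by
      simpa [Function.Injective] using hf
    rw [Matrix.det_zero_of_column_eq hne, zero_mul]
    intro z
    simp [hxy]

/-- The union of an initial interval and an interval. -/
def prefixUnion (σ p s : ℕ) : Set (Fin n) := {l | l.val < σ ∨ (p ≤ l.val ∧ l.val < s)}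

theorem mem_prefixUnion {σ p s : ℕ} {l : Fin n} :
    l ∈ (prefixUnion σ p s : Set (Fin n)) ↔ l.val < σ ∨ (p ≤ l.val ∧ l.val < s) := Iff.rfl

/-- Take a basis of the span of `W₀`, extend it by `r` and then to a basis for `W₁`, add `t`, and
extend to a basis of the whole space. The tuple `u` lists the basis elements other than `r` and `t`.
-/
theorem exists_adapted_tuple {v : Fin n → Fin k → ℝ} (hspan : Submodule.span ℝ (Set.range v) = ⊤)
    {W₀ W₁ : Set (Fin n)} {r t : Fin n} (hW : W₀ ⊆ W₁) (hr : r ∈ W₁) (hrW : r ∉ W₀)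
    (hr' : v r ∉ Submodule.span ℝ (v '' W₀)) (ht : t ∉ W₁)
    (ht' : v t ∉ Submodule.span ℝ (v '' W₁)) :
    ∃ k', ∃ _ : k' + 2 = k, ∃ u : Fin k' → Fin n,
      LinearIndependent ℝ (fun x => v (Matrix.vecCons r (Matrix.vecCons t u) x)) ∧
      Submodule.span ℝ (v '' W₀) ≤ Submodule.span ℝ (Set.range fun x => v (u x)) ∧
      Submodule.span ℝ (v '' W₁) ≤
        Submodule.span ℝ (insert (v r) (Set.range fun x => v (u x))) := by
  classical
  obtain ⟨b₀, hb₀, -, hs₀, hi₀⟩ := exists_linearIndepOn_extension (K := ℝ) (v := v)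
    (linearIndepOn_empty ℝ v) (Set.empty_subset W₀)
  have hi₀' : LinearIndepOn ℝ v (insert r b₀) :=
    hi₀.insert fun h => hr' (Submodule.span_mono (Set.image_mono hb₀) h)
  obtain ⟨b₁, hb₁, hb₁', hs₁, hi₁⟩ := exists_linearIndepOn_extension hi₀'
    (Set.insert_subset hr (hb₀.trans hW))
  have hi₁' : LinearIndepOn ℝ v (insert t b₁) :=
    hi₁.insert fun h => ht' (Submodule.span_mono (Set.image_mono hb₁) h)
  obtain ⟨b₂, -, hb₂', hs₂, hi₂⟩ := exists_linearIndepOn_extension hi₁' (Set.subset_univ _)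
  have hrt : r ≠ t := fun h => ht (h ▸ hr)
  have htb : t ∈ b₂ := hb₂' (Set.mem_insert _ _)
  have hrb : r ∈ b₂ := hb₂' (Set.mem_insert_of_mem _ (hb₁' (Set.mem_insert _ _)))
  have hcard : b₂.toFinset.card = k := by
    have h1 : Submodule.span ℝ (v '' b₂) = ⊤ := by
      rw [eq_top_iff, ← hspan]
      exact Submodule.span_le.2 (by simpa using hs₂)
    have h2 := finrank_span_eq_card hi₂
    rw [show Set.range (fun x : b₂ => v x) = v '' b₂ by ext; simp, h1, finrank_top,
      Module.finrank_fin_fun] at h2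
    rw [Set.toFinset_card, ← h2]
  have hcard' : ((b₂.toFinset.erase r).erase t).card + 2 = k := by
    rw [Finset.card_erase_of_mem (by simp [htb, hrt.symm]),
      Finset.card_erase_of_mem (by simp [hrb])]
    have : ({r, t} : Finset (Fin n)).card ≤ b₂.toFinset.card :=
      Finset.card_le_card (by intro x; simp; rintro (rfl | rfl) <;> assumption)
    rw [Finset.card_pair hrt] at this
    omega
  set B := (b₂.toFinset.erase r).erase t with hB
  have hBmem : ∀ x, x ∈ B ↔ x ∈ b₂ ∧ x ≠ r ∧ x ≠ t := by
    intro x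
    simp [hB]
    tauto
  set u : Fin B.card → Fin n := fun x => B.orderEmbOfFin rfl x with hu
  have hur : Set.range u = B := Finset.range_orderEmbOfFin B rfl
  have hur' : (Set.range fun x => v (u x)) = v '' B := by
    rw [← hur, ← Set.range_comp]
    rfl
  refine ⟨B.card, hcard', u, ?_, ?_, ?_⟩
  · have hrange : Set.range (Matrix.vecCons r (Matrix.vecCons t u)) = b₂ := by
      rw [Matrix.range_cons, Matrix.range_cons, hur]
      ext x
      simp only [Set.mem_union, Set.mem_singleton_iff, Finset.mem_coe, hBmem]
      constructor
      · rintro (rfl | rfl | h)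
        exacts [hrb, htb, h.1]
      · intro h
        tauto
    have hinj : Function.Injective (Matrix.vecCons r (Matrix.vecCons t u)) := by
      have hu_mem : ∀ x, u x ∈ B := fun x => by
        have : u x ∈ Set.range u := ⟨x, rfl⟩
        rwa [hur] at this
      rw [Matrix.vecCons, Fin.cons_injective_iff, Matrix.vecCons, Fin.cons_injective_iff]
      refine ⟨?_, ?_, (B.orderEmbOfFin rfl).injective⟩
      · rintro ⟨x, hx⟩
        refine Fin.cases (fun h => hrt h.symm) (fun x h => ?_) x hx
        exact ((hBmem _).1 (hu_mem x)).2.1 h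
      · rintro ⟨x, hx⟩
        exact ((hBmem _).1 (hu_mem x)).2.2 hx
    rw [← hrange] at hi₂
    exact (linearIndepOn_range_iff hinj v).1 hi₂
  · rw [hur']
    refine Submodule.span_le.2 (hs₀.trans (Submodule.span_mono (Set.image_mono fun x hx => ?_)))
    refine (hBmem x).2 ⟨hb₂' (Set.mem_insert_of_mem _ (hb₁' (Set.mem_insert_of_mem _ hx))), ?_, ?_⟩
    · rintro rfl
      exact hrW (hb₀ hx)
    · rintro rfl
      exact ht (hW (hb₀ hx))
  · rw [hur', ← Set.image_insert_eq]
    refine Submodule.span_le.2 (hs₁.trans (Submodule.span_mono (Set.image_mono fun x hx => ?_)))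
    by_cases hxr : x = r
    · exact Or.inl hxr
    · refine Or.inr ((hBmem x).2 ⟨hb₂' (Set.mem_insert_of_mem _ hx), hxr, ?_⟩)
      rintro rfl
      exact ht (hb₁ hx)

/-- The hypothesis `hpos` says that the maximal minors of `v` are non-negative if the columns are
ordered by increasing `c`. -/
theorem not_crossing {v : Fin n → Fin k → ℝ} {c : Fin n → ℝ} (hc : StrictAnti c)
    (hspan : Submodule.span ℝ (Set.range v) = ⊤)
    (hpos : ∀ f : Fin k → Fin n, 0 ≤ (Matrix.of fun x => v (f x)).det *
      ∏ x, ∏ y ∈ Finset.Ioi x, (c (f y) - c (f x)))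
    {i t r j : Fin n} (hit : i < t) (htr : t < r) (hrj : r < j)
    (h1 : ParallelMod v (prefixUnion i (t + 1) j) t j)
    (h2 : ParallelMod v (prefixUnion i (r + 1) j) r i) : False := by
  simp only [Fin.lt_def] at hit htr hrj
  have hW : (prefixUnion i (r + 1) j : Set (Fin n)) ⊆ prefixUnion i (t + 1) j := by
    intro l
    simp only [mem_prefixUnion]
    omega
  obtain ⟨k', rfl, u, hli, hs0, hs1⟩ := exists_adapted_tuple (r := r) (t := t) hspan hW
    (by rw [mem_prefixUnion]; omega) (by rw [mem_prefixUnion]; omega) h2.symm.1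
    (by rw [mem_prefixUnion]; omega) h1.symm.1
  set w : Fin k' → Fin (k' + 2) → ℝ := fun x => v (u x) with hw
  -- The determinant in the two free directions left by `u`: an alternating form that vanishes on
  -- the span of `u`.
  set D : (Fin (k' + 2) → ℝ) → (Fin (k' + 2) → ℝ) → ℝ := fun x y =>
    (Matrix.detRowAlternating (R := ℝ) (n := Fin (k' + 2))) (Matrix.vecCons x (Matrix.vecCons y w))
    with hD
  have hDcurry : ∀ x y, D x y =
      ((Matrix.detRowAlternating (R := ℝ) (n := Fin (k' + 2))).curryLeft x).curryLeft y w := by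
    intro x y
    rfl
  have add_left : ∀ x x' y, D (x + x') y = D x y + D x' y := by
    intro x x' y
    simp only [hDcurry, map_add, AlternatingMap.add_apply, AlternatingMap.curryLeft_add,
      LinearMap.add_apply]
  have smul_left : ∀ (a : ℝ) x y, D (a • x) y = a * D x y := by
    intro a x y
    simp only [hDcurry, map_smul, AlternatingMap.smul_apply, AlternatingMap.curryLeft_smul,
      LinearMap.smul_apply, smul_eq_mul]
  have self : ∀ x, D x x = 0 := fun x =>
    AlternatingMap.map_eq_zero_of_eq _ _ (i := 0) (j := 1) rfl (by simp)
  have left_mem : ∀ x y, D (w x) y = 0 := fun x y =>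
    AlternatingMap.map_eq_zero_of_eq _ _ (i := 0) (j := x.succ.succ) rfl
      (Fin.succ_ne_zero _).symm
  have add_right : ∀ x y y', D x (y + y') = D x y + D x y' := by
    intro x y y'
    simp only [hDcurry, map_add, AlternatingMap.add_apply]
  have anti : ∀ x y, D y x = - D x y := by
    intro x y
    have := self (x + y)
    rw [add_left, add_right, add_right, self, self] at this
    linarith
  have left_span : ∀ x ∈ Submodule.span ℝ (Set.range w), ∀ y, D x y = 0 := by
    intro x hx y
    induction hx using Submodule.span_induction with
    | mem x hx =>
      obtain ⟨z, rfl⟩ := hx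
      exact left_mem z y
    | zero =>
      have := smul_left 0 0 y
      simpa using this
    | add x x' _ _ h h' => rw [add_left, h, h', add_zero]
    | smul a x _ h => rw [smul_left, h, mul_zero]
  have hdet : ∀ x y, D (v x) (v y) =
      (Matrix.of fun z => v (Matrix.vecCons x (Matrix.vecCons y u) z)).det := by
    intro x y
    rw [hD]
    change Matrix.det _ = _
    congr 1
    ext z z'
    refine Fin.cases rfl (fun z => Fin.cases rfl (fun z => rfl) z) z
  have hδ : D (v r) (v t) ≠ 0 := by
    rw [hdet, ← isUnit_iff_ne_zero, ← Matrix.isUnit_iff_isUnit_det,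
      ← Matrix.linearIndependent_rows_iff_isUnit]
    exact hli
  obtain ⟨β, s, hs, hi⟩ := Submodule.mem_span_insert.1 (Set.image_insert_eq (f := v) ▸ h2.2)
  obtain ⟨α, ω, hω, hj⟩ := Submodule.mem_span_insert.1 (Set.image_insert_eq (f := v) ▸ h1.2)
  have hβ : β ≠ 0 := by
    rintro rfl
    rw [zero_smul, zero_add] at hi
    exact h2.1 (hi ▸ hs)
  have hα : α ≠ 0 := by
    rintro rfl
    rw [zero_smul, zero_add] at hj
    exact h1.1 (hj ▸ hω)
  have hDi : ∀ y, D (v i) y = β * D (v r) y := by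
    intro y
    rw [hi, add_left, smul_left, left_span s (hs0 hs), add_zero]
  -- The component of `v j` along `v r` does not matter, because the other argument is `v r`.
  have hDj : D (v j) (v r) = α * D (v t) (v r) := by
    obtain ⟨γ, ω', hω', rfl⟩ := Submodule.mem_span_insert.1 (hs1 hω)
    rw [hj, add_left, add_left, smul_left, smul_left, self, left_span ω' hω']
    ring
  have hV : ∀ x y, ∏ z, ∏ z' ∈ Finset.Ioi z,
        (c (Matrix.vecCons x (Matrix.vecCons y u) z') - c (Matrix.vecCons x (Matrix.vecCons y u) z))
      = (c y - c x) * (∏ z, (c (u z) - c x)) * (∏ z, (c (u z) - c y)) *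
        ∏ z, ∏ z' ∈ Finset.Ioi z, (c (u z') - c (u z)) := by
    intro x y
    simp only [Fin.prod_univ_succ, Fin.prod_Ioi_zero, Fin.prod_Ioi_succ, Matrix.cons_val_zero,
      Matrix.cons_val_succ]
    ring
  -- The pairs `jr`, `ji`, `rt`, `ti` form a cycle of length four. With `δ = D (v r) (v t)` the four
  -- determinants are `-αδ`, `-αβδ`, `δ`, `-βδ`, whose product is `-α²β²δ⁴`. Of the Vandermonde
  -- factors, each product over `u` belonging to one of `i, t, r, j` occurs twice, `V` occurs four
  -- times, and the remaining differences are positive. So four non-negative numbers would have a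
  -- negative product.
  have e1 := hpos (Matrix.vecCons j (Matrix.vecCons r u))
  have e2 := hpos (Matrix.vecCons j (Matrix.vecCons i u))
  have e3 := hpos (Matrix.vecCons r (Matrix.vecCons t u))
  have e4 := hpos (Matrix.vecCons t (Matrix.vecCons i u))
  rw [← hdet, hV] at e1 e2 e3 e4
  have c1 : c j < c r := hc (Fin.lt_def.2 hrj)
  have c2 : c r < c t := hc (Fin.lt_def.2 htr)
  have c3 : c t < c i := hc (Fin.lt_def.2 hit)
  rw [hDj, anti (v r) (v t)] at e1
  rw [anti (v i) (v j), hDi, anti (v j) (v r), hDj, anti (v r) (v t)] at e2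
  rw [anti (v i) (v t), hDi] at e4
  have hne : ∀ x y, D (v x) (v y) ≠ 0 → ∀ z, c (u z) - c x ≠ 0 ∧ c (u z) - c y ≠ 0 := by
    intro x y hxy z
    constructor
    · intro h
      have : u z = x := hc.injective (sub_eq_zero.1 h)
      apply hxy
      rw [← this]
      exact left_mem z _
    · intro h
      have : u z = y := hc.injective (sub_eq_zero.1 h)
      apply hxy
      rw [anti, ← this, neg_eq_zero]
      exact left_mem z _
  have n1 := hne r t hδ
  have n2 := hne j i (by
    rw [anti (v i) (v j), hDi, anti (v j) (v r), hDj, anti (v r) (v t)]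
    simp [hα, hβ, hδ])
  set δ := D (v r) (v t)
  set V := ∏ z, ∏ z' ∈ Finset.Ioi z, (c (u z') - c (u z)) with hVdef
  have hV0 : V ≠ 0 := by
    have hinj : Function.Injective u := by
      intro z z' hzz
      have h := hli.injective.comp (Fin.succ_injective _) |>.comp (Fin.succ_injective _)
      exact h (by simp [hzz])
    refine Finset.prod_ne_zero_iff.2 fun z _ => Finset.prod_ne_zero_iff.2 fun z' hz' => ?_
    rw [sub_ne_zero]
    exact hc.injective.ne (hinj.ne (Finset.mem_Ioi.1 hz').ne')
  set Pr := ∏ z, (c (u z) - c r)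
  set Pt := ∏ z, (c (u z) - c t)
  set Pi := ∏ z, (c (u z) - c i)
  set Pj := ∏ z, (c (u z) - c j)
  have p1 : Pr ≠ 0 := Finset.prod_ne_zero_iff.2 fun z _ => (n1 z).1
  have p2 : Pt ≠ 0 := Finset.prod_ne_zero_iff.2 fun z _ => (n1 z).2
  have p3 : Pj ≠ 0 := Finset.prod_ne_zero_iff.2 fun z _ => (n2 z).1
  have p4 : Pi ≠ 0 := Finset.prod_ne_zero_iff.2 fun z _ => (n2 z).2
  have hprod := mul_nonneg (mul_nonneg e1 e2) (mul_nonneg e3 e4)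
  have hneg : 0 < (α * β * δ ^ 2 * Pr * Pt * Pi * Pj * V ^ 2) ^ 2 *
      ((c r - c j) * (c i - c j) * (c t - c r) * (c i - c t)) := by
    have q1 := sub_pos.2 c1
    have q2 := sub_pos.2 c2
    have q3 := sub_pos.2 c3
    have q4 := sub_pos.2 (c1.trans (c2.trans c3))
    positivity
  linarith

/-! ### Labels of the pipes in terms of spans -/

/-- No two pairs of parallel elements cross. -/
def NonCrossing {E : Type*} [AddCommGroup E] [Module ℝ E] (v : Fin n → E) : Prop :=
  ∀ i t r j : Fin n, i < t → t < r → r < j → ParallelMod v (prefixUnion i (t + 1) j) t j →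
    ParallelMod v (prefixUnion i (r + 1) j) r i → False

theorem InCell.nonCrossing {M : Finset (Finset (Fin n))} {A : Matrix (Fin k) (Fin n) ℝ}
    (hA : InCell M A) : NonCrossing fun l => A.col l.rev := by
  intro i t r j hit htr hrj
  refine not_crossing (c := fun l => (l.rev.val : ℝ)) ?_ ?_ ?_ hit htr hrj
  · intro x y hxy
    simp only [Nat.cast_lt]
    exact Fin.rev_lt_rev.2 hxy
  · rw [← hA.span_col_eq_top, ← Fin.rev_surjective.range_comp A.col]
    rfl
  · intro f
    have := hA.det_mul_prod_nonneg fun x => (f x).rev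
    rw [← Matrix.det_transpose] at this
    exact this

variable {E : Type*} [AddCommGroup E] [Module ℝ E] {v : Fin n → E}

/-- `p` is the largest `q ≤ j` for which `v j` depends on the elements `< σ` and those in
`[q, j)`. -/
def IsTopLabel (v : Fin n → E) (σ : ℕ) (j : Fin n) (p : ℕ) : Prop :=
  ∀ q ≤ j.val, v j ∈ Submodule.span ℝ (v '' prefixUnion σ q j) ↔ q ≤ p

/-- `p` is the largest `q < s` for which `v i` depends on the elements `< i` and those in
`[q, s)`. -/
def IsLeftLabel (v : Fin n → E) (i : Fin n) (s p : ℕ) : Prop :=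
  ∀ q < s, v i ∈ Submodule.span ℝ (v '' prefixUnion i q s) ↔ q ≤ p

theorem span_prefixUnion_anti (v : Fin n → E) (σ s : ℕ) {p q : ℕ} (hpq : p ≤ q) :
    Submodule.span ℝ (v '' prefixUnion σ q s) ≤ Submodule.span ℝ (v '' prefixUnion σ p s) := by
  refine Submodule.span_mono (Set.image_mono fun l => ?_)
  simp only [mem_prefixUnion]
  omega

theorem insert_prefixUnion_left (i : Fin n) (p s : ℕ) :
    insert i (prefixUnion i p s : Set (Fin n)) = prefixUnion (i + 1) p s := by
  ext l
  simp only [Set.mem_insert_iff, mem_prefixUnion, Fin.ext_iff]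
  omega

theorem insert_prefixUnion_right {σ p : ℕ} {j : Fin n} (hp : p ≤ j) :
    insert j (prefixUnion σ p j : Set (Fin n)) = prefixUnion σ p (j + 1) := by
  ext l
  simp only [Set.mem_insert_iff, mem_prefixUnion, Fin.ext_iff]
  omega

theorem insert_prefixUnion_middle {σ s : ℕ} {p : Fin n} (hp : p.val < s) :
    insert p (prefixUnion σ (p + 1) s : Set (Fin n)) = prefixUnion σ p s := by
  ext l
  simp only [Set.mem_insert_iff, mem_prefixUnion, Fin.ext_iff]
  omega

theorem mem_span_exchange_iff (i j : Fin n) (X : Set (Fin n)) :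
    (v j ∈ Submodule.span ℝ (v '' insert i X) ∧ v j ∉ Submodule.span ℝ (v '' X)) ↔
      (v i ∈ Submodule.span ℝ (v '' insert j X) ∧ v i ∉ Submodule.span ℝ (v '' X)) :=
  ⟨fun h => have h' := ParallelMod.symm ⟨h.2, h.1⟩; ⟨h'.2, h'.1⟩,
    fun h => have h' := ParallelMod.symm ⟨h.2, h.1⟩; ⟨h'.2, h'.1⟩⟩

/-- Four memberships meet at the box with row label `i` and column label `j`: top (T) and bottom (B)
for `v j`, left (L) and right (R) for `v i`. Exchange over the common set `[0, i) ∪ [q, j)` gives: B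
without T if and only if L without R. Moreover T implies B, and R implies L. -/
theorem label_exchange {i j : Fin n} {q : ℕ} (hq : q ≤ j) :
    (v j ∈ Submodule.span ℝ (v '' prefixUnion (i + 1) q j) ∧
      v j ∉ Submodule.span ℝ (v '' prefixUnion i q j)) ↔
    (v i ∈ Submodule.span ℝ (v '' prefixUnion i q (j + 1)) ∧
      v i ∉ Submodule.span ℝ (v '' prefixUnion i q j)) := by
  rw [← insert_prefixUnion_left, ← insert_prefixUnion_right hq]
  exact mem_span_exchange_iff i j _

/-- The labels at a cross. -/
theorem labels_cross {i j : Fin n} {t l : ℕ} (ht : IsTopLabel v i j t)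
    (hl : IsLeftLabel v i (j + 1) l) (hlt : l < t) :
    IsTopLabel v (i + 1) j t ∧ IsLeftLabel v i j l := by
  have key : ∀ q ≤ j.val, (v j ∈ Submodule.span ℝ (v '' prefixUnion (i + 1) q j) ↔ q ≤ t) ∧
      (v i ∈ Submodule.span ℝ (v '' prefixUnion i q j) ↔ q ≤ l) := by
    intro q hq
    have h1 := label_exchange (v := v) (i := i) hq
    have h2 := ht q hq
    have h3 := hl q (by omega)
    have h4 : v j ∈ Submodule.span ℝ (v '' prefixUnion i q j) →
        v j ∈ Submodule.span ℝ (v '' prefixUnion (i + 1) q j) := by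
      rw [← insert_prefixUnion_left]
      exact fun h => Submodule.span_mono (Set.image_mono (Set.subset_insert _ _)) h
    have h5 : v i ∈ Submodule.span ℝ (v '' prefixUnion i q j) →
        v i ∈ Submodule.span ℝ (v '' prefixUnion i q (j + 1)) := by
      rw [← insert_prefixUnion_right hq]
      exact fun h => Submodule.span_mono (Set.image_mono (Set.subset_insert _ _)) h
    -- For `q ≤ t`, T and B hold, and the exchange forces L and R to agree. For `q > t > l`, both T
    -- and L fail, hence so do R and B.
    rcases le_or_gt q t with hqt | hqt
    · have hT := h2.2 hqt
      have hR : v i ∈ Submodule.span ℝ (v '' prefixUnion i q (j + 1)) →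
          v i ∈ Submodule.span ℝ (v '' prefixUnion i q j) := fun hL => by
        by_contra hR
        exact (h1.2 ⟨hL, hR⟩).2 hT
      exact ⟨iff_of_true (h4 hT) hqt, ⟨fun h => h3.1 (h5 h), fun h => hR (h3.2 h)⟩⟩
    · have hT := fun h => hqt.not_ge (h2.1 h)
      have hL := fun h => (hlt.trans hqt).not_ge (h3.1 h)
      exact ⟨iff_of_false (fun hB => hL (h1.1 ⟨hB, hT⟩).1) hqt.not_ge,
        iff_of_false (fun h => hL (h5 h)) (hlt.trans hqt).not_ge⟩
  exact ⟨fun q hq => (key q hq).1, fun q hq => (key q hq.le).2⟩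

/-- The labels at an elbow. -/
theorem labels_elbow (hv : NonCrossing v) {i j : Fin n} (hij : i < j)
    (hi : v i ∉ Submodule.span ℝ (v '' {l | l < i}))
    (hj : v j ∈ Submodule.span ℝ (v '' {l | l < j})) {t l : ℕ} (ht : IsTopLabel v i j t)
    (hl : IsLeftLabel v i (j + 1) l) (hlt : t < l) :
    IsTopLabel v (i + 1) j l ∧ IsLeftLabel v i j t := by
  -- For `t < q ≤ l` the exchange only says that exactly one of B and R holds. If it were R, then
  -- `i` would be parallel to some `r ≥ q` modulo `[0, i) ∪ (r, j)`, while `j` is parallel to `t`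
  -- modulo `[0, i) ∪ (t, j)`: a crossing `i < t < r < j`.
  have hnot : ∀ q ≤ j.val, t < q → v i ∉ Submodule.span ℝ (v '' prefixUnion i q j) := by
    intro q hq htq hR
    classical
    -- the largest `r` with this property
    obtain ⟨r, hrj, hqr, hr, hr'⟩ : ∃ r : Fin n, r < j ∧ q ≤ r.val ∧
        v i ∈ Submodule.span ℝ (v '' prefixUnion i r j) ∧
        v i ∉ Submodule.span ℝ (v '' prefixUnion i (r + 1) j) := by
      have hP : ∃ x, q ≤ x ∧ v i ∉ Submodule.span ℝ (v '' prefixUnion i (x + 1) j) := by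
        refine ⟨max q j, le_max_left _ _, ?_⟩
        convert hi using 4
        ext l
        rw [mem_prefixUnion]
        change _ ↔ l < i
        rw [Fin.lt_def]
        omega
      obtain ⟨h1, h2⟩ := Nat.find_spec hP
      set x := Nat.find hP
      have h3 : v i ∈ Submodule.span ℝ (v '' prefixUnion i x j) := by
        rcases h1.eq_or_lt with h | h
        · rwa [← h]
        · by_contra hcon
          refine Nat.find_min hP (m := x - 1) (by omega) ⟨by omega, ?_⟩
          rwa [show x - 1 + 1 = x by omega]
      have hxj : x < j.val := by
        by_contra hcon
        apply h2
        have : (prefixUnion i (x + 1) j : Set (Fin n)) = prefixUnion i x j := by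
          ext l
          rw [mem_prefixUnion, mem_prefixUnion]
          omega
        rwa [this]
      exact ⟨⟨x, by omega⟩, hxj, h1, h3, h2⟩
    rw [Fin.lt_def] at hij hrj
    -- Since R holds at `t + 1`, B fails there. This rules out `t ≤ i`, where B at `t + 1` would
    -- merely say that `v j` depends on its predecessors.
    have hB : v j ∉ Submodule.span ℝ (v '' prefixUnion (i + 1) (t + 1) j) := by
      intro h
      have hT : v j ∉ Submodule.span ℝ (v '' prefixUnion i (t + 1) j) := by
        rw [ht _ (by omega)]
        omega
      refine ((label_exchange (v := v) (by omega)).1 ⟨h, hT⟩).2 ?_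
      exact span_prefixUnion_anti v i j htq hR
    have hit : i.val < t := by
      by_contra hcon
      apply hB
      refine span_prefixUnion_anti v (i + 1) j (show t + 1 ≤ i + 1 by omega) ?_
      convert hj using 4
      ext l
      rw [mem_prefixUnion]
      change _ ↔ l < j
      rw [Fin.lt_def]
      omega
    refine hv i ⟨t, by omega⟩ r j hit (Fin.lt_def.2 (by simp only; omega)) hrj ⟨?_, ?_⟩ ⟨hr', ?_⟩
    · rw [ht _ (by simp only; omega)]
      simp
    · rw [insert_prefixUnion_middle (by simp only; omega), ht _ (by simp only; omega)]
    · rwa [insert_prefixUnion_middle hrj]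
  have key : ∀ q ≤ j.val, (v j ∈ Submodule.span ℝ (v '' prefixUnion (i + 1) q j) ↔ q ≤ l) ∧
      (v i ∈ Submodule.span ℝ (v '' prefixUnion i q j) ↔ q ≤ t) := by
    intro q hq
    have h1 := label_exchange (v := v) (i := i) hq
    have h2 := ht q hq
    have h3 := hl q (by omega)
    have h4 : v j ∈ Submodule.span ℝ (v '' prefixUnion i q j) →
        v j ∈ Submodule.span ℝ (v '' prefixUnion (i + 1) q j) := by
      rw [← insert_prefixUnion_left]
      exact fun h => Submodule.span_mono (Set.image_mono (Set.subset_insert _ _)) h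
    rcases le_or_gt q t with hqt | hqt
    · have hT := h2.2 hqt
      refine ⟨iff_of_true (h4 hT) (hqt.trans hlt.le), iff_of_true ?_ hqt⟩
      by_contra hR
      exact (h1.2 ⟨h3.2 (hqt.trans hlt.le), hR⟩).2 hT
    · have hT := fun h => hqt.not_ge (h2.1 h)
      have hR := hnot q hq hqt
      exact ⟨⟨fun hB => h3.1 (h1.1 ⟨hB, hT⟩).1, fun hql => (h1.2 ⟨h3.2 hql, hR⟩).1⟩,
        iff_of_false hR hqt.not_ge⟩
  exact ⟨fun q hq => (key q hq).1, fun q hq => (key q hq.le).2⟩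

/-- Elements `< σ + 1` do not span more than those `< σ` if `σ` depends on the latter. -/
theorem IsTopLabel.succ {s j : Fin n} {p : ℕ}
    (hs : v s ∈ Submodule.span ℝ (v '' {l | l < s})) (h : IsTopLabel v s j p) :
    IsTopLabel v (s + 1) j p := by
  intro q hq
  rw [← h q hq, ← insert_prefixUnion_left, Set.image_insert_eq, Submodule.span_insert_eq_span]
  exact Submodule.span_mono (Set.image_mono fun l hl => Or.inl hl) hs

/-- If adding `s` made `v i` dependent, then by exchange `v s` would depend on `i` and other
elements below `s`, which is impossible for a row label. -/
theorem IsLeftLabel.pred {i s : Fin n} {p : ℕ} (his : i < s)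
    (hs : v s ∉ Submodule.span ℝ (v '' {l | l < s})) (h : IsLeftLabel v i (s + 1) p) :
    IsLeftLabel v i s p := by
  intro q hq
  rw [← h q (by omega), ← insert_prefixUnion_right hq.le]
  refine ⟨fun h => Submodule.span_mono (Set.image_mono (Set.subset_insert _ _)) h, fun h => ?_⟩
  by_contra hcon
  refine hs (Submodule.span_mono (Set.image_mono ?_) ((mem_span_exchange_iff s i _).1 ⟨h, hcon⟩).1)
  intro l
  simp only [Set.mem_insert_iff, mem_prefixUnion]
  change _ → l < s
  rw [Fin.lt_def] at his ⊢
  rintro (rfl | h | h) <;> omega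

end Positivity

/-! ### The labels of the pipes of a Le-diagram -/

namespace LeDiagram

section Labels

variable {k m : ℕ} (L : LeDiagram k m)

theorem rowLen_le (r : ℕ) : L.shape.rowLen r ≤ m := by
  by_contra h
  exact absurd (L.col_lt (r, m) (YoungDiagram.mem_iff_lt_rowLen.2 (not_le.1 h))) (lt_irrefl m)

theorem mem_shape_of_le {r r' c c' : ℕ} (h : (r, c) ∈ L.shape) (hr : r' ≤ r) (hc : c' ≤ c) :
    (r', c') ∈ L.shape :=
  L.shape.up_left_mem hr hc h

theorem mem_shape_iff (r : Fin k) (c : Fin m) :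
    ((r : ℕ), (c : ℕ)) ∈ L.shape ↔ L.rowLabel r < L.colLabel c := by
  have h1 := YoungDiagram.mem_iff_lt_rowLen (μ := L.shape) (i := r) (j := c)
  have h2 := YoungDiagram.mem_iff_lt_colLen (μ := L.shape) (i := r) (j := c)
  have h3 := L.rowLen_le r
  have h4 := c.2
  rw [Fin.lt_def]
  simp only [rowLabel, colLabel]
  by_cases h : ((r : ℕ), (c : ℕ)) ∈ L.shape
  · simp only [h, true_iff] at h1 h2 ⊢
    omega
  · simp only [h, false_iff] at h1 h2 ⊢
    omega

theorem rowLabel_ne_colLabel (r : Fin k) (c : Fin m) : L.rowLabel r ≠ L.colLabel c := by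
  have h1 := YoungDiagram.mem_iff_lt_rowLen (μ := L.shape) (i := r) (j := c)
  have h2 := YoungDiagram.mem_iff_lt_colLen (μ := L.shape) (i := r) (j := c)
  have h3 := L.rowLen_le r
  have h4 := c.2
  have h5 := h1.symm.trans h2
  rw [Ne, Fin.ext_iff]
  simp only [rowLabel, colLabel]
  omega

theorem rowLabel_strictMono : StrictMono L.rowLabel := by
  intro r r' h
  have h1 := L.shape.rowLen_anti r r' (Fin.lt_def.1 h).le
  rw [Fin.lt_def] at h ⊢
  simp only [rowLabel]
  omega

theorem colLabel_strictAnti : StrictAnti L.colLabel := by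
  intro c c' h
  have h1 := L.shape.colLen_anti c c' (Fin.lt_def.1 h).le
  have h2 := c'.2
  rw [Fin.lt_def] at h ⊢
  simp only [colLabel]
  omega

theorem eq_rowLabel_or_eq_colLabel (x : Fin (k + m)) :
    (∃ r, x = L.rowLabel r) ∨ ∃ c, x = L.colLabel c := by
  have hinj : Function.Injective (Sum.elim L.rowLabel L.colLabel) :=
    Function.Injective.sumElim L.rowLabel_strictMono.injective L.colLabel_strictAnti.injective
      L.rowLabel_ne_colLabel
  have hbij := (Fintype.bijective_iff_injective_and_card _).2 ⟨hinj, by simp⟩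
  obtain ⟨r | c, h⟩ := hbij.2 x
  · exact Or.inl ⟨r, h.symm⟩
  · exact Or.inr ⟨c, h.symm⟩

variable {L}

theorem vLabel_of_plus {r : Fin k} {c : Fin m} (h : ((r : ℕ), (c : ℕ)) ∈ L.plus) :
    L.vLabel r c = L.hLabel (r + 1) c := by
  rw [vLabel, dif_pos (L.plus_subset _ h), if_pos h]

theorem hLabel_of_plus {r : Fin k} {c : Fin m} (h : ((r : ℕ), (c : ℕ)) ∈ L.plus) :
    L.hLabel r c = L.vLabel r (c + 1) := by
  rw [hLabel, dif_pos (L.plus_subset _ h), if_pos h]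

theorem vLabel_of_notMem_shape {r : Fin k} {c : ℕ} (h : ((r : ℕ), c) ∉ L.shape) :
    L.vLabel r c = L.rowLabel r := by
  rw [vLabel, dif_neg h]

theorem hLabel_of_notMem_shape {r : ℕ} {c : Fin m} (h : (r, (c : ℕ)) ∉ L.shape) :
    L.hLabel r c = L.colLabel c := by
  rw [hLabel, dif_neg h]

theorem vLabel_of_notMem_plus {r : Fin k} {c : ℕ} (h : ((r : ℕ), c) ∉ L.plus) :
    L.vLabel r c = L.vLabel r (c + 1) := by
  by_cases hs : ((r : ℕ), c) ∈ L.shape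
  · rw [vLabel, dif_pos hs, if_neg h]
  · rw [vLabel_of_notMem_shape hs, vLabel_of_notMem_shape]
    exact fun h' => hs (L.mem_shape_of_le h' le_rfl (Nat.le_succ c))

theorem hLabel_of_notMem_plus {r : ℕ} {c : Fin m} (h : (r, (c : ℕ)) ∉ L.plus) :
    L.hLabel r c = L.hLabel (r + 1) c := by
  by_cases hs : (r, (c : ℕ)) ∈ L.shape
  · rw [hLabel, dif_pos hs, if_neg h]
  · rw [hLabel_of_notMem_shape hs, hLabel_of_notMem_shape]
    exact fun h' => hs (L.mem_shape_of_le h' (Nat.le_succ r) le_rfl)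

variable (L)

theorem vLabel_of_le {r : Fin k} {c : ℕ} (h : m ≤ c) : L.vLabel r c = L.rowLabel r :=
  vLabel_of_notMem_shape fun h' => (L.col_lt _ h').not_ge h

theorem hLabel_of_le {r : ℕ} {c : Fin m} (h : k ≤ r) : L.hLabel r c = L.colLabel c :=
  hLabel_of_notMem_shape fun h' => (L.row_lt _ h').not_ge h

/-- Pipes are traced back towards the southeast, and `d` bounds the distance to that corner. At an
elbow the bound for one kind of segment comes from the strict bound for the other kind, so both are
proved together. -/
theorem label_bounds (d : ℕ) :
    (∀ (r : Fin k) (c : ℕ), k + m ≤ r + c + d → L.rowLabel r ≤ L.vLabel r c ∧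
      ∀ c' : Fin m, (c' : ℕ) < c → ((r : ℕ), (c' : ℕ)) ∈ L.shape → L.vLabel r c < L.colLabel c') ∧
    ∀ (r : ℕ) (c : Fin m), k + m ≤ r + c + d → L.hLabel r c ≤ L.colLabel c ∧
      ∀ r' : Fin k, (r' : ℕ) < r → ((r' : ℕ), (c : ℕ)) ∈ L.shape →
        L.rowLabel r' < L.hLabel r c := by
  induction d with
  | zero =>
    refine ⟨fun r c h => ?_, fun r c h => ?_⟩
    · have := r.2
      rw [L.vLabel_of_le (by omega)]
      exact ⟨le_rfl, fun c' _ h => (L.mem_shape_iff _ _).1 h⟩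
    · have := c.2
      rw [L.hLabel_of_le (by omega)]
      exact ⟨le_rfl, fun r' _ h => (L.mem_shape_iff _ _).1 h⟩
  | succ d ih =>
    obtain ⟨ihv, ihh⟩ := ih
    refine ⟨fun r c h => ?_, fun r c h => ?_⟩
    · by_cases hp : ((r : ℕ), c) ∈ L.plus
      · have hs := L.plus_subset _ hp
        have := vLabel_of_plus (L := L) (r := r) (c := ⟨c, L.col_lt _ hs⟩) hp
        simp only at this
        rw [this]
        obtain ⟨h1, h2⟩ := ihh (r + 1) ⟨c, L.col_lt _ hs⟩ (by simp only; omega)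
        exact ⟨(h2 r (Nat.lt_succ_self _) hs).le,
          fun c' hc' _ => h1.trans_lt (L.colLabel_strictAnti hc')⟩
      · rw [vLabel_of_notMem_plus hp]
        obtain ⟨h1, h2⟩ := ihv r (c + 1) (by omega)
        exact ⟨h1, fun c' hc' => h2 c' (by omega)⟩
    · by_cases hp : (r, (c : ℕ)) ∈ L.plus
      · have hs := L.plus_subset _ hp
        have := hLabel_of_plus (L := L) (r := ⟨r, L.row_lt _ hs⟩) (c := c) hp
        simp only at this
        rw [this]
        obtain ⟨h1, h2⟩ := ihv ⟨r, L.row_lt _ hs⟩ (c + 1) (by simp only; omega)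
        exact ⟨(h2 c (Nat.lt_succ_self _) hs).le,
          fun r' hr' _ => (L.rowLabel_strictMono hr').trans_le h1⟩
      · rw [hLabel_of_notMem_plus hp]
        obtain ⟨h1, h2⟩ := ihh (r + 1) c (by omega)
        exact ⟨h1, fun r' hr' => h2 r' (by omega)⟩

theorem rowLabel_le_vLabel (r : Fin k) (c : ℕ) : L.rowLabel r ≤ L.vLabel r c :=
  ((L.label_bounds (k + m)).1 r c (by omega)).1

theorem hLabel_le_colLabel (r : ℕ) (c : Fin m) : L.hLabel r c ≤ L.colLabel c :=
  ((L.label_bounds (k + m)).2 r c (by omega)).1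

variable {L}

theorem rowLabel_lt_hLabel {r : ℕ} {c : Fin m} {r' : Fin k} (hr : (r' : ℕ) < r)
    (h : ((r' : ℕ), (c : ℕ)) ∈ L.shape) : L.rowLabel r' < L.hLabel r c :=
  ((L.label_bounds (k + m)).2 r c (by omega)).2 r' hr h

variable (L)

/-- The horizontal segments above row `r` are passed by the pipes in the natural order, except that
a pipe that has crossed another one runs straight to the north. -/
def IsOrderedAbove (r : ℕ) : Prop :=
  ∀ c₁ c₂ : Fin m, c₂ < c₁ → L.hLabel r c₂ ≤ L.hLabel r c₁ → ∀ r' < r, (r', (c₁ : ℕ)) ∉ L.plus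

/-- The corresponding property of the lattice path that separates the boxes of row `r` from column
`c` on and the boxes in the rows above it from the other boxes. -/
structure IsOrderedAlong (r : Fin k) (c : ℕ) : Prop where
  top_top : ∀ c₁ c₂ : Fin m, c₂ < c₁ → c ≤ c₂ → L.hLabel r c₂ ≤ L.hLabel r c₁ →
    ∀ r' < (r : ℕ), (r', (c₁ : ℕ)) ∉ L.plus
  top_left : ∀ c₁ : Fin m, c ≤ c₁ → L.vLabel r c ≤ L.hLabel r c₁ →
    (∀ r' < (r : ℕ), (r', (c₁ : ℕ)) ∉ L.plus) ∨ ∀ c' < c, ((r : ℕ), c') ∉ L.plus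
  left_bottom : ∀ c₂ : Fin m, c₂ < c → ((r : ℕ), (c₂ : ℕ)) ∈ L.shape →
    L.vLabel r c < L.hLabel (r + 1) c₂
  top_bottom : ∀ c₁ c₂ : Fin m, c ≤ c₁ → c₂ < c → L.hLabel (r + 1) c₂ ≤ L.hLabel r c₁ →
    ∀ r' < (r : ℕ), (r', (c₁ : ℕ)) ∉ L.plus

variable {L}

/-- The lattice path is pushed across one box. At an elbow the pipes do not cross, and the `+` rules
out the inversions whose pipe would have to run straight through this box. At a cross the two pipes
become inverted, and it must be shown that one of them runs straight from here on. -/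
theorem IsOrderedAlong.pred {r : Fin k} (hr : L.IsOrderedAbove (r + 1)) {c : Fin m}
    (h : L.IsOrderedAlong r (c + 1)) : L.IsOrderedAlong r c := by
  have cases_le : ∀ {c₁ : Fin m}, (c : ℕ) ≤ c₁ → c₁ = c ∨ (c : ℕ) + 1 ≤ c₁ := by
    intro c₁ hc
    rcases hc.eq_or_lt with h | h
    · exact Or.inl (Fin.ext h.symm)
    · exact Or.inr h
  by_cases hp : ((r : ℕ), (c : ℕ)) ∈ L.plus
  · have hs := L.plus_subset _ hp
    have hab := h.left_bottom c (Nat.lt_succ_self _) hs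
    refine ⟨fun c₁ c₂ hc hc₂ hle => ?_, fun c₁ hc hle => ?_, fun c₂ hc hs₂ => ?_,
      fun c₁ c₂ hc hc₂ hle => ?_⟩
    · rcases cases_le hc₂ with rfl | hc₂
      · rw [hLabel_of_plus hp] at hle
        exact (h.top_left c₁ hc hle).resolve_right fun h' => h' _ (Nat.lt_succ_self _) hp
      · exact h.top_top c₁ c₂ hc hc₂ hle
    · rw [vLabel_of_plus hp] at hle
      rcases cases_le hc with rfl | hc
      · rw [hLabel_of_plus hp] at hle
        exact absurd hle hab.not_ge
      · exact Or.inl (h.top_bottom c₁ c hc (Nat.lt_succ_self _) hle)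
    · rw [vLabel_of_plus hp]
      by_contra hle
      exact hr c c₂ hc (not_lt.1 hle) r (Nat.lt_succ_self _) hp
    · rcases cases_le hc with rfl | hc
      · rw [hLabel_of_plus hp] at hle
        exact absurd hle (h.left_bottom c₂ (by omega)
          (L.mem_shape_of_le hs le_rfl hc₂.le)).not_ge
      · exact h.top_bottom c₁ c₂ hc (by omega) hle
  · have hv : L.vLabel r c = L.vLabel r (c + 1) := vLabel_of_notMem_plus hp
    have hh : L.hLabel r c = L.hLabel (r + 1) c := hLabel_of_notMem_plus hp
    refine ⟨fun c₁ c₂ hc hc₂ hle => ?_, fun c₁ hc hle => ?_, fun c₂ hc hs₂ => ?_,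
      fun c₁ c₂ hc hc₂ hle => ?_⟩
    · rcases cases_le hc₂ with rfl | hc₂
      · rw [hh] at hle
        exact h.top_bottom c₁ c₂ hc (Nat.lt_succ_self _) hle
      · exact h.top_top c₁ c₂ hc hc₂ hle
    · rcases cases_le hc with rfl | hc
      · by_cases hs : ((r : ℕ), (c₁ : ℕ)) ∈ L.shape
        · by_contra! hcon
          obtain ⟨⟨r', hr', hp₁⟩, c', hc', hp₂⟩ := hcon
          -- A `+` above and a `+` to the left would force a `+` here; this is where the Le-property
          -- enters.
          exact hp (L.le_property _ _ _ _ hs hr' hc' hp₁ hp₂)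
        · rw [vLabel_of_notMem_shape hs, hLabel_of_notMem_shape hs] at hle
          exact absurd ((L.mem_shape_iff _ _).2
            (hle.lt_of_ne (L.rowLabel_ne_colLabel _ _))) hs
      · rw [hv] at hle
        exact (h.top_left c₁ hc hle).imp_right fun h' c' hc' => h' c' (by omega)
    · rw [hv]
      exact h.left_bottom c₂ (by omega) hs₂
    · rcases cases_le hc with rfl | hc
      · rw [hh] at hle
        exact fun r' hr' => hr c₁ c₂ hc₂ hle r' (by omega)
      · exact h.top_bottom c₁ c₂ hc (by omega) hle

theorem IsOrderedAbove.along {r : Fin k} (hr : L.IsOrderedAbove (r + 1)) (c : ℕ) (hc : c ≤ m) :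
    L.IsOrderedAlong r c := by
  induction hc using Nat.decreasingInduction with
  | self =>
    refine ⟨fun c₁ c₂ _ h => ?_, fun c₁ h => ?_, fun c₂ _ hs => ?_, fun c₁ _ h => ?_⟩
    · exact absurd h c₂.2.not_ge
    · exact absurd h c₁.2.not_ge
    · rw [L.vLabel_of_le le_rfl]
      exact rowLabel_lt_hLabel (Nat.lt_succ_self _) hs
    · exact absurd h c₁.2.not_ge
  | of_succ c hc ih => exact IsOrderedAlong.pred (c := ⟨c, hc⟩) hr ih

variable (L)

theorem isOrderedAbove (r : ℕ) (hr : r ≤ k) : L.IsOrderedAbove r := by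
  induction hr using Nat.decreasingInduction with
  | self =>
    intro c₁ c₂ hc hle
    rw [L.hLabel_of_le le_rfl, L.hLabel_of_le le_rfl] at hle
    exact absurd hle (L.colLabel_strictAnti hc).not_ge
  | of_succ r hr ih =>
    intro c₁ c₂ hc hle
    exact (IsOrderedAbove.along (r := ⟨r, hr⟩) ih 0 (Nat.zero_le _)).top_top c₁ c₂ hc
      (Nat.zero_le _) hle

variable {L}

/-- The pipe that enters a box from the right has a smaller label than the one that enters it from
below. -/
theorem vLabel_lt_hLabel {r : Fin k} {c : Fin m} (h : ((r : ℕ), (c : ℕ)) ∈ L.shape) :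
    L.vLabel r (c + 1) < L.hLabel (r + 1) c :=
  ((L.isOrderedAbove (r + 1) r.2).along (c + 1) c.2).left_bottom c (Nat.lt_succ_self _) h

end Labels

end LeDiagram

-- Pipe labels as thresholds of spans in a realizing vector configuration

theorem Fin.lt_card_filter_iff {k : ℕ} {P : Fin k → Prop} [DecidablePred P]
    (hP : ∀ r r', r ≤ r' → P r' → P r) (r : Fin k) :
    (r : ℕ) < (Finset.univ.filter P).card ↔ P r := by
  constructor
  · intro h
    by_contra hr
    have hsub : Finset.univ.filter P ⊆ Finset.Iio r := by
      intro x hx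
      rw [Finset.mem_Iio]
      by_contra hle
      exact hr (hP _ _ (not_lt.1 hle) (Finset.mem_filter.1 hx).2)
    have := Finset.card_le_card hsub
    rw [Fin.card_Iio] at this
    omega
  · intro h
    have hsub : Finset.Iic r ⊆ Finset.univ.filter P := fun x hx =>
      Finset.mem_filter.2 ⟨Finset.mem_univ _, hP _ _ (Finset.mem_Iic.1 hx) h⟩
    have := Finset.card_le_card hsub
    rw [Fin.card_Iic] at this
    omega

theorem Fin.eq_of_forall_lt_iff {k a b : ℕ} (ha : a ≤ k) (hb : b ≤ k)
    (h : ∀ r : Fin k, (r : ℕ) < a ↔ (r : ℕ) < b) : a = b := by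
  rcases lt_trichotomy a b with hab | hab | hab
  · exact absurd ((h ⟨a, by omega⟩).2 hab) (lt_irrefl a)
  · exact hab
  · exact absurd ((h ⟨b, by omega⟩).1 hab) (lt_irrefl b)

namespace LeDiagram

section Realization

variable {k m : ℕ} (L : LeDiagram k m)

/-- The number of rows with a label `< σ`. -/
def rowCount (σ : ℕ) : ℕ := (Finset.univ.filter fun r : Fin k => (L.rowLabel r : ℕ) < σ).card

/-- The number of columns with a label `≥ s`. -/
def colCount (s : ℕ) : ℕ := (Finset.univ.filter fun c : Fin m => s ≤ (L.colLabel c : ℕ)).card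

theorem lt_rowCount_iff (σ : ℕ) (r : Fin k) : (r : ℕ) < L.rowCount σ ↔ (L.rowLabel r : ℕ) < σ :=
  Fin.lt_card_filter_iff (fun _ _ h h' =>
    (Fin.le_def.1 (L.rowLabel_strictMono.monotone h)).trans_lt h') r

theorem lt_colCount_iff (s : ℕ) (c : Fin m) : (c : ℕ) < L.colCount s ↔ s ≤ (L.colLabel c : ℕ) :=
  Fin.lt_card_filter_iff (P := fun c => s ≤ (L.colLabel c : ℕ)) (fun _ _ h h' =>
    h'.trans (Fin.le_def.1 (L.colLabel_strictAnti.antitone h))) c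

theorem rowCount_le (σ : ℕ) : L.rowCount σ ≤ k := (Finset.card_le_univ _).trans (by simp)

theorem colCount_le (s : ℕ) : L.colCount s ≤ m := (Finset.card_le_univ _).trans (by simp)

theorem rowCount_rowLabel (r : Fin k) : L.rowCount (L.rowLabel r) = r :=
  Fin.eq_of_forall_lt_iff (L.rowCount_le _) r.2.le fun r' => by
    rw [lt_rowCount_iff, ← Fin.lt_def, L.rowLabel_strictMono.lt_iff_lt, Fin.lt_def]

theorem rowCount_rowLabel_succ (r : Fin k) : L.rowCount (L.rowLabel r + 1) = r + 1 :=
  Fin.eq_of_forall_lt_iff (L.rowCount_le _) r.2 fun r' => by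
    rw [lt_rowCount_iff, Nat.lt_succ_iff, ← Fin.le_def, L.rowLabel_strictMono.le_iff_le, Fin.le_def,
      Nat.lt_succ_iff]

theorem rowCount_colLabel_succ (c : Fin m) :
    L.rowCount (L.colLabel c + 1) = L.rowCount (L.colLabel c) :=
  Fin.eq_of_forall_lt_iff (L.rowCount_le _) (L.rowCount_le _) fun r => by
    have := Fin.val_ne_of_ne (L.rowLabel_ne_colLabel r c)
    rw [lt_rowCount_iff, lt_rowCount_iff]
    omega

theorem colCount_colLabel (c : Fin m) : L.colCount (L.colLabel c) = c + 1 :=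
  Fin.eq_of_forall_lt_iff (L.colCount_le _) c.2 fun c' => by
    rw [lt_colCount_iff, ← Fin.le_def, L.colLabel_strictAnti.le_iff_ge, Fin.le_def,
      Nat.lt_succ_iff]

theorem colCount_colLabel_succ (c : Fin m) : L.colCount (L.colLabel c + 1) = c :=
  Fin.eq_of_forall_lt_iff (L.colCount_le _) c.2.le fun c' => by
    rw [lt_colCount_iff, Nat.succ_le_iff, ← Fin.lt_def, L.colLabel_strictAnti.lt_iff_gt, Fin.lt_def]

theorem colCount_rowLabel_succ (r : Fin k) :
    L.colCount (L.rowLabel r + 1) = L.colCount (L.rowLabel r) :=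
  Fin.eq_of_forall_lt_iff (L.colCount_le _) (L.colCount_le _) fun c => by
    have := Fin.val_ne_of_ne (L.rowLabel_ne_colLabel r c)
    rw [lt_colCount_iff, lt_colCount_iff]
    omega

theorem colCount_eq_zero : L.colCount (k + m) = 0 :=
  Fin.eq_of_forall_lt_iff (L.colCount_le _) (Nat.zero_le _) fun c => by
    rw [lt_colCount_iff]
    have := (L.colLabel c).2
    omega

theorem rowCount_zero : L.rowCount 0 = 0 :=
  Fin.eq_of_forall_lt_iff (L.rowCount_le _) (Nat.zero_le _) fun r => by
    rw [lt_rowCount_iff]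
    omega

variable {E : Type*} [AddCommGroup E] [Module ℝ E]

/-- The vector configuration `v` determines the labels of the pipes at the north and west sides
of `L`. -/
structure IsRealizedBy (v : Fin (k + m) → E) : Prop where
  nonCrossing : NonCrossing v
  row : ∀ r, v (L.rowLabel r) ∉ Submodule.span ℝ (v '' {l | l < L.rowLabel r})
  col : ∀ c, v (L.colLabel c) ∈ Submodule.span ℝ (v '' {l | l < L.colLabel c})
  top : ∀ c, IsTopLabel v 0 (L.colLabel c) (L.hLabel 0 c)
  left : ∀ r, IsLeftLabel v (L.rowLabel r) (k + m) (L.vLabel r 0)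
  hLabel_ne : ∀ c, L.hLabel 0 c ≠ L.colLabel c
  vLabel_ne : ∀ r, L.vLabel r 0 ≠ L.rowLabel r

variable {L} {v : Fin (k + m) → E}

/-- A column label `z` has `π z < z`, and the cyclic interval from `π z` to `z` is an ordinary
interval, as in `IsTopLabel` with `σ = 0`. A row label has `z < π z`, and the interval wraps around
to `[0, z) ∪ (π z, k + m)`, as in `IsLeftLabel` with `s = k + m`. -/
theorem HasPerm.isRealizedBy {π : Equiv.Perm (Fin (k + m))} (hL : L.HasPerm π)
    (hv : NonCrossing v) (h : ∀ z, π z ≠ z ∧ ParallelMod v (cyclicIoo (π z) z) z (π z)) :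
    L.IsRealizedBy v := by
  have hcol : ∀ c, π (L.colLabel c) < L.colLabel c := fun c =>
    lt_of_le_of_ne (by rw [hL.2]; exact L.hLabel_le_colLabel 0 c) (h _).1
  have hrow : ∀ r, L.rowLabel r < π (L.rowLabel r) := fun r =>
    lt_of_le_of_ne (by rw [hL.1]; exact L.rowLabel_le_vLabel r 0) (h _).1.symm
  have hcol' : ∀ c, v (L.colLabel c) ∈
      Submodule.span ℝ (v '' prefixUnion 0 (π (L.colLabel c)) (L.colLabel c)) := by
    intro c
    have h1 := hcol c
    refine Submodule.span_mono (Set.image_mono ?_) (h (L.colLabel c)).2.symm.2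
    intro l
    simp only [Set.mem_insert_iff, mem_cyclicIoo, mem_prefixUnion, Fin.lt_def, Fin.ext_iff]
      at h1 ⊢
    omega
  refine ⟨hv, fun r hcon => ?_, fun c => ?_, fun c q hq => ?_, fun r q hq => ?_, fun c => ?_,
    fun r => ?_⟩
  · refine (h (L.rowLabel r)).2.symm.1 (Submodule.span_mono (Set.image_mono ?_) hcon)
    intro l hl
    exact Or.inr ⟨hrow r, Or.inr hl⟩
  · refine Submodule.span_mono (Set.image_mono ?_) (hcol' c)
    rintro l (hl | hl)
    · exact absurd hl (Nat.not_lt_zero _)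
    · exact hl.2
  · rw [← hL.2]
    refine ⟨fun hmem => ?_, fun hle => span_prefixUnion_anti v _ _ hle (hcol' c)⟩
    by_contra hlt
    refine (h (L.colLabel c)).2.symm.1 (Submodule.span_mono (Set.image_mono ?_) hmem)
    intro l
    simp only [mem_cyclicIoo, mem_prefixUnion, Fin.lt_def]
    omega
  · rw [← hL.1]
    have h1 := hrow r
    constructor
    · intro hmem
      by_contra hlt
      refine (h (L.rowLabel r)).2.symm.1 (Submodule.span_mono (Set.image_mono ?_) hmem)
      intro l
      simp only [mem_cyclicIoo, mem_prefixUnion, Fin.lt_def] at h1 ⊢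
      omega
    · intro hle
      refine span_prefixUnion_anti v _ _ hle (Submodule.span_mono (Set.image_mono ?_)
        (h (L.rowLabel r)).2.symm.2)
      intro l
      have := l.2
      simp only [Set.mem_insert_iff, mem_cyclicIoo, mem_prefixUnion, Fin.lt_def, Fin.ext_iff]
        at h1 ⊢
      omega
  · rw [← hL.2]
    exact (h _).1
  · rw [← hL.1]
    exact (h _).1

namespace IsRealizedBy

/-- The pipe from the right always has the smaller label. In terms of the left label `l` and the top
label `t` this reads `l < t` at a cross and `t < l` at an elbow, as `labels_cross` and
`labels_elbow` require. -/
theorem labels_box (hv : L.IsRealizedBy v) {r : Fin k} {c : Fin m}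
    (hs : ((r : ℕ), (c : ℕ)) ∈ L.shape)
    (ht : IsTopLabel v (L.rowLabel r) (L.colLabel c) (L.hLabel r c))
    (hl : IsLeftLabel v (L.rowLabel r) (L.colLabel c + 1) (L.vLabel r c)) :
    IsTopLabel v (L.rowLabel r + 1) (L.colLabel c) (L.hLabel (r + 1) c) ∧
      IsLeftLabel v (L.rowLabel r) (L.colLabel c) (L.vLabel r (c + 1)) := by
  have hlt := Fin.lt_def.1 (vLabel_lt_hLabel hs)
  by_cases hp : ((r : ℕ), (c : ℕ)) ∈ L.plus
  · rw [hLabel_of_plus hp] at ht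
    rw [vLabel_of_plus hp] at hl
    exact labels_elbow hv.nonCrossing ((L.mem_shape_iff r c).1 hs) (hv.row r) (hv.col c) ht hl hlt
  · rw [hLabel_of_notMem_plus hp] at ht
    rw [vLabel_of_notMem_plus hp] at hl
    exact labels_cross ht hl hlt

/-- Lowering `s` from `k + m` means walking east along row `r` from the west side. Passing a row
label changes nothing, passing a column label crosses one box. -/
theorem isLeftLabel_of_isTopLabel (hv : L.IsRealizedBy v) (r : Fin k)
    (ht : ∀ c, L.rowLabel r ≤ L.colLabel c →
      IsTopLabel v (L.rowLabel r) (L.colLabel c) (L.hLabel r c)) (s : ℕ) (hs : s ≤ k + m) :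
    L.rowLabel r < s → IsLeftLabel v (L.rowLabel r) s (L.vLabel r (L.colCount s)) := by
  induction hs using Nat.decreasingInduction with
  | self =>
    intro _
    rw [colCount_eq_zero]
    exact hv.left r
  | of_succ s hs ih =>
    intro hrs
    have ih := ih (by omega)
    rcases L.eq_rowLabel_or_eq_colLabel ⟨s, hs⟩ with ⟨r', hr'⟩ | ⟨c, hc⟩
    · obtain rfl : s = L.rowLabel r' := congrArg Fin.val hr'
      rw [colCount_rowLabel_succ] at ih
      exact ih.pred (Fin.lt_def.2 hrs) (hv.row r')
    · obtain rfl : s = L.colLabel c := congrArg Fin.val hc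
      rw [colCount_colLabel_succ] at ih
      rw [colCount_colLabel]
      exact (hv.labels_box ((L.mem_shape_iff r c).2 hrs) (ht c hrs.le) ih).2

/-- Raising `σ` means walking south. The labels on top of a row give all labels on its vertical
segments, and these give the labels below it. -/
theorem isTopLabel (hv : L.IsRealizedBy v) (σ : ℕ) :
    ∀ c, σ ≤ L.colLabel c → IsTopLabel v σ (L.colLabel c) (L.hLabel (L.rowCount σ) c) := by
  induction σ with
  | zero =>
    intro c _
    rw [rowCount_zero]
    exact hv.top c
  | succ σ ih =>
    intro c hc
    have hσ : σ < k + m := by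
      have := (L.colLabel c).2
      omega
    rcases L.eq_rowLabel_or_eq_colLabel ⟨σ, hσ⟩ with ⟨r, hr⟩ | ⟨c', hc'⟩
    · obtain rfl : σ = L.rowLabel r := congrArg Fin.val hr
      rw [rowCount_rowLabel] at ih
      rw [rowCount_rowLabel_succ]
      refine (hv.labels_box ((L.mem_shape_iff r c).2 hc) (ih c (by omega)) ?_).1
      have := hv.isLeftLabel_of_isTopLabel r ih (L.colLabel c + 1) (L.colLabel c).2 (by omega)
      rwa [colCount_colLabel_succ] at this
    · obtain rfl : σ = L.colLabel c' := congrArg Fin.val hc'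
      rw [rowCount_colLabel_succ]
      exact (ih c (by omega)).succ (hv.col c')

theorem isLeftLabel (hv : L.IsRealizedBy v) (r : Fin k) (s : ℕ) (hs : s ≤ k + m)
    (hrs : L.rowLabel r < s) :
    IsLeftLabel v (L.rowLabel r) s (L.vLabel r (L.colCount s)) := by
  refine hv.isLeftLabel_of_isTopLabel r (fun c hc => ?_) s hs hrs
  have := hv.isTopLabel (L.rowLabel r) c hc
  rwa [rowCount_rowLabel] at this

end IsRealizedBy

end Realization

end LeDiagram

-- Labels as natural numbers along rows and columns

theorem Nat.exists_next {P : ℕ → Prop} {a b : ℕ} (hab : a ≤ b) (hb : P b) :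
    ∃ b, a ≤ b ∧ P b ∧ ∀ x, a ≤ x → x < b → ¬ P x := by
  classical
  have h : ∃ x, a ≤ x ∧ P x := ⟨b, hab, hb⟩
  exact ⟨Nat.find h, (Nat.find_spec h).1, (Nat.find_spec h).2,
    fun x hx hlt hP => Nat.find_min h hlt ⟨hx, hP⟩⟩

theorem Nat.exists_prev {P : ℕ → Prop} {a b : ℕ} (hab : a < b) (ha : P a) :
    ∃ a, a < b ∧ P a ∧ ∀ x, a < x → x < b → ¬ P x := by
  classical
  induction b with
  | zero => omega
  | succ b ih =>
    by_cases hb : P b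
    · exact ⟨b, by omega, hb, fun x h1 h2 => by omega⟩
    · obtain ⟨a', h1, h2, h3⟩ := ih (by
        rcases Nat.lt_succ_iff_lt_or_eq.1 hab with h | rfl
        · exact h
        · exact absurd ha hb)
      refine ⟨a', by omega, h2, fun x hx hxb => ?_⟩
      rcases Nat.lt_succ_iff_lt_or_eq.1 hxb with h | rfl
      · exact h3 x hx h
      · exact hb

namespace LeDiagram

section Numbers

variable {k m : ℕ} (L : LeDiagram k m)

/-- The label `rowLabel r` as a natural number. -/
def rowNum (r : ℕ) : ℕ := r + (m - L.shape.rowLen r)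

/-- The label `colLabel c` as a natural number. -/
def colNum (c : ℕ) : ℕ := (m - 1 - c) + L.shape.colLen c

/-- The label `vLabel r c` as a natural number. -/
def vNum (r c : ℕ) : ℕ := if h : r < k then L.vLabel ⟨r, h⟩ c else 0

/-- The label `hLabel r c` as a natural number. -/
def hNum (r c : ℕ) : ℕ := if h : c < m then L.hLabel r ⟨c, h⟩ else 0

theorem rowNum_coe (r : Fin k) : L.rowNum r = L.rowLabel r := rfl

theorem colNum_coe (c : Fin m) : L.colNum c = L.colLabel c := rfl

theorem vNum_coe (r : Fin k) (c : ℕ) : L.vNum r c = L.vLabel r c := dif_pos r.2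

theorem hNum_coe (r : ℕ) (c : Fin m) : L.hNum r c = L.hLabel r c := dif_pos c.2

theorem rowNum_strictMono : StrictMono L.rowNum := by
  intro r r' h
  have h1 := L.shape.rowLen_anti r r' h.le
  simp only [rowNum]
  omega

theorem colNum_lt_colNum {c c' : ℕ} (h : c < c') (hc : c' < m) : L.colNum c' < L.colNum c := by
  have h1 := L.shape.colLen_anti c c' h.le
  simp only [colNum]
  omega

theorem colNum_lt {c : ℕ} (hc : c < m) : L.colNum c < k + m := (L.colLabel ⟨c, hc⟩).2

variable {L}

theorem plus_row_lt {r c : ℕ} (h : (r, c) ∈ L.plus) : r < k := L.row_lt _ (L.plus_subset _ h)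

theorem plus_col_lt {r c : ℕ} (h : (r, c) ∈ L.plus) : c < m := L.col_lt _ (L.plus_subset _ h)

theorem exists_fin_of_plus {r c : ℕ} (h : (r, c) ∈ L.plus) :
    ∃ (r' : Fin k) (c' : Fin m), (r' : ℕ) = r ∧ (c' : ℕ) = c :=
  ⟨⟨r, plus_row_lt h⟩, ⟨c, plus_col_lt h⟩, rfl, rfl⟩

theorem vNum_of_plus {r c : ℕ} (h : (r, c) ∈ L.plus) : L.vNum r c = L.hNum (r + 1) c := by
  obtain ⟨r, c, rfl, rfl⟩ := exists_fin_of_plus h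
  rw [vNum_coe, hNum_coe, vLabel_of_plus h]

theorem hNum_of_plus {r c : ℕ} (h : (r, c) ∈ L.plus) : L.hNum r c = L.vNum r (c + 1) := by
  obtain ⟨r, c, rfl, rfl⟩ := exists_fin_of_plus h
  rw [vNum_coe, hNum_coe, hLabel_of_plus h]

theorem vNum_eq_of_notMem_plus {r a b : ℕ} (hab : a ≤ b)
    (h : ∀ c, a ≤ c → c < b → (r, c) ∉ L.plus) : L.vNum r a = L.vNum r b := by
  induction b, hab using Nat.le_induction with
  | base => rfl
  | succ b hab ih =>
    rw [ih fun c h1 h2 => h c h1 (by omega)]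
    unfold vNum
    split_ifs with hr
    · rw [vLabel_of_notMem_plus (h b hab (Nat.lt_succ_self b))]
    · rfl

theorem hNum_eq_of_notMem_plus {a b c : ℕ} (hab : a ≤ b)
    (h : ∀ r, a ≤ r → r < b → (r, c) ∉ L.plus) : L.hNum a c = L.hNum b c := by
  induction b, hab using Nat.le_induction with
  | base => rfl
  | succ b hab ih =>
    rw [ih fun c h1 h2 => h c h1 (by omega)]
    unfold hNum
    split_ifs with hc
    · rw [hLabel_of_notMem_plus (h b hab (Nat.lt_succ_self b))]
    · rfl

theorem vNum_eq_rowNum {r c : ℕ} (hr : r < k) (h : ∀ b, c ≤ b → (r, b) ∉ L.plus) :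
    L.vNum r c = L.rowNum r := by
  rw [vNum_eq_of_notMem_plus (le_max_left c m) fun b hb _ => h b hb,
    show L.vNum r (max c m) = _ from L.vNum_coe ⟨r, hr⟩ _, L.vLabel_of_le (le_max_right c m)]
  rfl

theorem hNum_eq_colNum {r c : ℕ} (hc : c < m) (h : ∀ b, r ≤ b → (b, c) ∉ L.plus) :
    L.hNum r c = L.colNum c := by
  rw [hNum_eq_of_notMem_plus (le_max_left r k) fun b hb _ => h b hb,
    show L.hNum (max r k) c = _ from L.hNum_coe _ ⟨c, hc⟩, L.hLabel_of_le (le_max_right r k)]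
  rfl

theorem num_bounds {r c : ℕ} (h : (r, c) ∈ L.plus) :
    L.rowNum r ≤ L.vNum r (c + 1) ∧ L.vNum r (c + 1) < L.hNum (r + 1) c ∧
      L.hNum (r + 1) c ≤ L.colNum c ∧ L.colNum c < k + m := by
  obtain ⟨r, c, rfl, rfl⟩ := exists_fin_of_plus h
  rw [vNum_coe, hNum_coe, rowNum_coe, colNum_coe]
  exact ⟨L.rowLabel_le_vLabel _ _, vLabel_lt_hLabel (L.plus_subset _ h), L.hLabel_le_colLabel _ _,
    Fin.is_lt _⟩

end Numbers

/-! ### Labels and positions of the darts -/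

section Darts

variable {k m : ℕ} (L : LeDiagram k m)

/-- The (reversed) label of the trip that leaves along a dart. -/
def outNum : LeDart k m → ℕ
  | .whiteTop X => L.hNum X.1 X.2
  | .whiteRight X => L.rowNum X.1
  | .whiteDiag X => L.colNum X.2
  | .blackDiag X => L.rowNum X.1
  | .blackLeft X => L.vNum X.1 X.2
  | .blackBottom X => L.colNum X.2
  | .west r => L.rowNum r
  | .north c => L.colNum c

/-- The (reversed) label of the trip that arrives along a dart. -/
def arrNum : LeDart k m → ℕ
  | .whiteTop X => L.colNum X.2
  | .whiteRight X => L.vNum X.1 (X.2 + 1)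
  | .whiteDiag X => L.rowNum X.1
  | .blackDiag X => L.colNum X.2
  | .blackLeft X => L.rowNum X.1
  | .blackBottom X => L.hNum (X.1 + 1) X.2
  | .west r => L.vNum r 0
  | .north c => L.hNum 0 c

/-- The smaller one of the two labels of a dart. -/
def loNum : LeDart k m → ℕ
  | .whiteTop X => L.hNum X.1 X.2
  | .whiteRight X => L.rowNum X.1
  | .whiteDiag X => L.rowNum X.1
  | .blackDiag X => L.rowNum X.1
  | .blackLeft X => L.rowNum X.1
  | .blackBottom X => L.hNum (X.1 + 1) X.2
  | .west r => L.rowNum r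
  | .north c => L.hNum 0 c

/-- The larger one of the two labels of a dart. -/
def hiNum : LeDart k m → ℕ
  | .whiteTop X => L.colNum X.2
  | .whiteRight X => L.vNum X.1 (X.2 + 1)
  | .whiteDiag X => L.colNum X.2
  | .blackDiag X => L.colNum X.2
  | .blackLeft X => L.vNum X.1 X.2
  | .blackBottom X => L.colNum X.2
  | .west r => L.vNum r 0
  | .north c => L.colNum c

/-- The third label at the vertex of a dart, increased by one; `0` and `k + m + 1` stand for the two
infinite ends. -/
def endNum : LeDart k m → ℕ
  | .whiteTop X => L.rowNum X.1 + 1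
  | .whiteRight X => L.colNum X.2 + 1
  | .whiteDiag X => L.hNum X.1 X.2 + 1
  | .blackDiag X => L.vNum X.1 X.2 + 1
  | .blackLeft X => L.colNum X.2 + 1
  | .blackBottom X => L.rowNum X.1 + 1
  | .west _ => k + m + 1
  | .north _ => 0

/-- The dart is based at the lower end of its edge. -/
def IsLower : LeDart k m → Prop
  | .whiteTop _ => False
  | .whiteRight _ => False
  | .whiteDiag _ => True
  | .blackDiag _ => False
  | .blackLeft _ => True
  | .blackBottom _ => True
  | .west _ => False
  | .north _ => True

/-- The two darts form an edge of the pipe graph. -/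
def Joined (d e : LeDart k m) : Prop := L.Glue d e ∨ L.Glue e d

variable {L}

theorem Joined.symm {d e : LeDart k m} (h : L.Joined d e) : L.Joined e d := Or.symm h

/-- A pipe keeps its label between consecutive boxes with `+`, so the trips in both directions, and
with them the two labels of the line, agree at the two halves of an edge. The third label grows from
the lower to the upper end, as the coordinate `r` on the line does. -/
theorem Glue.nums {d e : LeDart k m} (h : L.Glue d e) :
    (IsLower d ↔ ¬ IsLower e) ∧ L.outNum d = L.arrNum e ∧ L.arrNum d = L.outNum e ∧
      L.loNum d = L.loNum e ∧ L.hiNum d = L.hiNum e ∧ L.loNum d < L.hiNum d ∧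
      L.hiNum d < k + m ∧ (IsLower d → L.endNum d < L.endNum e) ∧
      (IsLower e → L.endNum e < L.endNum d) := by
  cases h with
  | @diag X h =>
    obtain ⟨r, c⟩ := X
    obtain ⟨h1, h2, h3, h4⟩ := num_bounds h
    simp only [IsLower, outNum, arrNum, loNum, hiNum, endNum, vNum_of_plus h, hNum_of_plus h]
    refine ⟨by simp, trivial, trivial, trivial, trivial, by omega, by omega, by omega, by simp⟩
  | @row r a b ha hb hab h =>
    obtain ⟨h1, h2, h3, h4⟩ := num_bounds hb
    have h5 := L.colNum_lt_colNum hab (plus_col_lt hb)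
    have h6 := vNum_eq_of_notMem_plus (L := L) (r := r) (a := a + 1) (b := b) hab h
    have h7 := vNum_of_plus hb
    simp only [IsLower, outNum, arrNum, loNum, hiNum, endNum]
    refine ⟨by simp, trivial, h6, trivial, h6, by omega, by omega, by simp, by omega⟩
  | @col a b c ha hb hab h =>
    obtain ⟨h1, h2, h3, h4⟩ := num_bounds hb
    have h5 := L.rowNum_strictMono hab
    have h6 := hNum_eq_of_notMem_plus (L := L) (c := c) (a := a + 1) (b := b) hab h
    have h7 := hNum_of_plus hb
    simp only [IsLower, outNum, arrNum, loNum, hiNum, endNum]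
    refine ⟨by simp, trivial, h6, h6, trivial, by omega, by omega, by omega, by simp⟩
  | @west r a ha h =>
    obtain ⟨h1, h2, h3, h4⟩ := num_bounds ha
    have h6 := vNum_eq_of_notMem_plus (L := L) (r := r) (a := 0) (b := a) (Nat.zero_le a)
      fun c _ => h c
    have h7 := vNum_of_plus ha
    simp only [IsLower, outNum, arrNum, loNum, hiNum, endNum]
    refine ⟨by simp, trivial, h6, trivial, h6, by omega, by omega, by simp, by omega⟩
  | @north a c ha h =>
    obtain ⟨h1, h2, h3, h4⟩ := num_bounds ha
    have h6 := hNum_eq_of_notMem_plus (L := L) (c := c) (a := 0) (b := a) (Nat.zero_le a)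
      fun c _ => h c
    have h7 := hNum_of_plus ha
    simp only [IsLower, outNum, arrNum, loNum, hiNum, endNum]
    refine ⟨by simp, trivial, h6, h6, trivial, by omega, by omega, by omega, by simp⟩

theorem Joined.nums {d e : LeDart k m} (h : L.Joined d e) :
    (IsLower d ↔ ¬ IsLower e) ∧ L.outNum d = L.arrNum e ∧ L.arrNum d = L.outNum e ∧
      L.loNum d = L.loNum e ∧ L.hiNum d = L.hiNum e ∧ L.loNum d < L.hiNum d ∧
      L.hiNum d < k + m ∧ (IsLower d → L.endNum d < L.endNum e) := by
  rcases h with h | h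
  · obtain ⟨h1, h2, h3, h4, h5, h6, h7, h8, h9⟩ := h.nums
    exact ⟨h1, h2, h3, h4, h5, h6, h7, h8⟩
  · obtain ⟨h1, h2, h3, h4, h5, h6, h7, h8, h9⟩ := h.nums
    exact ⟨by tauto, h3.symm, h2.symm, h4.symm, h5.symm, by omega, by omega, h9⟩

theorem Joined.unique {d e e' : LeDart k m} (h : L.Joined d e) (h' : L.Joined d e') : e = e' := by
  have aux : ∀ {P : ℕ → Prop} {b b' a : ℕ}, P b → P b' → a < b → a < b' →
      (∀ c, a < c → c < b → ¬ P c) → (∀ c, a < c → c < b' → ¬ P c) → b = b' := by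
    intro P b b' a h1 h2 h3 h4 h5 h6
    rcases lt_trichotomy b b' with h | h | h
    · exact absurd h1 (h6 b h3 h)
    · exact h
    · exact absurd h2 (h5 b' h4 h)
  have aux' : ∀ {P : ℕ → Prop} {b b' a : ℕ}, P b → P b' → b < a → b' < a →
      (∀ c, b < c → c < a → ¬ P c) → (∀ c, b' < c → c < a → ¬ P c) → b = b' := by
    intro P b b' a h1 h2 h3 h4 h5 h6
    rcases lt_trichotomy b b' with h | h | h
    · exact absurd h2 (h5 b' h h4)
    · exact h
    · exact absurd h1 (h6 b h h3)
  have aux0 : ∀ {P : ℕ → Prop} {b b' : ℕ}, P b → P b' →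
      (∀ c, c < b → ¬ P c) → (∀ c, c < b' → ¬ P c) → b = b' := by
    intro P b b' h1 h2 h5 h6
    rcases lt_trichotomy b b' with h | h | h
    · exact absurd h1 (h6 b h)
    · exact h
    · exact absurd h2 (h5 b' h)
  rcases h with h | h
  · cases h with
    | diag h => rcases h' with h' | h' <;> cases h'; rfl
    | @row r a b h1 h2 h3 h4 =>
      rcases h' with h' | h'
      · cases h' with
        | row h5 h6 h7 h8 => rw [aux (P := fun c => (r, c) ∈ L.plus) h2 h6 h3 h7 h4 h8]
      · cases h'
    | @col a b c h1 h2 h3 h4 =>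
      rcases h' with h' | h'
      · cases h' with
        | col h5 h6 h7 h8 => rw [aux (P := fun r => (r, c) ∈ L.plus) h2 h6 h3 h7 h4 h8]
      · cases h'
    | @west r a h1 h2 =>
      rcases h' with h' | h'
      · cases h' with
        | west h3 h4 => rw [aux0 (P := fun c => ((r : ℕ), c) ∈ L.plus) h1 h3 h2 h4]
      · cases h'
    | @north a c h1 h2 =>
      rcases h' with h' | h'
      · cases h' with
        | north h3 h4 => rw [aux0 (P := fun r => (r, (c : ℕ)) ∈ L.plus) h1 h3 h2 h4]
      · cases h'
  · cases h with
    | diag h => rcases h' with h' | h' <;> cases h'; rfl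
    | @row r a b h1 h2 h3 h4 =>
      rcases h' with h' | h'
      · cases h'
      · cases h' with
        | row h5 h6 h7 h8 => rw [aux' (P := fun c => (r, c) ∈ L.plus) h1 h5 h3 h7 h4 h8]
        | west h5 h6 => exact absurd h1 (h6 _ h3)
    | @col a b c h1 h2 h3 h4 =>
      rcases h' with h' | h'
      · cases h'
      · cases h' with
        | col h5 h6 h7 h8 => rw [aux' (P := fun r => (r, c) ∈ L.plus) h1 h5 h3 h7 h4 h8]
        | north h5 h6 => exact absurd h1 (h6 _ h3)
    | @west r a h1 h2 =>
      generalize hr' : (r : ℕ) = r' at h'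
      rcases h' with h' | h'
      · cases h'
      · cases h' with
        | row h5 h6 h7 h8 => exact absurd (hr' ▸ h5) (h2 _ h7)
        | @west r'' _ h5 h6 => rw [Fin.ext hr']
    | @north a c h1 h2 =>
      generalize hc' : (c : ℕ) = c' at h'
      rcases h' with h' | h'
      · cases h'
      · cases h' with
        | col h5 h6 h7 h8 => exact absurd (hc' ▸ h5) (h2 _ h7)
        | @north _ c'' h5 h6 => rw [Fin.ext hc']

end Darts

end LeDiagram

-- Parallel pairs modulo upper sets correspond to edges of the pipe graph

namespace LeDiagram

section Classification

variable {k m : ℕ} {L : LeDiagram k m} {E : Type*} [AddCommGroup E] [Module ℝ E]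
  {v : Fin (k + m) → E}

theorem exists_vNum_eq {r a : ℕ} (h : L.vNum r a ≠ L.rowNum r) (hr : r < k) :
    ∃ b, a ≤ b ∧ (r, b) ∈ L.plus ∧ (∀ c, a ≤ c → c < b → (r, c) ∉ L.plus) ∧
      L.vNum r a = L.vNum r b := by
  obtain ⟨b, hb, hp⟩ : ∃ b, a ≤ b ∧ (r, b) ∈ L.plus := by
    by_contra! hcon
    exact h (vNum_eq_rowNum hr hcon)
  obtain ⟨b, h1, h2, h3⟩ := Nat.exists_next (P := fun c => (r, c) ∈ L.plus) hb hp
  exact ⟨b, h1, h2, h3, vNum_eq_of_notMem_plus h1 h3⟩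

theorem exists_hNum_eq {a c : ℕ} (h : L.hNum a c ≠ L.colNum c) (hc : c < m) :
    ∃ b, a ≤ b ∧ (b, c) ∈ L.plus ∧ (∀ r, a ≤ r → r < b → (r, c) ∉ L.plus) ∧
      L.hNum a c = L.hNum b c := by
  obtain ⟨b, hb, hp⟩ : ∃ b, a ≤ b ∧ (b, c) ∈ L.plus := by
    by_contra! hcon
    exact h (hNum_eq_colNum hc hcon)
  obtain ⟨b, h1, h2, h3⟩ := Nat.exists_next (P := fun r => (r, c) ∈ L.plus) hb hp
  exact ⟨b, h1, h2, h3, hNum_eq_of_notMem_plus h1 h3⟩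

/-- The last elbow on this pipe lies in a column with label `< σ`, which bounds the label of the
pipe. This is needed in `parallelMod_horizontal_iff` for `σ = j + 1`, where `IsLeftLabel` gives no
upper bound. -/
theorem vNum_colCount_lt {r : Fin k} {σ : ℕ} (h : L.rowNum r < σ) :
    L.vNum r (L.colCount σ) < σ := by
  by_cases hcase : L.vNum r (L.colCount σ) = L.rowNum r
  · rwa [hcase]
  · obtain ⟨b, hb, hp, -, heq⟩ := exists_vNum_eq hcase r.2
    rw [heq, vNum_of_plus hp]
    refine (num_bounds hp).2.2.1.trans_lt ?_
    by_contra hle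
    exact hb.not_gt ((L.lt_colCount_iff σ ⟨b, plus_col_lt hp⟩).2 (not_lt.1 hle))

namespace IsRealizedBy

/-- This lemma and the next two treat the third root below, above and between the other two. The
upper set is `[0, σ) ∪ (i, j)`, `[0, i) ∪ (j, σ)` and `[0, i) ∪ [σ, j)`, respectively. Parallelism
says that a threshold jumps exactly at `i`, exactly at `j`, or that `σ` lies between the thresholds
at the top and the bottom of a box. -/
theorem parallelMod_vertical_iff (hv : L.IsRealizedBy v) (c : Fin m) {i : Fin (k + m)} {σ : ℕ}
    (hσ : σ ≤ i) (hi : i < L.colLabel c) :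
    ParallelMod v (upperSet i (L.colLabel c) σ) i (L.colLabel c) ↔
      L.hNum (L.rowCount σ) c = i := by
  have h := hv.isTopLabel σ c (hσ.trans (Fin.lt_def.1 hi).le)
  have hU : upperSet i (L.colLabel c) σ = prefixUnion σ (i + 1) (L.colLabel c) := by
    ext l
    change ((l < i ∧ l.val < σ) ∨ (i < l ∧ l < L.colLabel c ∧ σ ≤ l.val) ∨
      (L.colLabel c < l ∧ l.val < σ)) ↔ _
    simp only [mem_prefixUnion, Fin.lt_def] at hi ⊢
    omega
  rw [ParallelMod, hU, insert_prefixUnion_middle (Fin.lt_def.1 hi), h _ (Fin.lt_def.1 hi),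
    h _ (Fin.lt_def.1 hi).le, hNum_coe]
  omega

theorem parallelMod_horizontal_iff (hv : L.IsRealizedBy v) (r : Fin k) {j : Fin (k + m)} {σ : ℕ}
    (hσ : j.val < σ) (hσ' : σ ≤ k + m) (hj : L.rowLabel r < j) :
    ParallelMod v (upperSet (L.rowLabel r) j σ) (L.rowLabel r) j ↔
      L.vNum r (L.colCount σ) = j := by
  have h := hv.isLeftLabel r σ hσ' ((Fin.lt_def.1 hj).trans hσ)
  have hlt := vNum_colCount_lt (L := L) (r := r) ((Fin.lt_def.1 hj).trans hσ)
  rw [vNum_coe] at hlt ⊢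
  have hU : upperSet (L.rowLabel r) j σ = prefixUnion (L.rowLabel r) (j + 1) σ := by
    ext l
    change ((l < L.rowLabel r ∧ l.val < σ) ∨ (L.rowLabel r < l ∧ l < j ∧ σ ≤ l.val) ∨
      (j < l ∧ l.val < σ)) ↔ _
    simp only [mem_prefixUnion, Fin.lt_def] at hj ⊢
    omega
  have h' : v (L.rowLabel r) ∈ Submodule.span ℝ (v '' prefixUnion (L.rowLabel r) (j + 1) σ) ↔
      (j : ℕ) + 1 ≤ L.vLabel r (L.colCount σ) := by
    rcases (Nat.succ_le_iff.2 hσ).lt_or_eq with h1 | h1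
    · exact h _ h1
    · refine iff_of_false (fun hmem => hv.row r ?_) (by omega)
      convert hmem using 4
      ext l
      rw [mem_prefixUnion]
      change l < _ ↔ _
      rw [Fin.lt_def]
      omega
  have hsymm : ParallelMod v (upperSet (L.rowLabel r) j σ) (L.rowLabel r) j ↔
      ParallelMod v (upperSet (L.rowLabel r) j σ) j (L.rowLabel r) :=
    ⟨ParallelMod.symm, ParallelMod.symm⟩
  rw [hsymm, ParallelMod, hU, insert_prefixUnion_middle hσ, h', h _ hσ]
  omega

theorem parallelMod_diagonal_iff (hv : L.IsRealizedBy v) (r : Fin k) (c : Fin m) {σ : ℕ}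
    (hσ : L.rowLabel r < σ) (hσ' : σ ≤ L.colLabel c) :
    ParallelMod v (upperSet (L.rowLabel r) (L.colLabel c) σ) (L.rowLabel r) (L.colLabel c) ↔
      L.hNum r c < σ ∧ σ ≤ L.hNum (r + 1) c := by
  have h1 := hv.isTopLabel (L.rowLabel r) c (by omega)
  have h2 := hv.isTopLabel (L.rowLabel r + 1) c (by omega)
  rw [rowCount_rowLabel] at h1
  rw [rowCount_rowLabel_succ] at h2
  have hU : upperSet (L.rowLabel r) (L.colLabel c) σ =
      prefixUnion (L.rowLabel r) σ (L.colLabel c) := by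
    ext l
    change ((l < L.rowLabel r ∧ l.val < σ) ∨ (L.rowLabel r < l ∧ l < L.colLabel c ∧ σ ≤ l.val) ∨
      (L.colLabel c < l ∧ l.val < σ)) ↔ _
    simp only [mem_prefixUnion, Fin.lt_def]
    omega
  rw [ParallelMod, hU, insert_prefixUnion_left, h1 _ hσ', h2 _ hσ', hNum_coe, hNum_coe, not_le]

/-- The line-solitons are carried by the edges of the pipe graph. -/
theorem parallelMod_of_joined (hv : L.IsRealizedBy v) {d e : LeDart k m} (h : L.Joined d e)
    (hd : IsLower d) {i j : Fin (k + m)} (hi : L.loNum d = i) (hj : L.hiNum d = j) {σ : ℕ}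
    (hσ : L.endNum d ≤ σ) (hσ' : σ < L.endNum e) : ParallelMod v (upperSet i j σ) i j := by
  have hij : i < j := by
    have := h.nums.2.2.2.2.2.1
    rw [hi, hj] at this
    exact this
  have vertical : ∀ {a : ℕ} {c : Fin m}, (a, (c : ℕ)) ∈ L.plus → L.hNum a c = i →
      L.colNum c = j → σ ≤ L.rowNum a →
      (∀ r, L.rowCount σ ≤ r → r < a → (r, (c : ℕ)) ∉ L.plus) →
      ParallelMod v (upperSet i j σ) i j := by
    intro a c hp h1 h2 h3 h4
    obtain ⟨b1, b2, b3, b4⟩ := num_bounds hp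
    rw [← hNum_of_plus hp] at b1
    obtain rfl : L.colLabel c = j := Fin.ext h2
    refine (hv.parallelMod_vertical_iff c (by omega) hij).2 ?_
    rw [← h1]
    refine hNum_eq_of_notMem_plus ?_ h4
    by_contra hlt
    have := (L.lt_rowCount_iff σ ⟨a, plus_row_lt hp⟩).1 (not_le.1 hlt)
    rw [← rowNum_coe] at this
    exact absurd this (not_lt.2 h3)
  have horizontal : ∀ {r : Fin k} {b : ℕ}, ((r : ℕ), b) ∈ L.plus → L.vNum r b = j →
      L.rowNum r = i → L.colNum b < σ → σ ≤ k + m →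
      (∀ c, L.colCount σ ≤ c → c < b → ((r : ℕ), c) ∉ L.plus) →
      ParallelMod v (upperSet i j σ) i j := by
    intro r b hp h1 h2 h3 h4 h5
    obtain ⟨b1, b2, b3, b4⟩ := num_bounds hp
    rw [← vNum_of_plus hp] at b3
    obtain rfl : L.rowLabel r = i := Fin.ext h2
    refine (hv.parallelMod_horizontal_iff r (by omega) h4 hij).2 ?_
    rw [← h1]
    refine vNum_eq_of_notMem_plus ?_ h5
    by_contra hlt
    have := (L.lt_colCount_iff σ ⟨b, plus_col_lt hp⟩).1 (not_le.1 hlt)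
    rw [← colNum_coe] at this
    exact absurd this (not_le.2 h3)
  rcases h with h | h
  · cases h with
    | @diag X h =>
      obtain ⟨r, c⟩ := X
      obtain ⟨r, c, rfl, rfl⟩ := exists_fin_of_plus h
      obtain ⟨b1, b2, b3, b4⟩ := num_bounds h
      obtain rfl : L.rowLabel r = i := Fin.ext hi
      obtain rfl : L.colLabel c = j := Fin.ext hj
      simp only [endNum] at hσ hσ'
      rw [hNum_of_plus h, ← rowNum_coe] at *
      rw [vNum_of_plus h] at hσ'
      refine (hv.parallelMod_diagonal_iff r c ?_ ?_).2 ⟨?_, ?_⟩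
      · rw [← rowNum_coe]; omega
      · rw [← colNum_coe]; omega
      · rw [hNum_of_plus h]; omega
      · omega
    | @row r a b h1 h2 h3 h4 => exact hd.elim
    | @col a b c h1 h2 h3 h4 =>
      have hc := plus_col_lt h1
      simp only [endNum] at hσ hσ'
      refine vertical (a := b) (c := ⟨c, hc⟩) h2 ?_ hj (by omega) fun r hr hrb => h4 r ?_ hrb
      · rw [← hi]
        exact (hNum_eq_of_notMem_plus h3 h4).symm
      · refine lt_of_lt_of_le ?_ hr
        exact (L.lt_rowCount_iff σ ⟨a, plus_row_lt h1⟩).2 hσ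
    | west h1 h2 => exact hd.elim
    | @north a c h1 h2 =>
      simp only [endNum] at hσ hσ'
      refine vertical (a := a) (c := c) h1 ?_ hj (by omega) fun r _ => h2 r
      rw [← hi]
      exact (hNum_eq_of_notMem_plus (Nat.zero_le a) fun r _ => h2 r).symm
  · cases h with
    | diag h => exact hd.elim
    | @row r a b h1 h2 h3 h4 =>
      have hr := plus_row_lt h1
      have hab := L.colNum_lt (plus_col_lt h1)
      simp only [endNum] at hσ hσ'
      refine horizontal (r := ⟨r, hr⟩) (b := b) h2 hj hi hσ (by omega) fun c hc hcb => h4 c ?_ hcb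
      refine lt_of_lt_of_le ?_ hc
      exact (L.lt_colCount_iff σ ⟨a, plus_col_lt h1⟩).2 (Nat.lt_succ_iff.1 hσ')
    | col h1 h2 h3 h4 => exact hd.elim
    | @west r a h1 h2 =>
      simp only [endNum] at hσ hσ'
      exact horizontal (r := r) (b := a) h1 hj hi hσ (by omega) fun c _ => h2 c
    | north h1 h2 => exact hd.elim

/-- For `σ ≤ j` the element `j` depends on smaller ones, so it labels a column. For `i < σ` every
element below `i` is in the modulus, so `i`, being independent of them, labels a row. The nearest
`+` boxes on both sides of the segment singled out by `σ` are then the ends of the edge. -/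
theorem exists_joined_of_parallelMod (hv : L.IsRealizedBy v) {i j : Fin (k + m)} (hij : i < j)
    {σ : ℕ} (hσ : σ ≤ k + m) (h : ParallelMod v (upperSet i j σ) i j) :
    ∃ d e, L.Joined d e ∧ IsLower d ∧ L.loNum d = i ∧ L.hiNum d = j ∧ L.endNum d ≤ σ ∧
      σ < L.endNum e := by
  have hcol : σ ≤ j → ∃ c, j = L.colLabel c := by
    intro hσj
    refine (L.eq_rowLabel_or_eq_colLabel j).resolve_left ?_
    rintro ⟨r, rfl⟩
    refine hv.row r (Submodule.span_mono (Set.image_mono ?_) h.2)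
    rintro l (rfl | ⟨h1, -⟩ | ⟨-, h1, -⟩ | ⟨h1, h2⟩)
    · exact hij
    · exact h1.trans hij
    · exact h1
    · rw [Fin.lt_def] at h1
      omega
  have hrow : i.val < σ → ∃ r, i = L.rowLabel r := by
    intro hσi
    refine (L.eq_rowLabel_or_eq_colLabel i).resolve_right ?_
    rintro ⟨c, rfl⟩
    refine h.symm.1 (Submodule.span_mono (Set.image_mono ?_) (hv.col c))
    intro l hl
    exact Or.inl ⟨hl, (Fin.lt_def.1 hl).trans hσi⟩
  rcases le_or_gt σ i with hσi | hσi
  · obtain ⟨c, rfl⟩ := hcol (hσi.trans (Fin.lt_def.1 hij).le)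
    have h1 := (hv.parallelMod_vertical_iff c hσi hij).1 h
    obtain ⟨b, hb, hp, hnp, heq⟩ := exists_hNum_eq (L := L) (a := L.rowCount σ) (c := c)
      (by rw [h1, colNum_coe]; exact (Fin.lt_def.1 hij).ne) c.2
    have hσb : σ < L.rowNum b + 1 := by
      by_contra hlt
      exact hb.not_gt ((L.lt_rowCount_iff σ ⟨b, plus_row_lt hp⟩).2 (not_lt.1 hlt))
    by_cases hprev : ∃ a, a < b ∧ (a, (c : ℕ)) ∈ L.plus
    · obtain ⟨a, hab, ha⟩ := hprev
      obtain ⟨a, hab, ha, hna⟩ := Nat.exists_prev (P := fun r => (r, (c : ℕ)) ∈ L.plus) hab ha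
      refine ⟨.blackBottom (a, c), .whiteTop (b, c), Or.inl (.col ha hp hab hna), trivial, ?_, rfl,
        ?_, hσb⟩
      · rw [← h1, heq]
        exact hNum_eq_of_notMem_plus hab hna
      · have : a < L.rowCount σ := by
          by_contra hle
          exact hnp a (not_lt.1 hle) hab ha
        exact (L.lt_rowCount_iff σ ⟨a, plus_row_lt ha⟩).1 this
    · push Not at hprev
      refine ⟨.north c, .whiteTop (b, c), Or.inl (.north hp hprev), trivial, ?_, rfl,
        Nat.zero_le _, hσb⟩
      rw [← h1, heq]
      exact hNum_eq_of_notMem_plus (Nat.zero_le b) fun r _ => hprev r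
  rcases lt_or_ge j.val σ with hσj | hσj
  · obtain ⟨r, rfl⟩ := hrow hσi
    have h1 := (hv.parallelMod_horizontal_iff r hσj hσ hij).1 h
    obtain ⟨b, hb, hp, hnp, heq⟩ := exists_vNum_eq (L := L) (r := r) (a := L.colCount σ)
      (by rw [h1, rowNum_coe]; exact (Fin.lt_def.1 hij).ne') r.2
    have hσb : L.colNum b + 1 ≤ σ := by
      by_contra hlt
      exact hb.not_gt ((L.lt_colCount_iff σ ⟨b, plus_col_lt hp⟩).2
        (Nat.lt_succ_iff.1 (not_le.1 hlt)))
    by_cases hprev : ∃ a, a < b ∧ ((r : ℕ), a) ∈ L.plus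
    · obtain ⟨a, hab, ha⟩ := hprev
      obtain ⟨a, hab, ha, hna⟩ := Nat.exists_prev (P := fun c => ((r : ℕ), c) ∈ L.plus) hab ha
      refine ⟨.blackLeft (r, b), .whiteRight (r, a), Or.inr (.row ha hp hab hna), trivial, rfl, ?_,
        hσb, ?_⟩
      · rw [← h1, heq]
        rfl
      · have : a < L.colCount σ := by
          by_contra hle
          exact hnp a (not_lt.1 hle) hab ha
        exact Nat.lt_succ_iff.2 ((L.lt_colCount_iff σ ⟨a, plus_col_lt ha⟩).1 this)
    · push Not at hprev
      refine ⟨.blackLeft (r, b), .west r, Or.inr (.west hp hprev), trivial, rfl, ?_, hσb,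
        Nat.lt_succ_iff.2 hσ⟩
      rw [← h1, heq]
      rfl
  · obtain ⟨r, rfl⟩ := hrow hσi
    obtain ⟨c, rfl⟩ := hcol hσj
    have h1 := (hv.parallelMod_diagonal_iff r c hσi hσj).1 h
    -- In a box without `+` the labels above and below agree, which leaves no room for `σ`.
    have hp : ((r : ℕ), (c : ℕ)) ∈ L.plus := by
      by_contra hp
      have : L.hNum r c = L.hNum (r + 1) c :=
        hNum_eq_of_notMem_plus (Nat.le_succ r) fun r' h1 h2 => by
          obtain rfl : r' = r := by omega
          exact hp
      omega
    refine ⟨.whiteDiag (r, c), .blackDiag (r, c), Or.inl (.diag hp), trivial, rfl, rfl, h1.1, ?_⟩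
    simp only [endNum, vNum_of_plus hp]
    omega

end IsRealizedBy

/-- The edges of the pipe graph on one line do not overlap. -/
theorem joined_unique_of_overlap {d e d' e' : LeDart k m} (h : L.Joined d e) (h' : L.Joined d' e')
    (hd : IsLower d) (hd' : IsLower d') (hlo : L.loNum d = L.loNum d')
    (hhi : L.hiNum d = L.hiNum d') {σ : ℕ} (hσ : L.endNum d ≤ σ) (hσe : σ < L.endNum e)
    (hσ' : L.endNum d' ≤ σ) (hσe' : σ < L.endNum e') : d = d' ∧ e = e' := by
  -- the three kinds of edges
  have kinds : ∀ {d e : LeDart k m}, L.Joined d e → IsLower d → L.endNum d ≤ σ →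
      σ < L.endNum e →
      (∃ b c, e = .whiteTop (b, c) ∧ (b, c) ∈ L.plus ∧ L.hiNum d = L.colNum c ∧ σ ≤ L.loNum d ∧
        σ ≤ L.rowNum b ∧ ∀ a, a < b → (a, c) ∈ L.plus → L.rowNum a < σ) ∨
      (∃ r b, d = .blackLeft (r, b) ∧ (r, b) ∈ L.plus ∧ L.loNum d = L.rowNum r ∧
        L.hiNum d < σ ∧ L.colNum b < σ ∧ ∀ a, a < b → (r, a) ∈ L.plus → σ ≤ L.colNum a) ∨
      (∃ r c, d = .whiteDiag (r, c) ∧ (r, c) ∈ L.plus ∧ L.loNum d = L.rowNum r ∧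
        L.hiNum d = L.colNum c ∧ L.loNum d < σ ∧ σ ≤ L.hiNum d) := by
    intro d e h hd hσ hσe
    rcases h with h | h
    · cases h with
      | @diag X h =>
        obtain ⟨r, c⟩ := X
        obtain ⟨b1, b2, b3, b4⟩ := num_bounds h
        simp only [endNum, hNum_of_plus h, vNum_of_plus h] at hσ hσe
        exact Or.inr (Or.inr ⟨r, c, rfl, h, rfl, rfl, by simp only [loNum]; omega,
          by simp only [hiNum]; omega⟩)
      | row h1 h2 h3 h4 => exact hd.elim
      | @col a b c h1 h2 h3 h4 =>
        obtain ⟨b1, b2, b3, b4⟩ := num_bounds h2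
        simp only [endNum] at hσ hσe
        refine Or.inl ⟨b, c, rfl, h2, rfl, ?_, by omega, fun a' ha' hp => ?_⟩
        · rw [show L.loNum (.blackBottom (a, c)) = _ from hNum_eq_of_notMem_plus h3 h4,
            hNum_of_plus h2]
          omega
        · have : a' ≤ a := by
            by_contra hlt
            exact h4 a' (not_le.1 hlt) ha' hp
          have := L.rowNum_strictMono.monotone this
          omega
      | west h1 h2 => exact hd.elim
      | @north a c h1 h2 =>
        obtain ⟨b1, b2, b3, b4⟩ := num_bounds h1
        simp only [endNum] at hσ hσe
        refine Or.inl ⟨a, c, rfl, h1, rfl, ?_, by omega, fun a' ha' hp => absurd hp (h2 a' ha')⟩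
        rw [show L.loNum (.north c) = _ from
          hNum_eq_of_notMem_plus (Nat.zero_le a) fun r _ => h2 r, hNum_of_plus h1]
        omega
    · cases h with
      | diag h => exact hd.elim
      | @row r a b h1 h2 h3 h4 =>
        obtain ⟨b1, b2, b3, b4⟩ := num_bounds h2
        simp only [endNum] at hσ hσe
        refine Or.inr (Or.inl ⟨r, b, rfl, h2, rfl, ?_, by omega, fun a' ha' hp => ?_⟩)
        · simp only [hiNum, vNum_of_plus h2]
          omega
        · have : a' ≤ a := by
            by_contra hlt
            exact h4 a' (not_le.1 hlt) ha' hp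
          rcases this.eq_or_lt with rfl | h
          · omega
          · have := L.colNum_lt_colNum h (plus_col_lt h1)
            omega
      | col h1 h2 h3 h4 => exact hd.elim
      | @west r a h1 h2 =>
        obtain ⟨b1, b2, b3, b4⟩ := num_bounds h1
        simp only [endNum] at hσ hσe
        refine Or.inr (Or.inl ⟨r, a, rfl, h1, rfl, ?_, by omega,
          fun a' ha' hp => absurd hp (h2 a' ha')⟩)
        simp only [hiNum, vNum_of_plus h1]
        omega
      | north h1 h2 => exact hd.elim
  have hlt := h.nums.2.2.2.2.2.1
  have col_inj : ∀ {c c' : ℕ}, c < m → c' < m → L.colNum c = L.colNum c' → c = c' := by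
    intro c c' hc hc' h
    rcases lt_trichotomy c c' with hlt | rfl | hlt
    · have := L.colNum_lt_colNum hlt hc'
      omega
    · rfl
    · have := L.colNum_lt_colNum hlt hc
      omega
  rcases kinds h hd hσ hσe with ⟨b, c, rfl, hp, k1, k2, k3, k4⟩ | ⟨r, b, rfl, hp, k1, k2, k3, k4⟩ |
      ⟨r, c, rfl, hp, k1, k2, k3, k4⟩ <;>
    rcases kinds h' hd' hσ' hσe' with ⟨b', c', rfl, hp', l1, l2, l3, l4⟩ |
      ⟨r', b', rfl, hp', l1, l2, l3, l4⟩ | ⟨r', c', rfl, hp', l1, l2, l3, l4⟩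
  · obtain rfl := col_inj (plus_col_lt hp) (plus_col_lt hp') (by omega)
    obtain rfl : b = b' := by
      rcases lt_trichotomy b b' with h | h | h
      · have := l4 b h hp
        omega
      · exact h
      · have := k4 b' h hp'
        omega
    exact ⟨h.symm.unique h'.symm, rfl⟩
  · omega
  · omega
  · omega
  · obtain rfl := L.rowNum_strictMono.injective (k1.symm.trans (hlo.trans l1))
    obtain rfl : b = b' := by
      rcases lt_trichotomy b b' with h | h | h
      · have := l4 b h hp
        omega
      · exact h
      · have := k4 b' h hp'
        omega
    exact ⟨rfl, h.unique h'⟩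
  · omega
  · omega
  · omega
  · obtain rfl := L.rowNum_strictMono.injective (k1.symm.trans (hlo.trans l1))
    obtain rfl := col_inj (plus_col_lt hp) (plus_col_lt hp') (by omega)
    exact ⟨rfl, h.unique h'⟩

end Classification

end LeDiagram

/-! ### Chains through vertices of degree two -/

namespace PlabicGraph

variable {n : ℕ} {G : PlabicGraph n}

/-- `e` and `f` are the two darts at a vertex of degree two. -/
def Pass (G : PlabicGraph n) (e f : G.Dart) : Prop :=
  ∃ v, G.base e = .inl v ∧ G.base f = .inl v ∧ G.IsDegreeTwo v ∧ e ≠ f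

theorem Pass.symm {e f : G.Dart} (h : G.Pass e f) : G.Pass f e := by
  obtain ⟨v, h1, h2, h3, h4⟩ := h
  exact ⟨v, h2, h1, h3, h4.symm⟩

theorem Pass.chain {d e f g : G.Dart} (h : G.Pass e f) (hd : G.Chain d e) (hg : G.Joined f g) :
    G.Chain d g := by
  obtain ⟨v, h1, h2, h3, h4⟩ := h
  exact hd.pass h1 h2 h3 h4 hg

theorem Pass.not_essential {e f : G.Dart} (h : G.Pass e f) : ¬ G.Essential f := by
  obtain ⟨v, h1, h2, h3, h4⟩ := h
  exact fun hf => hf.2 v h2 h3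

theorem Pass.unique {e e' f : G.Dart} (h : G.Pass e f) (h' : G.Pass e' f) (he : G.Present e)
    (he' : G.Present e') (hf : G.Present f) : e = e' := by
  obtain ⟨v, h1, h2, h3, h4⟩ := h
  obtain ⟨v', h1', h2', h3', h4'⟩ := h'
  obtain rfl : v = v' := Sum.inl_injective (h2.symm.trans h2')
  obtain ⟨x, y, hxy, hS⟩ := Set.ncard_eq_two.1 h3
  have me : e ∈ ({x, y} : Set G.Dart) := hS ▸ ⟨h1, he⟩
  have me' : e' ∈ ({x, y} : Set G.Dart) := hS ▸ ⟨h1', he'⟩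
  have mf : f ∈ ({x, y} : Set G.Dart) := hS ▸ ⟨h2, hf⟩
  simp only [Set.mem_insert_iff, Set.mem_singleton_iff] at me me' mf
  rcases me with rfl | rfl <;> rcases me' with rfl | rfl <;> rcases mf with rfl | rfl <;> simp_all

theorem Chain.trans {a b c d : G.Dart} (hab : G.Chain a b) (hbc : G.Pass b c)
    (hcd : G.Chain c d) : G.Chain a d := by
  induction hcd with
  | edge h => exact hbc.chain hab h
  | pass _ h1 h2 h3 h4 h5 ih => exact ih.pass h1 h2 h3 h4 h5

theorem Chain.symm (hG : ∀ d e, G.Joined d e → G.Joined e d) {d e : G.Dart} (h : G.Chain d e) :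
    G.Chain e d := by
  induction h with
  | edge h => exact .edge (hG _ _ h)
  | pass _ h1 h2 h3 h4 h5 ih =>
    exact (Chain.edge (hG _ _ h5)).trans ⟨_, h2, h1, h3, h4.symm⟩ ih

theorem Chain.present_right (hG : ∀ d e, G.Joined d e → G.Joined e d) {d e : G.Dart}
    (h : G.Chain d e) : G.Present e := by
  cases h with
  | edge h => exact ⟨_, hG _ _ h⟩
  | pass _ _ _ _ _ h => exact ⟨_, hG _ _ h⟩

/-- The edge of `f` belongs to the chain that starts along `d`. -/
def Reach (G : PlabicGraph n) (d f : G.Dart) : Prop :=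
  d = f ∨ ∃ e, G.Chain d e ∧ G.Pass e f

theorem Reach.chain {d f g : G.Dart} (h : G.Reach d f) (hg : G.Joined f g) : G.Chain d g := by
  rcases h with rfl | ⟨e, h1, h2⟩
  · exact .edge hg
  · exact h2.chain h1 hg

theorem Reach.chain_of_reach (hG : ∀ d e, G.Joined d e → G.Joined e d) {d e f g : G.Dart}
    (hd : G.Reach d f) (he : G.Reach e g) (hg : G.Joined f g) : G.Chain d e := by
  have h1 := hd.chain hg
  rcases he with rfl | ⟨x, h2, h3⟩
  · exact h1
  · exact h1.trans h3.symm (h2.symm hG)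

theorem Chain.unique (hG : ∀ d e, G.Joined d e → G.Joined e d)
    (hu : ∀ d e e', G.Joined d e → G.Joined d e' → e = e') {d d' e : G.Dart}
    (h : G.Chain d e) (hd : G.Essential d) (hd' : G.Essential d') (h' : G.Chain d' e) : d = d' := by
  induction h with
  | edge h =>
    cases h' with
    | edge h' => exact hu _ _ _ (hG _ _ h) (hG _ _ h')
    | pass h1 h2 h3 h4 h5 h6 =>
      obtain rfl := hu _ _ _ (hG _ _ h) (hG _ _ h6)
      exact absurd h4 (hd.2 _ h3)
  | pass h1 h2 h3 h4 h5 h6 ih =>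
    cases h' with
    | edge h' =>
      obtain rfl := hu _ _ _ (hG _ _ h6) (hG _ _ h')
      exact absurd h4 (hd'.2 _ h3)
    | pass h1' h2' h3' h4' h5' h6' =>
      obtain rfl := hu _ _ _ (hG _ _ h6) (hG _ _ h6')
      obtain rfl := Pass.unique ⟨_, h2, h3, h4, h5⟩ ⟨_, h2', h3', h4', h5'⟩
        (h1.present_right hG) (h1'.present_right hG) ⟨_, h6⟩
      exact ih h1'

theorem Reach.unique (hG : ∀ d e, G.Joined d e → G.Joined e d)
    (hu : ∀ d e e', G.Joined d e → G.Joined d e' → e = e') {d d' f : G.Dart}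
    (hf : G.Present f) (h : G.Reach d f) (hd : G.Essential d) (hd' : G.Essential d')
    (h' : G.Reach d' f) : d = d' := by
  rcases h with rfl | ⟨e, h1, h2⟩
  · rcases h' with rfl | ⟨e', h1', h2'⟩
    · rfl
    · exact absurd hd h2'.not_essential
  · rcases h' with rfl | ⟨e', h1', h2'⟩
    · exact absurd hd' h2.not_essential
    · obtain rfl := h2.unique h2' (h1.present_right hG) (h1'.present_right hG) hf
      exact h1.unique hG hu hd hd' h1'

end PlabicGraph

/-! ### The pipe graph -/

namespace LeDiagram

section PipeGraph

variable {k m : ℕ} {L : LeDiagram k m}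

/-- A dart of the pipe graph is present. -/
abbrev IsPresent (L : LeDiagram k m) (d : LeDart k m) : Prop := L.pipeGraph.Present d

/-- A vertex of the pipe graph has degree two. -/
abbrev IsDegTwo (L : LeDiagram k m) (v : Bool × ℕ × ℕ) : Prop := L.pipeGraph.IsDegreeTwo v

/-- A dart of the pipe graph belongs to the graph `G_-(L)`. -/
abbrev IsEssential (L : LeDiagram k m) (d : LeDart k m) : Prop := L.pipeGraph.Essential d

theorem joined_symm (L : LeDiagram k m) (d e : L.pipeGraph.Dart) (h : L.pipeGraph.Joined d e) :
    L.pipeGraph.Joined e d := Or.symm h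

theorem joined_unique (L : LeDiagram k m) (d e e' : L.pipeGraph.Dart)
    (h : L.pipeGraph.Joined d e) (h' : L.pipeGraph.Joined d e') : e = e' :=
  Joined.unique h h'

/-- The darts that are present, in terms of the boxes with `+`. -/
def IsPlusDart (L : LeDiagram k m) : LeDart k m → Prop
  | .whiteTop X => X ∈ L.plus
  | .whiteRight X => X ∈ L.plus ∧ ∃ b, X.2 < b ∧ (X.1, b) ∈ L.plus
  | .whiteDiag X => X ∈ L.plus
  | .blackDiag X => X ∈ L.plus
  | .blackLeft X => X ∈ L.plus
  | .blackBottom X => X ∈ L.plus ∧ ∃ b, X.1 < b ∧ (b, X.2) ∈ L.plus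
  | .west r => ∃ a, ((r : ℕ), a) ∈ L.plus
  | .north c => ∃ a, (a, (c : ℕ)) ∈ L.plus

theorem isPresent_iff (d : LeDart k m) : L.IsPresent d ↔ L.IsPlusDart d := by
  constructor
  · rintro ⟨e, h | h⟩
    · cases h with
      | diag h => exact h
      | row h1 h2 h3 h4 => exact ⟨h1, _, h3, h2⟩
      | col h1 h2 h3 h4 => exact ⟨h1, _, h3, h2⟩
      | west h1 h2 => exact ⟨_, h1⟩
      | north h1 h2 => exact ⟨_, h1⟩
    · cases h with
      | diag h => exact h
      | row h1 h2 h3 h4 => exact h2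
      | col h1 h2 h3 h4 => exact h2
      | west h1 h2 => exact h1
      | north h1 h2 => exact h1
  · intro h
    cases d with
    | whiteTop X =>
      obtain ⟨r, c⟩ := X
      by_cases hprev : ∃ a, a < r ∧ (a, c) ∈ L.plus
      · obtain ⟨a, hab, ha⟩ := hprev
        obtain ⟨a, hab, ha, hna⟩ := Nat.exists_prev (P := fun r => (r, c) ∈ L.plus) hab ha
        exact ⟨_, Or.inr (.col ha h hab hna)⟩
      · push Not at hprev
        exact ⟨_, Or.inr (.north (c := ⟨c, plus_col_lt h⟩) h hprev)⟩
    | whiteRight X =>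
      obtain ⟨r, c⟩ := X
      obtain ⟨h1, b, hb, h2⟩ := h
      obtain ⟨b, hb, h2, h3⟩ := Nat.exists_next (P := fun c => (r, c) ∈ L.plus) hb h2
      exact ⟨_, Or.inl (.row h1 h2 hb h3)⟩
    | whiteDiag X => exact ⟨_, Or.inl (.diag h)⟩
    | blackDiag X => exact ⟨_, Or.inr (.diag h)⟩
    | blackLeft X =>
      obtain ⟨r, c⟩ := X
      by_cases hprev : ∃ a, a < c ∧ (r, a) ∈ L.plus
      · obtain ⟨a, hab, ha⟩ := hprev
        obtain ⟨a, hab, ha, hna⟩ := Nat.exists_prev (P := fun c => (r, c) ∈ L.plus) hab ha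
        exact ⟨_, Or.inr (.row ha h hab hna)⟩
      · push Not at hprev
        exact ⟨_, Or.inr (.west (r := ⟨r, plus_row_lt h⟩) h hprev)⟩
    | blackBottom X =>
      obtain ⟨r, c⟩ := X
      obtain ⟨h1, b, hb, h2⟩ := h
      obtain ⟨b, hb, h2, h3⟩ := Nat.exists_next (P := fun r => (r, c) ∈ L.plus) hb h2
      exact ⟨_, Or.inl (.col h1 h2 hb h3)⟩
    | west r =>
      obtain ⟨a, h⟩ := h
      obtain ⟨a, -, h1, h2⟩ := Nat.exists_next (P := fun c => ((r : ℕ), c) ∈ L.plus)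
        (Nat.zero_le a) h
      exact ⟨_, Or.inl (.west h1 fun c => h2 c (Nat.zero_le c))⟩
    | north c =>
      obtain ⟨a, h⟩ := h
      obtain ⟨a, -, h1, h2⟩ := Nat.exists_next (P := fun r => (r, (c : ℕ)) ∈ L.plus)
        (Nat.zero_le a) h
      exact ⟨_, Or.inl (.north h1 fun r => h2 r (Nat.zero_le r))⟩

theorem plus_of_isPresent {d : LeDart k m} (h : L.IsPresent d) {v : Bool × ℕ × ℕ}
    (hd : d.base = .inl v) : v.2 ∈ L.plus := by
  rw [isPresent_iff] at h
  cases d <;> cases hd <;> first | exact h | exact h.1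

theorem isDegTwo_iff (v : Bool × ℕ × ℕ) :
    L.IsDegTwo v ↔ {d : LeDart k m | d.base = .inl v ∧ L.IsPlusDart d}.ncard = 2 := by
  simp only [← isPresent_iff]
  exact Iff.rfl

theorem isDegTwo_white_iff {r c : ℕ} (h : (r, c) ∈ L.plus) :
    L.IsDegTwo (false, r, c) ↔ ∀ b, c < b → (r, b) ∉ L.plus := by
  have hS : {d : LeDart k m | d.base = .inl (false, r, c) ∧ L.IsPlusDart d} =
      {d : LeDart k m | d = .whiteTop (r, c) ∨ d = .whiteDiag (r, c) ∨
        (d = .whiteRight (r, c) ∧ ∃ b, c < b ∧ (r, b) ∈ L.plus)} := by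
    ext d
    change d.base = _ ∧ L.IsPlusDart d ↔
      (d = .whiteTop (r, c) ∨ d = .whiteDiag (r, c) ∨
        (d = .whiteRight (r, c) ∧ ∃ b, c < b ∧ (r, b) ∈ L.plus))
    cases d <;> simp +contextual [LeDart.base, IsPlusDart, h]
  rw [isDegTwo_iff, hS]
  constructor
  · intro hcard b hb hp
    have : {d : LeDart k m | d = .whiteTop (r, c) ∨ d = .whiteDiag (r, c) ∨
        (d = .whiteRight (r, c) ∧ ∃ b, c < b ∧ (r, b) ∈ L.plus)} =
        {.whiteTop (r, c), .whiteDiag (r, c), .whiteRight (r, c)} := by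
      ext d
      constructor
      · rintro (h | h | ⟨h, -⟩) <;> simp [h]
      · rintro (h | h | h)
        exacts [Or.inl h, Or.inr (Or.inl h), Or.inr (Or.inr ⟨h, b, hb, hp⟩)]
    rw [this, Set.ncard_eq_three.2 ⟨_, _, _, by simp, by simp, by simp, rfl⟩] at hcard
    omega
  · intro hnp
    refine Set.ncard_eq_two.2 ⟨.whiteTop (r, c), .whiteDiag (r, c), by simp, ?_⟩
    ext d
    constructor
    · rintro (h | h | ⟨-, b, hb, hp⟩)
      exacts [Or.inl h, Or.inr h, absurd hp (hnp b hb)]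
    · rintro (h | h)
      exacts [Or.inl h, Or.inr (Or.inl h)]

theorem isDegTwo_black_iff {r c : ℕ} (h : (r, c) ∈ L.plus) :
    L.IsDegTwo (true, r, c) ↔ ∀ b, r < b → (b, c) ∉ L.plus := by
  have hS : {d : LeDart k m | d.base = .inl (true, r, c) ∧ L.IsPlusDart d} =
      {d : LeDart k m | d = .blackLeft (r, c) ∨ d = .blackDiag (r, c) ∨
        (d = .blackBottom (r, c) ∧ ∃ b, r < b ∧ (b, c) ∈ L.plus)} := by
    ext d
    change d.base = _ ∧ L.IsPlusDart d ↔
      (d = .blackLeft (r, c) ∨ d = .blackDiag (r, c) ∨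
        (d = .blackBottom (r, c) ∧ ∃ b, r < b ∧ (b, c) ∈ L.plus))
    cases d <;> simp +contextual [LeDart.base, IsPlusDart, h]
  rw [isDegTwo_iff, hS]
  constructor
  · intro hcard b hb hp
    have : {d : LeDart k m | d = .blackLeft (r, c) ∨ d = .blackDiag (r, c) ∨
        (d = .blackBottom (r, c) ∧ ∃ b, r < b ∧ (b, c) ∈ L.plus)} =
        {.blackLeft (r, c), .blackDiag (r, c), .blackBottom (r, c)} := by
      ext d
      constructor
      · rintro (h | h | ⟨h, -⟩) <;> simp [h]
      · rintro (h | h | h)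
        exacts [Or.inl h, Or.inr (Or.inl h), Or.inr (Or.inr ⟨h, b, hb, hp⟩)]
    rw [this, Set.ncard_eq_three.2 ⟨_, _, _, by simp, by simp, by simp, rfl⟩] at hcard
    omega
  · intro hnp
    refine Set.ncard_eq_two.2 ⟨.blackLeft (r, c), .blackDiag (r, c), by simp, ?_⟩
    ext d
    constructor
    · rintro (h | h | ⟨-, b, hb, hp⟩)
      exacts [Or.inl h, Or.inr h, absurd hp (hnp b hb)]
    · rintro (h | h)
      exacts [Or.inl h, Or.inr (Or.inl h)]

/-- A vertex of degree two has lost its dart towards the erased end of a row (white) or column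
(black). The pipe on the erased piece still has the label of that row or column, so the other two
darts have the same pair of labels and the same third label. Forgetting the vertex therefore only
joins two collinear edges. -/
theorem pass_nums {e f : LeDart k m} (h : L.pipeGraph.Pass e f) (he : L.IsPresent e)
    (hf : L.IsPresent f) :
    (IsLower e ↔ ¬ IsLower f) ∧ L.arrNum e = L.outNum f ∧ L.outNum e = L.arrNum f ∧
      L.loNum e = L.loNum f ∧ L.hiNum e = L.hiNum f ∧ L.endNum e = L.endNum f := by
  obtain ⟨⟨b, r, c⟩, h1, h2, h3, h4⟩ := h
  have hp := plus_of_isPresent he h1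
  have hr := plus_row_lt hp
  have hc := plus_col_lt hp
  rw [isPresent_iff] at he hf
  simp only at hp
  cases b with
  | false =>
    have hno := (isDegTwo_white_iff hp).1 h3
    have h5 := hNum_of_plus hp
    have h6 := vNum_eq_rowNum (L := L) (c := c + 1) hr fun b hb => hno b hb
    cases e <;> cases h1 <;> cases f <;> cases h2 <;>
      first
      | exact absurd rfl h4
      | exact absurd he.2 (by simpa using hno)
      | exact absurd hf.2 (by simpa using hno)
      | simp [IsLower, arrNum, outNum, loNum, hiNum, endNum, h5, h6]
  | true =>
    have hno := (isDegTwo_black_iff hp).1 h3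
    have h5 := vNum_of_plus hp
    have h6 := hNum_eq_colNum (L := L) (r := r + 1) hc fun b hb => hno b hb
    cases e <;> cases h1 <;> cases f <;> cases h2 <;>
      first
      | exact absurd rfl h4
      | exact absurd he.2 (by simpa using hno)
      | exact absurd hf.2 (by simpa using hno)
      | simp [IsLower, arrNum, outNum, loNum, hiNum, endNum, h5, h6]

theorem chain_nums {d e : L.pipeGraph.Dart} (h : L.pipeGraph.Chain d e) :
    (IsLower d ↔ ¬ IsLower e) ∧ L.outNum d = L.arrNum e ∧ L.arrNum d = L.outNum e ∧
      L.loNum d = L.loNum e ∧ L.hiNum d = L.hiNum e ∧ L.loNum d < L.hiNum d ∧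
      L.hiNum d < k + m ∧ (IsLower d → L.endNum d < L.endNum e) := by
  induction h with
  | edge h => exact Joined.nums h
  | pass h1 h2 h3 h4 h5 h6 ih =>
    obtain ⟨a1, a2, a3, a4, a5, a6, a7, a8⟩ := ih
    obtain ⟨b1, b2, b3, b4, b5, b6⟩ := pass_nums ⟨_, h2, h3, h4, h5⟩
      (h1.present_right L.joined_symm) ⟨_, h6⟩
    obtain ⟨c1, c2, c3, c4, c5, c6, c7, c8⟩ := Joined.nums h6
    refine ⟨by tauto, by omega, by omega, by omega, by omega, a6, a7, fun hd => ?_⟩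
    have := c8 (by tauto)
    have := a8 hd
    omega

theorem reach_nums {d f : LeDart k m} (h : L.pipeGraph.Reach d f) (hf : L.IsPresent f) :
    (IsLower d ↔ IsLower f) ∧ L.outNum d = L.outNum f ∧ L.loNum d = L.loNum f ∧
      L.hiNum d = L.hiNum f ∧ (IsLower f → L.endNum d ≤ L.endNum f) ∧
      (¬ IsLower f → L.endNum f ≤ L.endNum d) := by
  rcases h with rfl | ⟨e, h1, h2⟩
  · simp
  · obtain ⟨a1, a2, a3, a4, a5, a6, a7, a8⟩ := chain_nums h1
    obtain ⟨b1, b2, b3, b4, b5, b6⟩ := pass_nums h2 (h1.present_right L.joined_symm) hf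
    obtain ⟨-, -, -, -, -, -, -, c8⟩ := chain_nums (h1.symm L.joined_symm)
    refine ⟨by tauto, by omega, by omega, by omega, fun h => ?_, fun h => ?_⟩
    · have := a8 (by tauto)
      omega
    · have := c8 (by tauto)
      omega

/-- A chain covers the part of its line between its two ends. -/
theorem chain_cover {d e : L.pipeGraph.Dart} (h : L.pipeGraph.Chain d e) {σ : ℕ}
    (hσ : L.endNum d ≤ σ) (hσ' : σ < L.endNum e) :
    ∃ f g, L.Joined f g ∧ L.endNum f ≤ σ ∧ σ < L.endNum g ∧ L.pipeGraph.Reach d f ∧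
      L.pipeGraph.Reach e g := by
  induction h with
  | edge h => exact ⟨_, _, h, hσ, hσ', Or.inl rfl, Or.inl rfl⟩
  | @pass e f g v h1 h2 h3 h4 h5 h6 ih =>
    have hpass : L.pipeGraph.Pass e f := ⟨_, h2, h3, h4, h5⟩
    obtain ⟨b1, b2, b3, b4, b5, b6⟩ := pass_nums hpass (h1.present_right L.joined_symm) ⟨_, h6⟩
    rcases lt_or_ge σ (L.endNum e) with hlt | hge
    · obtain ⟨f', g', a1, a2, a3, a4, a5⟩ := ih hlt
      refine ⟨f', g', a1, a2, a3, a4, ?_⟩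
      have hge := L.joined_symm _ _ h6
      rcases a5 with rfl | ⟨x, c1, c2⟩
      · exact Or.inr ⟨f, .edge hge, hpass.symm⟩
      · exact Or.inr ⟨x, (PlabicGraph.Chain.edge hge).trans hpass.symm c1, c2⟩
    · exact ⟨f, g, h6, b6 ▸ hge, hσ', Or.inr ⟨e, h1, hpass⟩, Or.inl rfl⟩

theorem isEssential_of_base {d e : LeDart k m} (he : L.IsEssential e) {v : Bool × ℕ × ℕ}
    (h : e.base = .inl v) (h' : d.base = .inl v) : L.IsEssential d := by
  have hp := plus_of_isPresent he.1 h
  have hv : ¬ L.IsDegTwo v := he.2 v h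
  refine ⟨(isPresent_iff d).2 ?_, fun w hw => ?_⟩
  · obtain ⟨b, r, c⟩ := v
    cases b with
    | false =>
      rw [isDegTwo_white_iff hp] at hv
      push Not at hv
      cases d <;> cases h' <;> first | exact hp | exact ⟨hp, hv⟩
    | true =>
      rw [isDegTwo_black_iff hp] at hv
      push Not at hv
      cases d <;> cases h' <;> first | exact hp | exact ⟨hp, hv⟩
  · obtain rfl : v = w := Sum.inl_injective (h'.symm.trans hw)
    exact hv

end PipeGraph

end LeDiagram

/-! ### Trips -/

/-- The dart along which a trip in the mirror image leaves when it has arrived along a dart. -/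
def LeDart.turn {k m : ℕ} : LeDart k m → LeDart k m
  | .whiteTop X => .whiteDiag X
  | .whiteDiag X => .whiteRight X
  | .whiteRight X => .whiteTop X
  | .blackDiag X => .blackBottom X
  | .blackBottom X => .blackLeft X
  | .blackLeft X => .blackDiag X
  | .west r => .west r
  | .north c => .north c

theorem LeDart.base_turn {k m : ℕ} (e : LeDart k m) : e.turn.base = e.base := by
  cases e <;> rfl

namespace LeDiagram

section Trips

variable {k m : ℕ} {D : LeDiagram k m} {π : Equiv.Perm (Fin (k + m))}

theorem arrNum_eq_outNum_turn {e : LeDart k m} (he : D.IsPresent e) {v : Bool × ℕ × ℕ}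
    (h : e.base = .inl v) : D.arrNum e = D.outNum e.turn := by
  have hp := plus_of_isPresent he h
  cases e <;> cases h <;>
    first
    | rfl
    | exact (hNum_of_plus hp).symm
    | exact (vNum_of_plus hp).symm

theorem onTrip_turn {i : Fin (k + m)} {d e : LeDart k m} {v : Bool × ℕ × ℕ}
    (h : (graphPlus π D).OnTrip i d) (hj : (graphPlus π D).Joined d e) (he : e.base = .inl v) :
    (graphPlus π D).OnTrip i e.turn := by
  cases e with
  | whiteTop X => exact .turnLeft h hj rfl (fun hb => Bool.false_ne_true hb)
  | whiteDiag X => exact .turnLeft h hj rfl (fun hb => Bool.false_ne_true hb)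
  | whiteRight X => exact .turnLeft h hj rfl (fun hb => Bool.false_ne_true hb)
  | blackDiag X => exact .turnRight h hj rfl (show true = true from rfl)
  | blackBottom X => exact .turnRight h hj rfl (show true = true from rfl)
  | blackLeft X => exact .turnRight h hj rfl (show true = true from rfl)
  | west r => cases he
  | north c => cases he

/-- The relabelling by `j ↦ π (rev j)` makes the trip that starts at the west end of a row carry the
reversed label of that row. `label_north` is the analogue for columns. -/
theorem label_west (hD : D.HasPerm (dualPerm π)) (r : Fin k) :
    π (D.vLabel r 0).rev = (D.rowLabel r).rev := by
  rw [← hD.1]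
  simp [dualPerm]

theorem label_north (hD : D.HasPerm (dualPerm π)) (c : Fin m) :
    π (D.hLabel 0 c).rev = (D.colLabel c).rev := by
  rw [← hD.2]
  simp [dualPerm]

/-- A trip determines the label of every dart along which it leaves. -/
theorem rev_eq_outNum_of_onTrip (hD : D.HasPerm (dualPerm π)) {i : Fin (k + m)}
    {d : (graphPlus π D).Dart} (h : (graphPlus π D).OnTrip i d) :
    D.IsEssential d ∧ (i.rev : ℕ) = D.outNum d := by
  have next : ∀ {d e f : LeDart k m} {v : Bool × ℕ × ℕ},
      D.IsEssential d ∧ (i.rev : ℕ) = D.outNum d → (graphPlus π D).Joined d e →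
      e.base = .inl v → f = e.turn → D.IsEssential f ∧ (i.rev : ℕ) = D.outNum f := by
    rintro d e f v ⟨h1, h2⟩ ⟨h3, h4, h5⟩ hv rfl
    refine ⟨isEssential_of_base h4 hv (e.base_turn.trans hv), ?_⟩
    rw [h2, (chain_nums h5).2.1, arrNum_eq_outNum_turn h4.1 hv]
  induction h with
  | @start d b hb hl hp =>
    obtain ⟨e, he⟩ := hp
    refine ⟨he.1, ?_⟩
    subst hl
    cases d <;> cases hb
    · change ((π (D.vLabel _ 0).rev).rev : ℕ) = _
      rw [label_west hD, Fin.rev_rev]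
      rfl
    · change ((π (D.hLabel 0 _).rev).rev : ℕ) = _
      rw [label_north hD, Fin.rev_rev]
      rfl
  | @turnRight d e v h1 h2 h3 h4 ih =>
    refine next ih h2 h3 ?_
    have h4 : v.1 = true := h4
    cases e <;> cases h3 <;> first | rfl | exact absurd h4 Bool.false_ne_true
  | @turnLeft d e v h1 h2 h3 h4 ih =>
    refine next ih h2 h3 ?_
    have h4 : ¬ v.1 = true := h4
    cases e <;> cases h3 <;> first | rfl | exact absurd rfl h4

/-- Every dart of the pipe graph is obtained from the boundary by following trips, where one may
also turn the other way at a vertex of degree two. -/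
theorem present_induction {Q : LeDart k m → Prop}
    (west : ∀ r, D.IsPresent (.west r) → Q (.west r))
    (north : ∀ c, D.IsPresent (.north c) → Q (.north c))
    (next : ∀ d e f v, Q d → D.Joined d e → e.base = .inl v → f.base = .inl v → D.IsPresent f →
      e ≠ f → (D.IsDegTwo v ∨ f = e.turn) → Q f) {d : LeDart k m} (hd : D.IsPresent d) : Q d := by
  have hright : ∀ {r a b}, Q (.blackDiag (r, a)) → (r, a) ∈ D.plus → a < b → (r, b) ∈ D.plus →
      Q (.whiteRight (r, a)) := fun {r a b} hQ ha hab hb =>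
    next _ (.whiteDiag (r, a)) _ _ hQ (Or.inr (.diag ha)) rfl rfl
      ((isPresent_iff _).2 ⟨ha, b, hab, hb⟩) (by simp) (Or.inr rfl)
  have hbottom : ∀ {a b c}, Q (.whiteDiag (a, c)) → (a, c) ∈ D.plus → a < b → (b, c) ∈ D.plus →
      Q (.blackBottom (a, c)) := fun {a b c} hQ ha hab hb =>
    next _ (.blackDiag (a, c)) _ _ hQ (Or.inl (.diag ha)) rfl rfl
      ((isPresent_iff _).2 ⟨ha, b, hab, hb⟩) (by simp) (Or.inr rfl)
  -- A trip that starts in the west follows its row eastwards, through the left, diagonal and right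
  -- darts of each box.
  have hrow : ∀ c r, (r, c) ∈ D.plus → Q (.blackDiag (r, c)) := by
    intro c
    induction c using Nat.strong_induction_on with
    | _ c ih =>
      intro r h
      obtain ⟨e, he⟩ := (isPresent_iff (.blackLeft (r, c))).2 h
      have hpres : D.IsPresent (.blackDiag (r, c)) := (isPresent_iff _).2 h
      refine next e (.blackLeft (r, c)) _ _ ?_ (Or.symm he) rfl rfl hpres (by simp) (Or.inr rfl)
      have hpe : D.IsPresent e := ⟨_, Or.symm he⟩
      rcases he with he | he
      · cases he
      · cases he with
        | row h1 h2 h3 h4 => exact hright (ih _ h3 _ h1) h1 h3 h2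
        | west h1 h2 => exact west _ hpe
  -- Likewise a trip that starts in the north follows its column southwards.
  have hcol : ∀ r c, (r, c) ∈ D.plus → Q (.whiteDiag (r, c)) := by
    intro r
    induction r using Nat.strong_induction_on with
    | _ r ih =>
      intro c h
      obtain ⟨e, he⟩ := (isPresent_iff (.whiteTop (r, c))).2 h
      have hpres : D.IsPresent (.whiteDiag (r, c)) := (isPresent_iff _).2 h
      refine next e (.whiteTop (r, c)) _ _ ?_ (Or.symm he) rfl rfl hpres (by simp) (Or.inr rfl)
      have hpe : D.IsPresent e := ⟨_, Or.symm he⟩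
      rcases he with he | he
      · cases he
      · cases he with
        | col h1 h2 h3 h4 => exact hbottom (ih _ h3 _ h1) h1 h3 h2
        | north h1 h2 => exact north _ hpe
  -- The remaining darts are met by following the pipes to the northwest, by induction on the
  -- distance `s` from the southeast corner. Where the outer end of a pipe is erased, the dart is
  -- reached from the diagonal through a vertex of degree two.
  have hpipe : ∀ s r c, (r, c) ∈ D.plus → k + m ≤ r + c + s →
      Q (.whiteTop (r, c)) ∧ Q (.blackLeft (r, c)) := by
    intro s
    induction s with
    | zero =>
      intro r c h hs
      have := plus_row_lt h
      have := plus_col_lt h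
      omega
    | succ s ih =>
      intro r c h hs
      have htop : D.IsPresent (.whiteTop (r, c)) := (isPresent_iff _).2 h
      have hleft : D.IsPresent (.blackLeft (r, c)) := (isPresent_iff _).2 h
      constructor
      · by_cases hb : D.IsPresent (.whiteRight (r, c))
        · obtain ⟨e, he⟩ := hb
          refine next e (.whiteRight (r, c)) _ _ ?_ (Or.symm he) rfl rfl htop (by simp) (Or.inr rfl)
          rcases he with he | he
          · cases he with
            | row h1 h2 h3 h4 => exact (ih _ _ h2 (by omega)).2
          · cases he
        · refine next _ (.whiteDiag (r, c)) _ _ (hrow c r h) (Or.inr (.diag h)) rfl rfl htop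
            (by simp) (Or.inl ((isDegTwo_white_iff h).2 fun b hcb hb' => hb ?_))
          exact (isPresent_iff _).2 ⟨h, b, hcb, hb'⟩
      · by_cases hb : D.IsPresent (.blackBottom (r, c))
        · obtain ⟨e, he⟩ := hb
          refine next e (.blackBottom (r, c)) _ _ ?_ (Or.symm he) rfl rfl hleft (by simp)
            (Or.inr rfl)
          rcases he with he | he
          · cases he with
            | col h1 h2 h3 h4 => exact (ih _ _ h2 (by omega)).1
          · cases he
        · refine next _ (.blackDiag (r, c)) _ _ (hcol r c h) (Or.inl (.diag h)) rfl rfl hleft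
            (by simp) (Or.inl ((isDegTwo_black_iff h).2 fun b hcb hb' => hb ?_))
          exact (isPresent_iff _).2 ⟨h, b, hcb, hb'⟩
  have hplus := (isPresent_iff d).1 hd
  cases d with
  | whiteTop X => exact (hpipe (k + m) X.1 X.2 hplus (by omega)).1
  | whiteRight X =>
    obtain ⟨h, b, hb, hb'⟩ := hplus
    exact hright (hrow _ _ h) h hb hb'
  | whiteDiag X => exact hcol X.1 X.2 hplus
  | blackDiag X => exact hrow X.2 X.1 hplus
  | blackLeft X => exact (hpipe (k + m) X.1 X.2 hplus (by omega)).2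
  | blackBottom X =>
    obtain ⟨h, b, hb, hb'⟩ := hplus
    exact hbottom (hcol _ _ h) h hb hb'
  | west r => exact west r hd
  | north c => exact north c hd

theorem isEssential_west {r : Fin k} (h : D.IsPresent (.west r)) : D.IsEssential (.west r) :=
  ⟨h, fun _ hv => by cases hv⟩

theorem isEssential_north {c : Fin m} (h : D.IsPresent (.north c)) : D.IsEssential (.north c) :=
  ⟨h, fun _ hv => by cases hv⟩

theorem isEssential_of_not_isDegTwo {d : LeDart k m} (h : D.IsPresent d) {v : Bool × ℕ × ℕ}
    (hd : d.base = .inl v) (hv : ¬ D.IsDegTwo v) : D.IsEssential d := by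
  refine ⟨h, fun w hw => ?_⟩
  obtain rfl : v = w := Sum.inl_injective (hd.symm.trans hw)
  exact hv

theorem exists_reach {d : LeDart k m} (hd : D.IsPresent d) :
    ∃ d₀, D.IsEssential d₀ ∧ D.pipeGraph.Reach d₀ d := by
  refine present_induction (Q := fun d => ∃ d₀, D.IsEssential d₀ ∧ D.pipeGraph.Reach d₀ d)
    (fun r hr => ⟨_, isEssential_west hr, Or.inl rfl⟩)
    (fun c hc => ⟨_, isEssential_north hc, Or.inl rfl⟩) ?_ hd
  rintro d e f v ⟨d₀, h1, h2⟩ hde he hf hp hef -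
  by_cases hv : D.IsDegTwo v
  · exact ⟨d₀, h1, Or.inr ⟨e, h2.chain hde, v, he, hf, hv, hef⟩⟩
  · exact ⟨f, isEssential_of_not_isDegTwo hp hf hv, Or.inl rfl⟩

theorem graphPlus_present_iff {d : LeDart k m} :
    (graphPlus π D).Present d ↔ D.IsEssential d := by
  refine ⟨fun ⟨e, he⟩ => he.1, fun hd => ?_⟩
  obtain ⟨e, he⟩ := hd.1
  obtain ⟨e₀, h1, h2⟩ := exists_reach (D := D) (d := e) ⟨d, Or.symm he⟩
  exact ⟨e₀, hd, h1, (h2.chain (Or.symm he)).symm D.joined_symm⟩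

/-- At a vertex of degree two the chain that carries the trip is merely extended. At any other
vertex the trip turns and starts a new chain with the same invariant. -/
theorem exists_onTrip (hD : D.HasPerm (dualPerm π)) {d : LeDart k m} (hd : D.IsPresent d) :
    ∃ d₀, D.IsEssential d₀ ∧ D.pipeGraph.Reach d₀ d ∧
      ∀ i : Fin (k + m), (i.rev : ℕ) = D.outNum d → (graphPlus π D).OnTrip i d₀ := by
  refine present_induction (Q := fun d => ∃ d₀, D.IsEssential d₀ ∧ D.pipeGraph.Reach d₀ d ∧
    ∀ i : Fin (k + m), (i.rev : ℕ) = D.outNum d → (graphPlus π D).OnTrip i d₀)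
    (fun r hr => ⟨_, isEssential_west hr, Or.inl rfl, fun i hi => .start rfl ?_
      (graphPlus_present_iff.2 (isEssential_west hr))⟩)
    (fun c hc => ⟨_, isEssential_north hc, Or.inl rfl, fun i hi => .start rfl ?_
      (graphPlus_present_iff.2 (isEssential_north hc))⟩) ?_ hd
  · change π (D.vLabel r 0).rev = i
    rw [label_west hD, Fin.rev_eq_iff]
    exact Fin.ext hi.symm
  · change π (D.hLabel 0 c).rev = i
    rw [label_north hD, Fin.rev_eq_iff]
    exact Fin.ext hi.symm
  · rintro d e f v ⟨d₀, h1, h2, h3⟩ hde he hf hp hef hturn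
    have hchain : D.pipeGraph.Chain d₀ e := h2.chain hde
    have hpe : D.IsPresent e := ⟨d, hde.symm⟩
    have hnum := hde.nums.2.1
    by_cases hv : D.IsDegTwo v
    · have hpass : D.pipeGraph.Pass e f := ⟨v, he, hf, hv, hef⟩
      refine ⟨d₀, h1, Or.inr ⟨e, hchain, hpass⟩, fun i hi => h3 i ?_⟩
      rw [hi, hnum, (pass_nums hpass hpe hp).2.1]
    · obtain rfl := hturn.resolve_left hv
      refine ⟨e.turn, isEssential_of_not_isDegTwo hp hf hv, Or.inl rfl, fun i hi => ?_⟩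
      refine onTrip_turn (h3 i ?_) ⟨h1, isEssential_of_not_isDegTwo hpe he hv, hchain⟩ he
      rw [hi, hnum, arrNum_eq_outNum_turn hpe he]

theorem onTrip_iff (hD : D.HasPerm (dualPerm π)) {d : LeDart k m} (hd : D.IsEssential d)
    (i : Fin (k + m)) : (graphPlus π D).OnTrip i d ↔ (i.rev : ℕ) = D.outNum d := by
  refine ⟨fun h => (rev_eq_outNum_of_onTrip hD h).2, fun h => ?_⟩
  obtain ⟨d₀, h1, h2, h3⟩ := exists_onTrip hD hd.1
  obtain rfl := PlabicGraph.Reach.unique D.joined_symm D.joined_unique hd.1 h2 h1 hd (Or.inl rfl)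
  exact h3 i h

theorem lo_hi (d : LeDart k m) : (D.loNum d = D.outNum d ∧ D.hiNum d = D.arrNum d) ∨
    (D.loNum d = D.arrNum d ∧ D.hiNum d = D.outNum d) := by
  cases d <;> simp [loNum, hiNum, outNum, arrNum]

theorem edgeLabels_eq (hD : D.HasPerm (dualPerm π)) {d : LeDart k m} (hd : D.IsEssential d)
    {x y : Fin (k + m)} (hx : D.loNum d = x) (hy : D.hiNum d = y) :
    (graphPlus π D).edgeLabels d = {y.rev, x.rev} := by
  have key : ∀ i : Fin (k + m), ((graphPlus π D).OnTrip i d ∨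
      ∃ e, (graphPlus π D).Joined d e ∧ (graphPlus π D).OnTrip i e) ↔
      ((i.rev : ℕ) = D.outNum d ∨ (i.rev : ℕ) = D.arrNum d) := by
    intro i
    refine or_congr (onTrip_iff hD hd i) ⟨?_, fun h => ?_⟩
    · rintro ⟨e, he, h⟩
      rw [(chain_nums he.2.2).2.2.1]
      exact (rev_eq_outNum_of_onTrip hD h).2
    · obtain ⟨e, he⟩ := (graphPlus_present_iff (π := π)).2 hd
      refine ⟨e, he, (onTrip_iff hD he.2.1 i).2 ?_⟩
      rw [h, (chain_nums he.2.2).2.2.1]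
  ext i
  simp only [PlabicGraph.edgeLabels, Finset.mem_filter, Finset.mem_univ, true_and, key,
    Finset.mem_insert, Finset.mem_singleton]
  rw [← Fin.rev_eq_iff, ← Fin.rev_eq_iff, Fin.ext_iff, Fin.ext_iff, ← hx, ← hy]
  rcases lo_hi (D := D) d with ⟨h1, h2⟩ | ⟨h1, h2⟩
  · rw [h1, h2, or_comm]
  · rw [h1, h2]

theorem exists_lo_hi {d : LeDart k m} (hd : D.IsPresent d) :
    ∃ x y : Fin (k + m), x < y ∧ D.loNum d = x ∧ D.hiNum d = y := by
  obtain ⟨e, he⟩ := hd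
  obtain ⟨-, -, -, -, -, h1, h2, -⟩ := Joined.nums he
  exact ⟨⟨_, h1.trans h2⟩, ⟨_, h2⟩, h1, rfl, rfl⟩

/-- The trip that arrives at a boundary vertex has the reversed label of the pipe ending there, and
the vertex is labelled by `π` of it. Absence of fixed points puts a `+` in every row and column, so
each boundary vertex has an edge. -/
theorem graphPlus_hasTripPerm (hD : D.HasPerm (dualPerm π))
    (hrow : ∀ r, D.vLabel r 0 ≠ D.rowLabel r) (hcol : ∀ c, D.hLabel 0 c ≠ D.colLabel c) :
    (graphPlus π D).HasTripPerm π := by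
  intro i j
  constructor
  · rintro ⟨d, e, b, h1, h2, h3, rfl⟩
    have hout := (rev_eq_outNum_of_onTrip hD h1).2
    rw [(chain_nums h2.2.2).2.1] at hout
    cases e <;> cases h3
    · change π i = π (D.vLabel _ 0).rev
      rw [← Fin.rev_eq_iff.1 (Fin.ext (hout.trans (D.vNum_coe _ 0)))]
    · change π i = π (D.hLabel 0 _).rev
      rw [← Fin.rev_eq_iff.1 (Fin.ext (hout.trans (D.hNum_coe 0 _)))]
  · rintro rfl
    have arrive : ∀ {e : LeDart k m} {b : Fin k ⊕ Fin m}, D.IsEssential e →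
        e.base = .inr b → (i.rev : ℕ) = D.arrNum e → (graphPlus π D).label b = π i →
        ∃ d e b, (graphPlus π D).OnTrip i d ∧ (graphPlus π D).Joined d e ∧
          (graphPlus π D).base e = .inr b ∧ (graphPlus π D).label b = π i := by
      intro e b he hb hi hl
      obtain ⟨d, h1, h2, h3⟩ := (graphPlus_present_iff (π := π)).2 he
      refine ⟨d, e, b, (onTrip_iff hD h2 i).2 ?_, ⟨h2, h1, h3.symm D.joined_symm⟩, hb, hl⟩
      rw [hi, (chain_nums h3).2.2.1]
    obtain ⟨x, hx⟩ := (dualPerm π).surjective i.rev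
    rcases D.eq_rowLabel_or_eq_colLabel x with ⟨r, rfl⟩ | ⟨c, rfl⟩
    · rw [hD.1] at hx
      refine arrive (e := .west r) (b := .inl r) (isEssential_west ?_) rfl ?_ ?_
      · obtain ⟨b, -, hb, -⟩ := exists_vNum_eq (L := D) (r := r) (a := 0)
          (fun h => hrow r (Fin.ext (by rwa [vNum_coe] at h))) r.2
        exact (isPresent_iff _).2 ⟨b, hb⟩
      · rw [← hx]
        exact (D.vNum_coe r 0).symm
      · change π (D.vLabel r 0).rev = π i
        rw [hx, Fin.rev_rev]
    · rw [hD.2] at hx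
      refine arrive (e := .north c) (b := .inr c) (isEssential_north ?_) rfl ?_ ?_
      · obtain ⟨b, -, hb, -⟩ := exists_hNum_eq (L := D) (c := c) (a := 0)
          (fun h => hcol c (Fin.ext (by rwa [hNum_coe] at h))) c.2
        exact (isPresent_iff _).2 ⟨b, hb⟩
      · rw [← hx]
        exact (D.hNum_coe 0 c).symm
      · change π (D.hLabel 0 c).rev = π i
        rw [hx, Fin.rev_rev]

end Trips

end LeDiagram

-- Internal vertices: their three labels and their positions

theorem Finset.sum_powersetCard_two_prod {α R : Type*} [DecidableEq α] [CommRing R] {a b c : α}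
    (hab : a ≠ b) (hac : a ≠ c) (hbc : b ≠ c) (f : α → R) :
    ∑ s ∈ ({a, b, c} : Finset α).powersetCard 2, ∏ i ∈ s, f i =
      f a * f b + f a * f c + f b * f c := by
  have h : ({a, b, c} : Finset α).powersetCard 2 = {{a, b}, {a, c}, {b, c}} := by
    rw [Finset.powersetCard_succ_insert (by simp [hab, hac]),
      show ({b, c} : Finset α).powersetCard (1 + 1) = {{b, c}} by
        rw [show 1 + 1 = ({b, c} : Finset α).card from (Finset.card_pair hbc).symm,
          Finset.powersetCard_self], Finset.powersetCard_one]
    ext s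
    simp only [Finset.mem_union, Finset.mem_image, Finset.mem_map, Finset.mem_singleton,
      Finset.mem_insert, Function.Embedding.coeFn_mk, exists_eq_left, or_and_right,
      exists_or, eq_comm (a := s), eq_comm (a := ({_} : Finset α))]
    tauto
  have h1 : ({a, b} : Finset α) ≠ {a, c} := fun h => by
    have : b ∈ ({a, c} : Finset α) := h ▸ by simp
    simp [hab.symm, hbc] at this
  have h2 : ({a, b} : Finset α) ≠ {b, c} := fun h => by
    have : a ∈ ({b, c} : Finset α) := h ▸ by simp
    simp [hab, hac] at this
  have h3 : ({a, c} : Finset α) ≠ {b, c} := fun h => by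
    have : a ∈ ({b, c} : Finset α) := h ▸ by simp
    simp [hab, hac] at this
  rw [h, Finset.sum_insert (by simp [h1, h2]), Finset.sum_pair h3, Finset.prod_pair hab,
    Finset.prod_pair hac, Finset.prod_pair hbc, add_assoc]

theorem triple_eq_of_finset_eq {n : ℕ} {x y z x' y' z' : Fin n} (hxy : x < y) (hyz : y < z)
    (hxy' : x' < y') (hyz' : y' < z') (h : ({x, y, z} : Finset (Fin n)) = {x', y', z'}) :
    x = x' ∧ y = y' ∧ z = z' := by
  have hx : x ∈ ({x', y', z'} : Finset (Fin n)) := h ▸ by simp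
  have hy : y ∈ ({x', y', z'} : Finset (Fin n)) := h ▸ by simp
  have hz : z ∈ ({x', y', z'} : Finset (Fin n)) := h ▸ by simp
  simp only [Finset.mem_insert, Finset.mem_singleton, Fin.ext_iff] at hx hy hz
  simp only [Fin.ext_iff, Fin.lt_def] at *
  omega

namespace LeDiagram

section Vertices

variable {k m : ℕ} {D : LeDiagram k m} {π : Equiv.Perm (Fin (k + m))}

/-- The label at a vertex that is neither the label of its row nor the label of its column. -/
def midNum (D : LeDiagram k m) : Bool × ℕ × ℕ → ℕ
  | (true, r, c) => D.vNum r c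
  | (false, r, c) => D.hNum r c

/-- The middle label is strictly between those of the row and the column. One inequality is that of
the pipes entering the box; the other expresses that the right (white) or bottom (black) dart,
present because the degree is not two, has two different labels. -/
theorem exists_three_darts {v : Bool × ℕ × ℕ} {d : LeDart k m} (hd : D.IsEssential d)
    (hv : d.base = .inl v) :
    ∃ x y z : Fin (k + m), x < y ∧ y < z ∧ D.rowNum v.2.1 = x ∧ D.midNum v = y ∧
      D.colNum v.2.2 = z ∧ ∃ d₁ d₂ d₃ : LeDart k m,
        {d : LeDart k m | d.base = .inl v ∧ D.IsEssential d} = {d₁, d₂, d₃} ∧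
        (D.loNum d₁ = x ∧ D.hiNum d₁ = y ∧ D.endNum d₁ = z + 1) ∧
        (D.loNum d₂ = x ∧ D.hiNum d₂ = z ∧ D.endNum d₂ = y + 1) ∧
        (D.loNum d₃ = y ∧ D.hiNum d₃ = z ∧ D.endNum d₃ = x + 1) := by
  have hp := plus_of_isPresent hd.1 hv
  have hess : ∀ {e : LeDart k m}, e.base = .inl v ↔ e.base = .inl v ∧ D.IsEssential e :=
    fun {e} => ⟨fun he => ⟨he, isEssential_of_base hd hv he⟩, fun he => he.1⟩
  simp only [← hess]
  obtain ⟨b, r, c⟩ := v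
  have hp : (r, c) ∈ D.plus := hp
  have hb := num_bounds hp
  have hv' := vNum_of_plus hp
  have hh' := hNum_of_plus hp
  cases b with
  | true =>
    obtain ⟨e, he⟩ := (hess (e := .blackBottom (r, c))).1 rfl |>.2.1
    have hlt : D.hNum (r + 1) c < D.colNum c := (Joined.nums he).2.2.2.2.2.1
    refine ⟨⟨D.rowNum r, by omega⟩, ⟨D.vNum r c, by omega⟩, ⟨D.colNum c, by omega⟩,
      Fin.lt_def.2 (by simp only; omega), Fin.lt_def.2 (by simp only; omega), rfl, rfl, rfl,
      .blackLeft (r, c), .blackDiag (r, c), .blackBottom (r, c), ?_, ⟨rfl, rfl, rfl⟩,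
      ⟨rfl, rfl, rfl⟩, ⟨hv'.symm, rfl, rfl⟩⟩
    ext e
    change e.base = _ ↔ e = _ ∨ e = _ ∨ e = _
    cases e <;> simp [LeDart.base]
  | false =>
    obtain ⟨e, he⟩ := (hess (e := .whiteRight (r, c))).1 rfl |>.2.1
    have hlt : D.rowNum r < D.vNum r (c + 1) := (Joined.nums he).2.2.2.2.2.1
    refine ⟨⟨D.rowNum r, by omega⟩, ⟨D.hNum r c, by omega⟩, ⟨D.colNum c, by omega⟩,
      Fin.lt_def.2 (by simp only; omega), Fin.lt_def.2 (by simp only; omega), rfl, rfl, rfl,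
      .whiteRight (r, c), .whiteDiag (r, c), .whiteTop (r, c), ?_, ⟨rfl, hh'.symm, rfl⟩,
      ⟨rfl, rfl, rfl⟩, ⟨rfl, rfl, rfl⟩⟩
    ext e
    change e.base = _ ↔ e = _ ∨ e = _ ∨ e = _
    cases e <;> simp [LeDart.base]

/-- The row and column labels determine the box, and within a box the black vertex has the larger
middle label. -/
theorem vertex_eq {v w : Bool × ℕ × ℕ} (hv : v.2 ∈ D.plus) (hw : w.2 ∈ D.plus)
    (hrow : D.rowNum v.2.1 = D.rowNum w.2.1) (hmid : D.midNum v = D.midNum w)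
    (hcol : D.colNum v.2.2 = D.colNum w.2.2) : v = w := by
  obtain ⟨b, r, c⟩ := v
  obtain ⟨b', r', c'⟩ := w
  obtain rfl : r = r' := D.rowNum_strictMono.injective hrow
  obtain rfl : c = c' := by
    rcases lt_trichotomy c c' with h | h | h
    · exact absurd hcol (D.colNum_lt_colNum h (plus_col_lt hw)).ne'
    · exact h
    · exact absurd hcol (D.colNum_lt_colNum h (plus_col_lt hv)).ne
  have hv : (r, c) ∈ D.plus := hv
  have h1 := (num_bounds hv).2.1
  have h2 := vNum_of_plus hv
  have h3 := hNum_of_plus hv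
  cases b <;> cases b' <;> simp only [midNum] at hmid <;> first | rfl | omega

theorem vertexLabels_eq (hD : D.HasPerm (dualPerm π)) {v : Bool × ℕ × ℕ} {d : LeDart k m}
    (hd : D.IsEssential d) (hv : d.base = .inl v) {x y z : Fin (k + m)}
    (hx : D.rowNum v.2.1 = x) (hy : D.midNum v = y) (hz : D.colNum v.2.2 = z) :
    (graphPlus π D).vertexLabels v = {z.rev, y.rev, x.rev} := by
  obtain ⟨x', y', z', -, -, hx', hy', hz', d₁, d₂, d₃, hS, h1, h2, h3⟩ := exists_three_darts hd hv
  obtain rfl : x = x' := Fin.ext (hx.symm.trans hx')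
  obtain rfl : y = y' := Fin.ext (hy.symm.trans hy')
  obtain rfl : z = z' := Fin.ext (hz.symm.trans hz')
  have hmem : ∀ {e : LeDart k m}, e.base = .inl v ∧ D.IsEssential e ↔ e = d₁ ∨ e = d₂ ∨ e = d₃ :=
    fun {e} => Set.ext_iff.1 hS e
  have hl1 := edgeLabels_eq hD (hmem.2 (Or.inl rfl)).2 h1.1 h1.2.1
  have hl2 := edgeLabels_eq hD (hmem.2 (Or.inr (Or.inl rfl))).2 h2.1 h2.2.1
  have hl3 := edgeLabels_eq hD (hmem.2 (Or.inr (Or.inr rfl))).2 h3.1 h3.2.1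
  ext i
  simp only [PlabicGraph.vertexLabels, Finset.mem_filter, Finset.mem_univ, true_and]
  constructor
  · rintro ⟨e, he, hi⟩
    rcases hmem.1 ⟨he, isEssential_of_base hd hv he⟩ with rfl | rfl | rfl
    · rw [hl1] at hi; simp at hi ⊢; tauto
    · rw [hl2] at hi; simp at hi ⊢; tauto
    · rw [hl3] at hi; simp at hi ⊢; tauto
  · intro hi
    simp only [Finset.mem_insert, Finset.mem_singleton] at hi
    rcases hi with rfl | rfl | rfl
    · exact ⟨d₂, (hmem.2 (Or.inr (Or.inl rfl))).1, by rw [hl2]; simp⟩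
    · exact ⟨d₁, (hmem.2 (Or.inl rfl)).1, by rw [hl1]; simp⟩
    · exact ⟨d₂, (hmem.2 (Or.inr (Or.inl rfl))).1, by rw [hl2]; simp⟩

theorem position_eq (hD : D.HasPerm (dualPerm π)) (κ : Fin (k + m) → ℝ) {v : Bool × ℕ × ℕ}
    {d : LeDart k m} (hd : D.IsEssential d) (hv : d.base = .inl v) {x y z : Fin (k + m)}
    (hxy : x < y) (hyz : y < z)
    (hx : D.rowNum v.2.1 = x) (hy : D.midNum v = y) (hz : D.colNum v.2.2 = z) :
    (graphPlus π D).position κ v =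
      (κ z.rev * κ y.rev + κ z.rev * κ x.rev + κ y.rev * κ x.rev,
        - (κ z.rev + κ y.rev + κ x.rev)) := by
  have h1 : z.rev ≠ y.rev := Fin.rev_injective.ne hyz.ne'
  have h2 : z.rev ≠ x.rev := Fin.rev_injective.ne (hxy.trans hyz).ne'
  have h3 : y.rev ≠ x.rev := Fin.rev_injective.ne hxy.ne'
  have hl := vertexLabels_eq hD hd hv hx hy hz
  change (∑ s ∈ ((graphPlus π D).vertexLabels v).powersetCard 2, ∏ i ∈ s, κ i,
    - ∑ i ∈ (graphPlus π D).vertexLabels v, κ i) = _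
  rw [hl]
  rw [Finset.sum_powersetCard_two_prod h1 h2 h3, Finset.sum_insert (by simp [h1, h2]),
    Finset.sum_pair h3, ← add_assoc]

/-- The position of a vertex on the line of any of its darts. -/
theorem position_eq_linePoint (hD : D.HasPerm (dualPerm π)) {κ κ' : Fin (k + m) → ℝ}
    (hκ' : ∀ l, κ' l = - κ l.rev) {v : Bool × ℕ × ℕ} {d : LeDart k m} (hd : D.IsEssential d)
    (hv : d.base = .inl v) {a b : Fin (k + m)} (ha : D.loNum d = a) (hb : D.hiNum d = b) :
    ∃ l : Fin (k + m), D.endNum d = l + 1 ∧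
      (graphPlus π D).position κ v = linePoint κ' a b (κ' l) := by
  obtain ⟨x, y, z, hxy, hyz, hx, hy, hz, d₁, d₂, d₃, hS, h1, h2, h3⟩ := exists_three_darts hd hv
  rw [position_eq hD κ hd hv hxy hyz hx hy hz]
  have hmem : d = d₁ ∨ d = d₂ ∨ d = d₃ := (Set.ext_iff.1 hS d).1 ⟨hv, hd⟩
  rcases hmem with rfl | rfl | rfl
  · obtain rfl : a = x := Fin.ext (ha.symm.trans h1.1)
    obtain rfl : b = y := Fin.ext (hb.symm.trans h1.2.1)
    refine ⟨z, h1.2.2, ?_⟩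
    simp only [linePoint, hκ', Prod.mk.injEq]
    constructor <;> ring
  · obtain rfl : a = x := Fin.ext (ha.symm.trans h2.1)
    obtain rfl : b = z := Fin.ext (hb.symm.trans h2.2.1)
    refine ⟨y, h2.2.2, ?_⟩
    simp only [linePoint, hκ', Prod.mk.injEq]
    constructor <;> ring
  · obtain rfl : a = y := Fin.ext (ha.symm.trans h3.1)
    obtain rfl : b = z := Fin.ext (hb.symm.trans h3.2.1)
    refine ⟨x, h3.2.2, ?_⟩
    simp only [linePoint, hκ', Prod.mk.injEq]
    constructor <;> ring

end Vertices

end LeDiagram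

/-! ### The placement of the edges -/

namespace PlabicGraph

variable {n : ℕ} {G : PlabicGraph n} {κ : Fin n → ℝ} {d e : G.Dart}

theorem edgeSet_of_inl_inl {v w : G.Vertex} (hd : G.base d = .inl v) (he : G.base e = .inl w) :
    G.edgeSet κ d e = segment ℝ (G.position κ v) (G.position κ w) := by
  simp only [edgeSet, hd, he]

theorem edgeSet_of_inl_inr {v : G.Vertex} {w : G.Bdry} (hd : G.base d = .inl v)
    (he : G.base e = .inr w) : G.edgeSet κ d e = G.ray κ d v w := by
  simp only [edgeSet, hd, he]

theorem edgeSet_of_inr_inl {v : G.Vertex} {w : G.Bdry} (hd : G.base d = .inr w)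
    (he : G.base e = .inl v) : G.edgeSet κ d e = G.ray κ d v w := by
  simp only [edgeSet, hd, he]

theorem edgeSet_of_inr_inr {v w : G.Bdry} (hd : G.base d = .inr v) (he : G.base e = .inr w) :
    G.edgeSet κ d e =
      {q | ∃ i ∈ G.edgeLabels d, ∃ j ∈ G.edgeLabels d, i < j ∧ phase κ i q = phase κ j q} := by
  simp only [edgeSet, hd, he]

end PlabicGraph

namespace LeDiagram

section Placement

variable {k m : ℕ} {D : LeDiagram k m} {π : Equiv.Perm (Fin (k + m))}

/-- The parameter `r` on the line of `d` is on the same side of the vertex of `d` as the edge. -/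
def OnSide (D : LeDiagram k m) (κ' : Fin (k + m) → ℝ) (d : LeDart k m) (r : ℝ) : Prop :=
  ∀ l : Fin (k + m), D.endNum d = l + 1 → (IsLower d → κ' l ≤ r) ∧ (¬ IsLower d → r ≤ κ' l)

theorem onSide_iff {κ' : Fin (k + m) → ℝ} {d : LeDart k m} {l : Fin (k + m)}
    (h : D.endNum d = l + 1) (r : ℝ) :
    D.OnSide κ' d r ↔ (IsLower d → κ' l ≤ r) ∧ (¬ IsLower d → r ≤ κ' l) := by
  refine ⟨fun h' => h' l h, fun h' l' hl' => ?_⟩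
  obtain rfl : l = l' := Fin.ext (by omega)
  exact h'

theorem onSide_of_base_eq_inr {κ' : Fin (k + m) → ℝ} {d : LeDart k m} {b : Fin k ⊕ Fin m}
    (h : d.base = .inr b) (r : ℝ) : D.OnSide κ' d r := by
  intro l hl
  have := l.2
  cases d <;> cases h <;> simp only [endNum] at hl <;> omega

theorem isLower_iff_of_base_eq_inr {d : LeDart k m} {b : Fin k ⊕ Fin m} (h : d.base = .inr b) :
    IsLower d ↔ ¬ b.isLeft = true := by
  cases d <;> cases h <;> simp [IsLower]

theorem linePoint_eq_add (κ' : Fin (k + m) → ℝ) (a b : Fin (k + m)) (r s : ℝ) :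
    linePoint κ' a b r = linePoint κ' a b s + (r - s) • ((κ' a + κ' b, 1) : ℝ × ℝ) := by
  simp only [linePoint, Prod.smul_mk, Prod.mk_add_mk, smul_eq_mul, Prod.mk.injEq]
  constructor <;> ring

theorem slope_eq (hD : D.HasPerm (dualPerm π)) {κ κ' : Fin (k + m) → ℝ}
    (hκ' : ∀ l, κ' l = - κ l.rev) {d : LeDart k m} (hd : D.IsEssential d) {a b : Fin (k + m)}
    (hab : a < b) (ha : D.loNum d = a) (hb : D.hiNum d = b) :
    (graphPlus π D).slope κ d = - (κ' a + κ' b) := by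
  change ∑ i ∈ (graphPlus π D).edgeLabels d, κ i = _
  rw [edgeLabels_eq hD hd ha hb,
    Finset.sum_pair (Fin.rev_injective.ne hab.ne'), hκ', hκ']
  ring

theorem mem_ray_iff (hD : D.HasPerm (dualPerm π)) {κ κ' : Fin (k + m) → ℝ}
    (hκ' : ∀ l, κ' l = - κ l.rev) {d e f : LeDart k m} (he : D.IsEssential e)
    {v : Bool × ℕ × ℕ} {w : Fin k ⊕ Fin m} (hv : e.base = .inl v) (hw : f.base = .inr w)
    (hef : IsLower e ↔ ¬ IsLower f) {a b : Fin (k + m)}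
    (hs : (graphPlus π D).slope κ d = - (κ' a + κ' b))
    (ha : D.loNum e = a) (hb : D.hiNum e = b) (p : ℝ × ℝ) :
    p ∈ (graphPlus π D).ray κ d v w ↔ ∃ r, p = linePoint κ' a b r ∧ D.OnSide κ' e r := by
  obtain ⟨l, hl, hpos⟩ := position_eq_linePoint hD hκ' he hv ha hb
  simp only [onSide_iff hl]
  have htop : (graphPlus π D).top w ↔ IsLower e := by
    rw [hef, isLower_iff_of_base_eq_inr hw, not_not]
    exact Iff.rfl
  change (∃ t : ℝ, ((graphPlus π D).top w → 0 ≤ t) ∧ (¬ (graphPlus π D).top w → t ≤ 0) ∧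
    p = (graphPlus π D).position κ v + t • ((- (graphPlus π D).slope κ d, 1) : ℝ × ℝ)) ↔ _
  rw [hpos, hs, neg_neg, htop]
  constructor
  · rintro ⟨t, h1, h2, rfl⟩
    refine ⟨κ' l + t, ?_, fun h => ?_, fun h => ?_⟩
    · rw [linePoint_eq_add κ' a b (κ' l + t) (κ' l), add_sub_cancel_left]
    · linarith [h1 h]
    · linarith [h2 h]
  · rintro ⟨r, rfl, h1, h2⟩
    refine ⟨r - κ' l, fun h => ?_, fun h => ?_, linePoint_eq_add _ _ _ _ _⟩
    · linarith [h1 h]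
    · linarith [h2 h]

theorem mem_segment_linePoint_iff {κ' : Fin (k + m) → ℝ} {a b : Fin (k + m)} {s t : ℝ} (hst : s ≤ t)
    (p : ℝ × ℝ) : p ∈ segment ℝ (linePoint κ' a b s) (linePoint κ' a b t) ↔
      ∃ r, p = linePoint κ' a b r ∧ s ≤ r ∧ r ≤ t := by
  have hf : ∀ r, linePoint κ' a b r =
      AffineMap.lineMap (linePoint κ' a b 0) (linePoint κ' a b 1) r := by
    intro r
    rw [AffineMap.lineMap_apply_module']
    simp only [linePoint, Prod.mk_sub_mk, Prod.smul_mk, Prod.mk_add_mk, smul_eq_mul, Prod.mk.injEq]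
    constructor <;> ring
  rw [hf s, hf t, ← image_segment, segment_eq_Icc hst]
  constructor
  · rintro ⟨r, hr, rfl⟩
    exact ⟨r, (hf r).symm, hr⟩
  · rintro ⟨r, rfl, hr⟩
    exact ⟨r, hr, (hf r).symm⟩

/-- Segments, rays and lines receive one description. At a boundary vertex the condition `OnSide` is
empty, because the end numbers `0` and `k + m + 1` are not of the form `l + 1` with `l < k + m`. -/
theorem mem_edgeSet_iff (hD : D.HasPerm (dualPerm π)) {κ κ' : Fin (k + m) → ℝ}
    (hκ' : ∀ l, κ' l = - κ l.rev) (hmono : StrictMono κ') {d e : LeDart k m}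
    (h : (graphPlus π D).Joined d e) {a b : Fin (k + m)} (hab : a < b) (ha : D.loNum d = a)
    (hb : D.hiNum d = b) (p : ℝ × ℝ) :
    p ∈ (graphPlus π D).edgeSet κ d e ↔
      ∃ r, p = linePoint κ' a b r ∧ D.OnSide κ' d r ∧ D.OnSide κ' e r := by
  obtain ⟨hd, he, hde⟩ := h
  obtain ⟨n1, -, -, n4, n5, -, -, n8⟩ := chain_nums hde
  obtain ⟨-, -, -, -, -, -, -, n8'⟩ := chain_nums (hde.symm D.joined_symm)
  have ha' : D.loNum e = a := n4.symm.trans ha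
  have hb' : D.hiNum e = b := n5.symm.trans hb
  have hs := slope_eq hD hκ' hd hab ha hb
  have hn1' : IsLower e ↔ ¬ IsLower d := by tauto
  rcases hvd : d.base with v | v <;> rcases hve : e.base with w | w
  · obtain ⟨l, hl, hpos⟩ := position_eq_linePoint hD hκ' hd hvd ha hb
    obtain ⟨l', hl', hpos'⟩ := position_eq_linePoint hD hκ' he hve ha' hb'
    simp only [onSide_iff hl, onSide_iff hl']
    rw [PlabicGraph.edgeSet_of_inl_inl (G := graphPlus π D) hvd hve, hpos, hpos']
    by_cases hlow : IsLower d
    · have hle : κ' l ≤ κ' l' := hmono.monotone (Fin.le_def.2 (by have := n8 hlow; omega))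
      rw [mem_segment_linePoint_iff hle]
      simp [hlow, n1.1 hlow]
    · have hlow' := hn1'.2 hlow
      have hle : κ' l' ≤ κ' l := hmono.monotone (Fin.le_def.2 (by have := n8' hlow'; omega))
      rw [segment_symm, mem_segment_linePoint_iff hle]
      simp [hlow, hlow', and_comm]
  · rw [PlabicGraph.edgeSet_of_inl_inr (G := graphPlus π D) hvd hve,
      mem_ray_iff hD hκ' hd hvd hve n1 hs ha hb]
    simp only [onSide_of_base_eq_inr hve, and_true]
  · rw [PlabicGraph.edgeSet_of_inr_inl (G := graphPlus π D) hvd hve,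
      mem_ray_iff hD hκ' he hve hvd hn1' hs ha' hb']
    simp only [onSide_of_base_eq_inr hvd, true_and]
  · rw [PlabicGraph.edgeSet_of_inr_inr (G := graphPlus π D) hvd hve]
    simp only [onSide_of_base_eq_inr hvd, onSide_of_base_eq_inr hve, and_true]
    have hl := edgeLabels_eq hD hd ha hb
    constructor
    · rintro ⟨i, hi, j, hj, hij, heq⟩
      rw [hl, Finset.mem_insert, Finset.mem_singleton] at hi hj
      have hba := Fin.rev_lt_rev.2 hab
      rcases hi with rfl | rfl <;> rcases hj with rfl | rfl
      · exact absurd hij (lt_irrefl _)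
      · exact exists_eq_linePoint κ κ' hκ' (hmono hab).ne heq.symm
      · exact absurd hij hba.not_gt
      · exact absurd hij (lt_irrefl _)
    · rintro ⟨r, rfl⟩
      refine ⟨b.rev, by rw [hl]; simp, a.rev, by rw [hl]; simp, Fin.rev_lt_rev.2 hab, ?_⟩
      have := phase_linePoint_sub κ κ' hκ' a b r b
      rw [sub_self, mul_zero, zero_mul, neg_zero] at this
      linarith

theorem endNum_le {d : LeDart k m} (hd : D.IsPresent d) : D.endNum d ≤ k + m + 1 := by
  have hp := fun v => plus_of_isPresent (v := v) hd
  have bound : ∀ {r c}, (r, c) ∈ D.plus → D.rowNum r < k + m ∧ D.colNum c < k + m ∧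
      D.hNum r c < k + m ∧ D.vNum r c < k + m := by
    intro r c h
    have h1 := num_bounds h
    have h2 := vNum_of_plus h
    have h3 := hNum_of_plus h
    omega
  cases d <;> simp only [endNum]
  all_goals first | omega | (have := bound (hp _ rfl); simp only at this; omega)

/-- A point on an edge of `G_+` lies in a cell of the line between the ends of the edge. -/
theorem exists_separates_of_onSide {κ' : Fin (k + m) → ℝ} (hmono : StrictMono κ')
    {d e : LeDart k m} (he : D.IsPresent e) (hd : IsLower d) (he' : ¬ IsLower e)
    (hde : D.endNum d < D.endNum e) {r : ℝ} (h1 : D.OnSide κ' d r) (h2 : D.OnSide κ' e r) :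
    ∃ σ, D.endNum d ≤ σ ∧ σ < D.endNum e ∧ Separates κ' σ r := by
  obtain ⟨s, hs, hsep⟩ := exists_separates hmono r
  have hle := endNum_le he
  rcases le_or_gt (D.endNum d) s with h | h
  · refine ⟨s, h, ?_, fun l => ⟨fun hl => ((hsep l).1 hl).le, fun hl => ?_⟩⟩
    · by_contra! hcon
      have hr := (h2 ⟨D.endNum e - 1, by omega⟩ (by simp only; omega)).2 he'
      exact hr.not_gt ((hsep _).1 (by simp only; omega))
    · exact not_lt.1 fun hlt => hl.not_gt ((hsep l).2 hlt)
  -- Here `r` is exactly the value at the lower end, so `σ` may be raised past that element and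
  -- enters the range of the edge.
  · have hr := (h1 ⟨D.endNum d - 1, by omega⟩ (by simp only; omega)).1 hd
    have hr' : r = κ' ⟨D.endNum d - 1, by omega⟩ :=
      le_antisymm (not_lt.1 fun hlt => absurd ((hsep _).2 hlt) (by simp only; omega)) hr
    refine ⟨D.endNum d, le_rfl, hde, fun l => ⟨fun hl => ?_, fun hl => ?_⟩⟩
    · rw [hr']
      exact hmono.monotone (Fin.le_def.2 (by simp only; omega))
    · rw [hr']
      exact hmono.monotone (Fin.le_def.2 (by simp only; omega))

theorem onSide_of_separates {κ' : Fin (k + m) → ℝ} {d e : LeDart k m} (hd : IsLower d)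
    (he : ¬ IsLower e) {σ : ℕ} {r : ℝ} (h : Separates κ' σ r) (h1 : D.endNum d ≤ σ)
    (h2 : σ < D.endNum e) : D.OnSide κ' d r ∧ D.OnSide κ' e r := by
  refine ⟨fun l hl => ⟨fun _ => (h l).1 (by omega), fun h' => absurd hd h'⟩,
    fun l hl => ⟨fun h' => absurd h' he, fun _ => (h l).2 (by omega)⟩⟩

end Placement

end LeDiagram

-- The edges carry the line-solitons and make up the contour plot

namespace LeDiagram

section Soliton

variable {k m : ℕ} {D : LeDiagram k m} {π : Equiv.Perm (Fin (k + m))}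
  {E : Type*} [AddCommGroup E] [Module ℝ E] {M : Finset (Finset (Fin (k + m)))}
  {v : Fin (k + m) → E} {κ κ' : Fin (k + m) → ℝ}

/-- The coordinate `r` lies in a gap `σ` between the ends of the chain. One edge of the pipe graph
in this chain covers the gap and supplies the parallel pair. -/
theorem isBalanced_of_onSide (hM : Represents M v) (hv : D.IsRealizedBy fun l => v l.rev)
    (hκ' : ∀ l, κ' l = - κ l.rev) (hmono : StrictMono κ') {d e : LeDart k m}
    (h : (graphPlus π D).Joined d e) {a b : Fin (k + m)} (hab : a < b) (ha : D.loNum d = a)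
    (hb : D.hiNum d = b) {r : ℝ} (hd : D.OnSide κ' d r) (he : D.OnSide κ' e r) :
    IsBalanced κ M a.rev b.rev (linePoint κ' a b r) := by
  have lower : ∀ {d e : LeDart k m}, D.pipeGraph.Chain d e → IsLower d → D.loNum d = a →
      D.hiNum d = b → D.OnSide κ' d r → D.OnSide κ' e r →
      IsBalanced κ M a.rev b.rev (linePoint κ' a b r) := by
    intro d e h hlow ha hb hd he
    obtain ⟨n1, -, -, -, -, -, -, n8⟩ := chain_nums h
    obtain ⟨σ, h1, h2, hsep⟩ := exists_separates_of_onSide hmono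
      (h.present_right D.joined_symm) hlow (n1.1 hlow) (n8 hlow) hd he
    obtain ⟨f, g, hfg, hf, hg, hdf, -⟩ := chain_cover h h1 h2
    obtain ⟨m1, -, m3, m4, -, -⟩ := reach_nums hdf ⟨g, hfg⟩
    exact isBalanced_of_parallelMod_upperSet hM hκ' hmono hab hsep
      (hv.parallelMod_of_joined hfg (m1.1 hlow) (m3.symm.trans ha) (m4.symm.trans hb) hf hg)
  obtain ⟨n1, -, -, n4, n5, -, -, -⟩ := chain_nums h.2.2
  by_cases hlow : IsLower d
  · exact lower h.2.2 hlow ha hb hd he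
  · exact lower (h.2.2.symm D.joined_symm) (by tauto) (n4.symm.trans ha) (n5.symm.trans hb) he hd

/-- Two edges with the same labels and more than one common point coincide. -/
theorem eq_of_onSide_of_lt (hmono : StrictMono κ') {d e d' e' : LeDart k m}
    (h : (graphPlus π D).Joined d e) (h' : (graphPlus π D).Joined d' e') (hd : IsLower d)
    (hd' : IsLower d') (hlo : D.loNum d = D.loNum d') (hhi : D.hiNum d = D.hiNum d') {r s : ℝ}
    (hrs : r < s) (h1 : D.OnSide κ' d r) (h2 : D.OnSide κ' e s) (h1' : D.OnSide κ' d' r)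
    (h2' : D.OnSide κ' e' s) : d = d' ∧ e = e' := by
  -- The gap of a point strictly between the two common ones is covered by one pipe edge from each
  -- chain. These coincide by `joined_unique_of_overlap`, and a pipe edge determines the chain that
  -- contains it.
  obtain ⟨t, hrt, hts⟩ := exists_between hrs
  obtain ⟨σ, hσ, hsep⟩ := exists_separates hmono t
  have bounds : ∀ {d e : LeDart k m}, D.pipeGraph.Chain d e → IsLower d → D.OnSide κ' d r →
      D.OnSide κ' e s → D.endNum d ≤ σ ∧ σ < D.endNum e := by
    intro d e h hlow h1 h2
    obtain ⟨n1, -, -, -, -, -, -, n8⟩ := chain_nums h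
    have hle := endNum_le (h.present_right D.joined_symm)
    have hlt := n8 hlow
    constructor
    · by_contra! hcon
      have hl := (h1 ⟨D.endNum d - 1, by omega⟩ (by simp only; omega)).1 hlow
      have := (hsep _).2 (hl.trans_lt hrt)
      simp only at this
      omega
    · by_contra! hcon
      have hl := (h2 ⟨D.endNum e - 1, by omega⟩ (by simp only; omega)).2 (n1.1 hlow)
      exact (hts.trans_le hl).not_gt ((hsep _).1 (by simp only; omega))
  obtain ⟨b1, b2⟩ := bounds h.2.2 hd h1 h2
  obtain ⟨b1', b2'⟩ := bounds h'.2.2 hd' h1' h2'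
  obtain ⟨f, g, hfg, hf, hg, hdf, heg⟩ := chain_cover h.2.2 b1 b2
  obtain ⟨f', g', hfg', hf', hg', hdf', heg'⟩ := chain_cover h'.2.2 b1' b2'
  obtain ⟨m1, -, m3, m4, -, -⟩ := reach_nums hdf ⟨g, hfg⟩
  obtain ⟨m1', -, m3', m4', -, -⟩ := reach_nums hdf' ⟨g', hfg'⟩
  obtain ⟨rfl, rfl⟩ := joined_unique_of_overlap hfg hfg' (m1.1 hd) (m1'.1 hd') (by omega) (by omega)
    hf hg hf' hg'
  exact ⟨hdf.unique D.joined_symm D.joined_unique ⟨g, hfg⟩ h.1 h'.1 hdf',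
    heg.unique D.joined_symm D.joined_unique ⟨f, hfg.symm⟩ h.2.1 h'.2.1 heg'⟩

theorem eq_of_not_subsingleton (hD : D.HasPerm (dualPerm π)) (hκ' : ∀ l, κ' l = - κ l.rev)
    (hmono : StrictMono κ') {d e d' e' : LeDart k m} (h : (graphPlus π D).Joined d e)
    (h' : (graphPlus π D).Joined d' e') (hd : IsLower d) (hd' : IsLower d')
    (hs : ¬ ((graphPlus π D).edgeSet κ d e ∩ (graphPlus π D).edgeSet κ d' e').Subsingleton) :
    d = d' ∧ e = e' := by
  obtain ⟨a, b, hab, ha, hb⟩ := exists_lo_hi h.1.1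
  obtain ⟨a', b', hab', ha', hb'⟩ := exists_lo_hi h'.1.1
  obtain ⟨p, ⟨hp, hp'⟩, q, ⟨hq, hq'⟩, hpq⟩ := Set.not_subsingleton_iff.1 hs
  rw [mem_edgeSet_iff hD hκ' hmono h hab ha hb] at hp hq
  rw [mem_edgeSet_iff hD hκ' hmono h' hab' ha' hb'] at hp' hq'
  obtain ⟨r, rfl, hr1, hr2⟩ := hp
  obtain ⟨s, rfl, hs1, hs2⟩ := hq
  obtain ⟨r', hr, hr1', hr2'⟩ := hp'
  obtain ⟨s', hs, hs1', hs2'⟩ := hq'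
  by_cases hne : a = a' ∧ b = b'
  · obtain ⟨rfl, rfl⟩ := hne
    have inj : ∀ {x y : ℝ}, linePoint κ' a b x = linePoint κ' a b y → x = y := by
      intro x y hxy
      simpa [linePoint] using congrArg Prod.snd hxy
    obtain rfl := inj hr
    obtain rfl := inj hs
    rcases lt_trichotomy r s with hlt | rfl | hlt
    · exact eq_of_onSide_of_lt hmono h h' hd hd' (ha.trans ha'.symm) (hb.trans hb'.symm) hlt hr1 hs2
        hr1' hs2'
    · exact absurd rfl hpq
    · exact eq_of_onSide_of_lt hmono h h' hd hd' (ha.trans ha'.symm) (hb.trans hb'.symm) hlt hs1 hr2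
        hs1' hr2'
  · exact absurd (congrArg _ (linePoint_inj hmono hab hab' hne hr hs)) hpq

theorem edgeSet_symm (hD : D.HasPerm (dualPerm π)) (hκ' : ∀ l, κ' l = - κ l.rev)
    (hmono : StrictMono κ') {d e : LeDart k m} (h : (graphPlus π D).Joined d e) :
    (graphPlus π D).edgeSet κ d e = (graphPlus π D).edgeSet κ e d := by
  obtain ⟨a, b, hab, ha, hb⟩ := exists_lo_hi h.1.1
  obtain ⟨-, -, -, n4, n5, -, -, -⟩ := chain_nums h.2.2
  ext p
  rw [mem_edgeSet_iff hD hκ' hmono h hab ha hb,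
    mem_edgeSet_iff hD hκ' hmono (d := e) (e := d) ⟨h.2.1, h.1, h.2.2.symm D.joined_symm⟩ hab
      (n4.symm.trans ha) (n5.symm.trans hb)]
  simp only [and_comm (a := D.OnSide κ' d _)]

theorem subsingleton_edgeSet_inter (hD : D.HasPerm (dualPerm π)) (hκ' : ∀ l, κ' l = - κ l.rev)
    (hmono : StrictMono κ') {d e d' e' : LeDart k m} (h : (graphPlus π D).Joined d e)
    (h' : (graphPlus π D).Joined d' e') (h1 : d' ≠ d) (h2 : d' ≠ e) :
    ((graphPlus π D).edgeSet κ d e ∩ (graphPlus π D).edgeSet κ d' e').Subsingleton := by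
  by_contra hs
  have n := (chain_nums h.2.2).1
  have n' := (chain_nums h'.2.2).1
  have hsymm : (graphPlus π D).Joined e d := ⟨h.2.1, h.1, h.2.2.symm D.joined_symm⟩
  have hsymm' : (graphPlus π D).Joined e' d' := ⟨h'.2.1, h'.1, h'.2.2.symm D.joined_symm⟩
  -- Each edge is first reoriented so that its lower half comes first.
  by_cases hd : IsLower d <;> by_cases hd' : IsLower d'
  · exact h1 (eq_of_not_subsingleton hD hκ' hmono h h' hd hd' hs).1.symm
  · rw [edgeSet_symm hD hκ' hmono h'] at hs
    exact h2 (eq_of_not_subsingleton hD hκ' hmono h hsymm' hd (by tauto) hs).2.symm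
  · rw [edgeSet_symm hD hκ' hmono h] at hs
    exact h2 (eq_of_not_subsingleton hD hκ' hmono hsymm h' (by tauto) hd' hs).1.symm
  · rw [edgeSet_symm hD hκ' hmono h, edgeSet_symm hD hκ' hmono h'] at hs
    exact h1 (eq_of_not_subsingleton hD hκ' hmono hsymm hsymm' (by tauto) (by tauto) hs).2.symm

theorem contourPlot_eq (hM : Represents M v) (hv : D.IsRealizedBy fun l => v l.rev)
    (hD : D.HasPerm (dualPerm π)) (hκ : StrictMono κ) (hκ' : ∀ l, κ' l = - κ l.rev)
    (hmono : StrictMono κ') :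
    contourPlot κ M =
      {p | ∃ d e, (graphPlus π D).Joined d e ∧ p ∈ (graphPlus π D).edgeSet κ d e} := by
  ext p
  constructor
  · intro hp
    obtain ⟨i, j, σ, r, hij, hσ, rfl, hsep, hpar⟩ := exists_parallelMod_upperSet hM hκ' hmono hp
    obtain ⟨f, g, hfg, hlow, hlo, hhi, h1, h2⟩ := hv.exists_joined_of_parallelMod hij hσ hpar
    have hpf : D.IsPresent f := ⟨g, hfg⟩
    have hpg : D.IsPresent g := ⟨f, hfg.symm⟩
    obtain ⟨d, hd, hdf⟩ := exists_reach hpf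
    obtain ⟨e, he, heg⟩ := exists_reach hpg
    have hde : (graphPlus π D).Joined d e :=
      ⟨hd, he, hdf.chain_of_reach D.joined_symm heg hfg⟩
    obtain ⟨m1, -, m3, m4, m5, -⟩ := reach_nums hdf hpf
    obtain ⟨m1', -, -, -, -, m6'⟩ := reach_nums heg hpg
    have hg := hfg.nums.1.1 hlow
    obtain ⟨s1, s2⟩ := onSide_of_separates (m1.2 hlow) (fun h => hg (m1'.1 h)) hsep
      ((m5 hlow).trans h1) (h2.trans_le (m6' hg))
    exact ⟨d, e, hde, (mem_edgeSet_iff hD hκ' hmono hde hij (m3.trans hlo) (m4.trans hhi) _).2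
      ⟨r, rfl, s1, s2⟩⟩
  · rintro ⟨d, e, h, hp⟩
    obtain ⟨a, b, hab, ha, hb⟩ := exists_lo_hi h.1.1
    obtain ⟨r, rfl, h1, h2⟩ := (mem_edgeSet_iff hD hκ' hmono h hab ha hb p).1 hp
    exact (isBalanced_of_onSide hM hv hκ' hmono h hab ha hb h1 h2).mem_contourPlot hκ.injective
      (Fin.rev_injective.ne hab.ne)

theorem phase_eq_and_isBalanced (hM : Represents M v) (hv : D.IsRealizedBy fun l => v l.rev)
    (hD : D.HasPerm (dualPerm π)) (hκ' : ∀ l, κ' l = - κ l.rev) (hmono : StrictMono κ')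
    {d e : LeDart k m} (h : (graphPlus π D).Joined d e) {i j : Fin (k + m)} (hij : i < j)
    (hl : (graphPlus π D).edgeLabels d = {i, j}) {p : ℝ × ℝ}
    (hp : p ∈ (graphPlus π D).edgeSet κ d e) :
    phase κ i p = phase κ j p ∧ IsBalanced κ M i j p := by
  obtain ⟨a, b, hab, ha, hb⟩ := exists_lo_hi h.1.1
  rw [edgeLabels_eq hD h.1 ha hb] at hl
  have hi : i ∈ ({b.rev, a.rev} : Finset (Fin (k + m))) := hl ▸ by simp
  have hj : j ∈ ({b.rev, a.rev} : Finset (Fin (k + m))) := hl ▸ by simp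
  have hba := Fin.rev_lt_rev.2 hab
  simp only [Finset.mem_insert, Finset.mem_singleton] at hi hj
  obtain ⟨rfl, rfl⟩ : i = b.rev ∧ j = a.rev := by
    rcases hi with rfl | rfl <;> rcases hj with rfl | rfl
    · exact absurd hij (lt_irrefl _)
    · exact ⟨rfl, rfl⟩
    · exact absurd hij hba.not_gt
    · exact absurd hij (lt_irrefl _)
  obtain ⟨r, rfl, h1, h2⟩ := (mem_edgeSet_iff hD hκ' hmono h hab ha hb p).1 hp
  constructor
  · have := phase_linePoint_sub κ κ' hκ' a b r b
    rw [sub_self, mul_zero, zero_mul, neg_zero] at this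
    linarith
  · obtain ⟨S, s1, s2, s3, s4⟩ := isBalanced_of_onSide hM hv hκ' hmono h hab ha hb h1 h2
    exact ⟨S, s2, s1, s4, s3⟩

theorem isVertex_iff {w : Bool × ℕ × ℕ} :
    (graphPlus π D).IsVertex w ↔ ∃ d : LeDart k m, D.IsEssential d ∧ d.base = .inl w := by
  constructor
  · rintro ⟨d, hd, hp⟩
    exact ⟨d, graphPlus_present_iff.1 hp, hd⟩
  · rintro ⟨d, hd, hw⟩
    exact ⟨d, hw, graphPlus_present_iff.2 hd⟩

theorem vertex_eq_of_vertexLabels_eq (hD : D.HasPerm (dualPerm π)) {w w' : Bool × ℕ × ℕ}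
    (hw : (graphPlus π D).IsVertex w) (hw' : (graphPlus π D).IsVertex w')
    (h : (graphPlus π D).vertexLabels w = (graphPlus π D).vertexLabels w') : w = w' := by
  obtain ⟨d, hd, hdw⟩ := isVertex_iff.1 hw
  obtain ⟨d', hd', hdw'⟩ := isVertex_iff.1 hw'
  obtain ⟨x, y, z, hxy, hyz, hx, hy, hz, -⟩ := exists_three_darts hd hdw
  obtain ⟨x', y', z', hxy', hyz', hx', hy', hz', -⟩ := exists_three_darts hd' hdw'
  rw [vertexLabels_eq hD hd hdw hx hy hz, vertexLabels_eq hD hd' hdw' hx' hy' hz'] at h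
  obtain ⟨h1, h2, h3⟩ := triple_eq_of_finset_eq (Fin.rev_lt_rev.2 hyz) (Fin.rev_lt_rev.2 hxy)
    (Fin.rev_lt_rev.2 hyz') (Fin.rev_lt_rev.2 hxy') h
  obtain rfl := Fin.rev_injective h1
  obtain rfl := Fin.rev_injective h2
  obtain rfl := Fin.rev_injective h3
  exact vertex_eq (plus_of_isPresent hd.1 hdw) (plus_of_isPresent hd'.1 hdw') (hx.trans hx'.symm)
    (hy.trans hy'.symm) (hz.trans hz'.symm)

theorem exists_trivalent (hD : D.HasPerm (dualPerm π)) (κ : Fin (k + m) → ℝ) {w : Bool × ℕ × ℕ}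
    (hw : (graphPlus π D).IsVertex w) : ∃ i a b, i < a ∧ a < b ∧
      (graphPlus π D).position κ w =
        (κ i * κ a + κ i * κ b + κ a * κ b, - (κ i + κ a + κ b)) ∧
      ∃ d₁ d₂ d₃, {d | (graphPlus π D).base d = .inl w ∧ (graphPlus π D).Present d} =
          {d₁, d₂, d₃} ∧ (graphPlus π D).edgeLabels d₁ = {i, a} ∧
        (graphPlus π D).edgeLabels d₂ = {i, b} ∧ (graphPlus π D).edgeLabels d₃ = {a, b} := by
  obtain ⟨d, hd, hdw⟩ := isVertex_iff.1 hw
  obtain ⟨x, y, z, hxy, hyz, hx, hy, hz, d₁, d₂, d₃, hS, h1, h2, h3⟩ := exists_three_darts hd hdw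
  have hmem := Set.ext_iff.1 hS
  refine ⟨z.rev, y.rev, x.rev, Fin.rev_lt_rev.2 hyz, Fin.rev_lt_rev.2 hxy,
    position_eq hD κ hd hdw hxy hyz hx hy hz, d₃, d₂, d₁, ?_,
    edgeLabels_eq hD ((hmem d₃).2 (by simp)).2 h3.1 h3.2.1,
    edgeLabels_eq hD ((hmem d₂).2 (by simp)).2 h2.1 h2.2.1,
    edgeLabels_eq hD ((hmem d₁).2 (by simp)).2 h1.1 h1.2.1⟩
  ext e
  refine (and_congr_right fun _ => graphPlus_present_iff).trans ((hmem e).trans ?_)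
  change e = d₁ ∨ e = d₂ ∨ e = d₃ ↔ e = d₃ ∨ e = d₂ ∨ e = d₁
  tauto

theorem HasPerm.unique {ρ ρ' : Equiv.Perm (Fin (k + m))} (h : D.HasPerm ρ) (h' : D.HasPerm ρ') :
    ρ = ρ' := by
  ext1 x
  rcases D.eq_rowLabel_or_eq_colLabel x with ⟨r, rfl⟩ | ⟨c, rfl⟩
  · rw [h.1, h'.1]
  · rw [h.2, h'.2]

end Soliton

end LeDiagram

-- The main theorem

theorem mainTheorem8 (k m : ℕ) (κ : Fin (k + m) → ℝ) (hκ : StrictMono κ)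
    (M : Finset (Finset (Fin (k + m)))) (hM : IsIrreduciblePositroid k M)
    (π : Equiv.Perm (Fin (k + m))) (hπ : HasNecklacePerm M π)
    (L Ldual : LeDiagram k m) (hL : L.HasPerm π) (hdual : L.IsDual Ldual)
    (G : PlabicGraph (k + m)) (hG : G = LeDiagram.graphPlus π Ldual) :
    -- the trip permutation
    G.HasTripPerm π ∧
    -- each edge gets a label `[i, j]`
    (∀ d, G.Present d → ∃ i j, i < j ∧ G.edgeLabels d = {i, j}) ∧
    -- each internal vertex is trivalent, with edges `[i, a]`, `[i, b]`, `[a, b]`, and its position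
    (∀ v, G.IsVertex v → ∃ i a b, i < a ∧ a < b ∧
      G.position κ v = (κ i * κ a + κ i * κ b + κ a * κ b, - (κ i + κ a + κ b)) ∧
      ∃ d₁ d₂ d₃, {d | G.base d = .inl v ∧ G.Present d} = {d₁, d₂, d₃} ∧
        G.edgeLabels d₁ = {i, a} ∧ G.edgeLabels d₂ = {i, b} ∧ G.edgeLabels d₃ = {a, b}) ∧
    -- distinct vertices are `x_{i,a,b}` for distinct triples
    (∀ v w, G.IsVertex v → G.IsVertex w → G.vertexLabels v = G.vertexLabels w → v = w) ∧
    -- an edge labelled `[i, j]` lies on the line `φ_i = φ_j` and is a line-soliton of type `[i, j]`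
    (∀ d e i j, G.Joined d e → i < j → G.edgeLabels d = {i, j} → ∀ p ∈ G.edgeSet κ d e,
      phase κ i p = phase κ j p ∧ IsBalanced κ M i j p) ∧
    -- distinct edges meet in at most one point
    (∀ d e d' e', G.Joined d e → G.Joined d' e' → d' ≠ d → d' ≠ e →
      (G.edgeSet κ d e ∩ G.edgeSet κ d' e').Subsingleton) ∧
    -- the edges form the contour plot
    contourPlot κ M = {p | ∃ d e, G.Joined d e ∧ p ∈ G.edgeSet κ d e} := by
  subst hG
  obtain ⟨⟨A, hA⟩, -⟩ := hM
  obtain ⟨π₀, hπ₀, hD⟩ := hdual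
  -- A Le-diagram determines its permutation, so the duality is witnessed by `π` itself.
  obtain rfl := hπ₀.unique hL
  have hrep := hA.represents
  -- Reversing the columns turns `π` into its dual, so it is the dual diagram that the reversed
  -- configuration realizes.
  have hreal : Ldual.IsRealizedBy fun l => A.col l.rev :=
    hD.isRealizedBy hA.nonCrossing (hπ.parallelMod_rev hrep)
  obtain ⟨κ', hκ'⟩ : ∃ κ' : Fin (k + m) → ℝ, ∀ l, κ' l = - κ l.rev := ⟨_, fun _ => rfl⟩
  have hmono : StrictMono κ' := fun a b hab => by
    rw [hκ', hκ', neg_lt_neg_iff]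
    exact hκ (Fin.rev_lt_rev.2 hab)
  refine ⟨LeDiagram.graphPlus_hasTripPerm hD hreal.vLabel_ne hreal.hLabel_ne, fun d hd => ?_,
    fun v hv => LeDiagram.exists_trivalent hD κ hv,
    fun v w hv hw h => LeDiagram.vertex_eq_of_vertexLabels_eq hD hv hw h,
    fun d e i j h hij hl p hp =>
      LeDiagram.phase_eq_and_isBalanced hrep hreal hD hκ' hmono h hij hl hp,
    fun d e d' e' h h' h1 h2 => LeDiagram.subsingleton_edgeSet_inter hD hκ' hmono h h' h1 h2,
    LeDiagram.contourPlot_eq hrep hreal hD hκ hκ' hmono⟩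
  have hess := LeDiagram.graphPlus_present_iff.1 hd
  obtain ⟨a, b, hab, ha, hb⟩ := LeDiagram.exists_lo_hi hess.1
  exact ⟨b.rev, a.rev, Fin.rev_lt_rev.2 hab, LeDiagram.edgeLabels_eq hD hess ha hb⟩
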